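/- For $\alpha>0$ and $u\in H^1(\mathbb{R}^2)\setminus\{0\}$, where $H^1(\mathbb{R}^2)=H^1(\mathbb{R}^2;\mathbb{C})$ is the Sobolev space of complex-valued functions and $\nabla u$ is the weak gradient, let $$F_\alpha(u)=\frac{\|\nabla u\|_{L^2}^{\frac{2}{1+\alpha}}\,\|u\|_{L^2}^{\frac{2+\alpha}{1+\alpha}}\,\|u\|_{L^6}^{\frac{3\alpha}{1+\alpha}}}{\|u\|_{L^4}^{4}},\qquad C_\alpha=\inf_{u\in H^1(\mathbb{R}^2)\setminus\{0\}}F_\alpha(u).$$ **Theorem.** Let $0<\alpha<\infty$. Then there is a continuous, radially symmetric function $Q_\alpha:\mathbb{R}^2\to\mathbb{R}$ in $H^1(\mathbb{R}^2)$ with $Q_\alpha(x)>0$ for all $x\in\mathbb{R}^2$ that minimizes $F_\alpha$ over $H^1(\mathbb{R}^2)\setminus\{0\}$, i.e. $F_\alpha(Q_\alpha)=C_\alpha$, and that satisfies, in the sense of distributions on $\mathbb{R}^2$, $$-\Delta Q_\alpha+Q_\alpha^5-Q_\alpha^3+\omega Q_\alpha=0\quad\text{with}\quad \omega=\frac{2+\alpha}{2}\,\frac{\|\nabla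 Q_\alpha\|_{L^2}^2}{\|Q_\alpha\|_{L^2}^2}.$$ Moreover, $$\frac{\int_{\mathbb{R}^2}|Q_\alpha|^6\,dx}{\int_{\mathbb{R}^2}|\nabla Q_\alpha|^2\,dx}=\frac32\alpha,\qquad C_\alpha=\frac{\left(\frac32\alpha\right)^{\frac{\alpha}{2(1+\alpha)}}}{2(1+\alpha)}\,\|Q_\alpha\|_{L^2}^{\frac{2+\alpha}{1+\alpha}}\,\|\nabla Q_\alpha\|_{L^2}^{-\frac{\alpha}{1+\alpha}}.$$ -/

import Mathlib

open MeasureTheory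
open scoped ContDiff

noncomputable section

namespace CubicQuintic

/-- The plane `ℝ²` with its Euclidean norm and Lebesgue measure. -/
abbrev Plane : Type := EuclideanSpace ℝ (Fin 2)

/-- A real test function on the plane: smooth with compact support. -/
def IsTestFunction (φ : Plane → ℝ) : Prop :=
  ContDiff ℝ ∞ φ ∧ HasCompactSupport φ

/-- `g` is a weak gradient of the complex-valued function `u` on the plane: both are locally
integrable and `∫ (∂ᵢφ) u = - ∫ φ gᵢ` for every test function `φ` and `i = 1, 2`. -/
def HasWeakGradient (u : Plane → ℂ) (g : Plane → EuclideanSpace ℂ (Fin 2)) : Prop :=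
  LocallyIntegrable u ∧ LocallyIntegrable g ∧
    ∀ φ : Plane → ℝ, IsTestFunction φ → ∀ i : Fin 2,
      ∫ x, fderiv ℝ φ x (EuclideanSpace.single i (1 : ℝ)) • u x = -∫ x, φ x • g x i

/-- A weak gradient is unique up to a set of measure zero. -/
theorem HasWeakGradient.ae_eq {u : Plane → ℂ} {g h : Plane → EuclideanSpace ℂ (Fin 2)}
    (hg : HasWeakGradient u g) (hh : HasWeakGradient u h) : g =ᵐ[volume] h := by
  have comp : ∀ {f : Plane → EuclideanSpace ℂ (Fin 2)}, LocallyIntegrable f → ∀ i : Fin 2,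
      LocallyIntegrable (fun x => f x i) := by
    intro f hf i x
    obtain ⟨s, hs, hfs⟩ := hf x
    exact ⟨s, hs, (EuclideanSpace.proj i : EuclideanSpace ℂ (Fin 2) →L[ℂ] ℂ).integrable_comp hfs⟩
  have key : ∀ i : Fin 2, (fun x => g x i) =ᵐ[volume] (fun x => h x i) := by
    intro i
    refine ae_eq_of_integral_contDiff_smul_eq (comp hg.2.1 i) (comp hh.2.1 i) ?_
    intro φ hφ hφc
    have h1 := hg.2.2 φ ⟨hφ, hφc⟩ i
    have h2 := hh.2.2 φ ⟨hφ, hφc⟩ i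
    exact neg_injective (h1.symm.trans h2)
  filter_upwards [key 0, key 1] with x h0 h1
  ext i
  fin_cases i
  · exact h0
  · exact h1

open scoped Classical in
/-- The weak gradient `∇u` (well defined up to a set of measure zero; `0` if there is none). -/
def weakGrad (u : Plane → ℂ) : Plane → EuclideanSpace ℂ (Fin 2) :=
  if h : ∃ g, HasWeakGradient u g then h.choose else 0

/-- Membership in the Sobolev space `H¹(ℝ²) = H¹(ℝ²; ℂ)`: square integrable, with a square
integrable weak gradient. -/
def MemH1 (u : Plane → ℂ) : Prop :=
  MemLp u 2 volume ∧ ∃ g, HasWeakGradient u g ∧ MemLp g 2 volume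

/-- `H¹(ℝ²) \ {0}`; functions that agree almost everywhere represent the same element. -/
def H1Nonzero : Set (Plane → ℂ) :=
  {u | MemH1 u ∧ ¬ u =ᵐ[volume] 0}

/-- `F_α(u) = ‖∇u‖₂^(2/(1+α)) ‖u‖₂^((2+α)/(1+α)) ‖u‖₆^(3α/(1+α)) / ‖u‖₄⁴`. -/
def F (α : ℝ) (u : Plane → ℂ) : ℝ :=
  lpNorm (weakGrad u) 2 volume ^ (2 / (1 + α)) * lpNorm u 2 volume ^ ((2 + α) / (1 + α)) *
    lpNorm u 6 volume ^ (3 * α / (1 + α)) / lpNorm u 4 volume ^ 4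

/-- `C_α`, the infimum of `F_α` over `H¹(ℝ²) \ {0}` (of a non-empty set of reals that is bounded
below by `0`). -/
def C (α : ℝ) : ℝ := sInf (F α '' H1Nonzero)

/-- `u` is a minimizer of `F_α` over `H¹(ℝ²) \ {0}`. -/
def IsMinimizer (α : ℝ) (u : Plane → ℂ) : Prop :=
  u ∈ H1Nonzero ∧ IsMinOn (F α) H1Nonzero u

/-- `β(u) = ∫ |u|⁶ / ∫ |∇u|²`. -/
def beta (u : Plane → ℂ) : ℝ :=
  (∫ x, ‖u x‖ ^ 6) / ∫ x, ‖weakGrad u x‖ ^ 2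

/-- `Q` is a distributional solution of `-ΔQ + Q⁵ - Q³ + w Q = 0` on the plane. -/
def IsSolution (w : ℝ) (Q : Plane → ℝ) : Prop :=
  LocallyIntegrable Q ∧ LocallyIntegrable (fun x => Q x ^ 3) ∧
    LocallyIntegrable (fun x => Q x ^ 5) ∧
    ∀ φ : Plane → ℝ, IsTestFunction φ →
      ∫ x, (-(Q x * Laplacian.laplacian φ x) + (Q x ^ 5 - Q x ^ 3 + w * Q x) * φ x) = 0

/-- A real-valued function on the plane, regarded as a complex-valued one. -/
def toComplex (Q : Plane → ℝ) : Plane → ℂ := fun x => (Q x : ℂ)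

/-- `Q` is radially symmetric: its value at `x` depends on `‖x‖` only. -/
def IsRadial (Q : Plane → ℝ) : Prop :=
  ∀ x y : Plane, ‖x‖ = ‖y‖ → Q x = Q y

end CubicQuintic

end

noncomputable section

namespace CubicQuintic

open Filter Topology Set
open scoped ENNReal NNReal RealInnerProductSpace

/-! ### Norms as integrals -/

/-! The functional depends only on A = ∫|∇u|², B = ∫|u|², D = ∫|u|⁶ and E = ∫|u|⁴ (`F_eq_quotient`),
and its exponents make it invariant under u ↦ s·u(l·) (`quotient_scale`). These two free parameters
are spent twice: to normalize a minimizing sequence by B = E = 1, and later to normalize the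
minimizer.

Compactness comes from symmetry. Smooth compactly supported functions are dense in H¹, and each can
be replaced by a nonnegative, radially decreasing Lipschitz function with the same power integrals
and no larger Dirichlet integral (`exists_symmetrization`). This symmetrization is obtained from
polarizations. A polarization preserves all the integrals involved, and unless w is already radially
decreasing some polarization strictly lowers the moment ∫|x|²w; hence a minimizer of the moment, in
a compact class stable under polarization, is radially decreasing. Helly selection then yields an
a.e. convergent minimizing subsequence. Radial monotonicity turns the L² and L⁶ bounds into
pointwise decay, which gives an integrable majorant of the fourth powers: E passes to the limit
exactly, while A, B and D can only drop. The limit is therefore a minimizer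
(`exists_radial_minimizer`).

Scaling the minimizer so that D = (3/2)αA and E = 2(1+α)A yields the ratio β at once, and the
formula for C_α by evaluating the quotient; no Pohozaev identity is needed. With the same
normalization, the vanishing of the first variation is precisely the stated equation
(`IsH1.euler_lagrange`).

Regularity is a one-dimensional matter. In the variable s = |x|² the equation for the profile f
reads 4s f′(s) = ∫₀ˢ (f⁵ − f³ + ωf). A monotone weak solution is a classical one
(`hasDerivAt_profile`); the L⁶ bound keeps f bounded at the origin (`exists_profile_bound`), so it
extends continuously; and a zero of f would propagate inwards by Grönwall, making f vanish
identically (`profile_pos`). -/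

theorem lpNorm_pow_eq_integral {X G : Type*} [MeasurableSpace X] {μ : Measure X}
    [NormedAddCommGroup G] {f : X → G} (hf : AEStronglyMeasurable f μ) (n : ℕ) (hn : n ≠ 0) :
    lpNorm f n μ ^ n = ∫ x, ‖f x‖ ^ n ∂μ := by
  have h := lpNorm_eq_integral_norm_rpow_toReal (p := (n : ℝ≥0∞)) (by exact_mod_cast hn)
    (by simp) hf
  rw [h]
  simp only [ENNReal.toReal_natCast, Real.rpow_natCast]
  exact Real.rpow_inv_natCast_pow (integral_nonneg fun x => by positivity) hn

theorem lpNorm_rpow_eq_integral {X G : Type*} [MeasurableSpace X] {μ : Measure X}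
    [NormedAddCommGroup G] {f : X → G} (hf : AEStronglyMeasurable f μ) (n : ℕ) (hn : n ≠ 0)
    (a : ℝ) : lpNorm f n μ ^ a = (∫ x, ‖f x‖ ^ n ∂μ) ^ (a / n) := by
  rw [← lpNorm_pow_eq_integral hf n hn, ← Real.rpow_natCast, ← Real.rpow_mul lpNorm_nonneg]
  congr 1
  field_simp

theorem lpNorm_congr_ae' {X G : Type*} [MeasurableSpace X] {μ : Measure X}
    [NormedAddCommGroup G] {f g : X → G} {p : ℝ≥0∞} (h : f =ᵐ[μ] g) :
    lpNorm f p μ = lpNorm g p μ := by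
  by_cases hf : AEStronglyMeasurable f μ
  · rw [← toReal_eLpNorm hf, ← toReal_eLpNorm (hf.congr h), eLpNorm_congr_ae h]
  · rw [lpNorm_of_not_aestronglyMeasurable hf,
      lpNorm_of_not_aestronglyMeasurable fun h' => hf (h'.congr h.symm)]

theorem memLp_iff_integrable_norm_pow {X G : Type*} [MeasurableSpace X] {μ : Measure X}
    [NormedAddCommGroup G] {f : X → G} (hf : AEStronglyMeasurable f μ) {n : ℕ} (hn : n ≠ 0) :
    MemLp f n μ ↔ Integrable (fun x => ‖f x‖ ^ n) μ := by
  rw [← integrable_norm_rpow_iff hf (by exact_mod_cast hn) (by simp)]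
  simp

/-! ### The weak gradient -/

/-- The value of the functional `F α` in terms of the four integrals that it involves. -/
def quotient (α A B D E : ℝ) : ℝ :=
  A ^ (1 / (1 + α)) * B ^ ((2 + α) / (2 * (1 + α))) * D ^ (α / (2 * (1 + α))) / E

variable {u : Plane → ℂ} {g : Plane → EuclideanSpace ℂ (Fin 2)}

theorem HasWeakGradient.weakGrad_ae_eq (h : HasWeakGradient u g) :
    weakGrad u =ᵐ[volume] g := by
  have hex : ∃ g, HasWeakGradient u g := ⟨g, h⟩
  rw [weakGrad, dif_pos hex]
  exact hex.choose_spec.ae_eq h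

theorem F_eq_quotient {α : ℝ} (h : HasWeakGradient u g) :
    F α u = quotient α (∫ x, ‖g x‖ ^ 2) (∫ x, ‖u x‖ ^ 2) (∫ x, ‖u x‖ ^ 6) (∫ x, ‖u x‖ ^ 4) := by
  have hu := h.1.aestronglyMeasurable
  have hg := h.2.1.aestronglyMeasurable
  have e4 := lpNorm_pow_eq_integral hu 4 (by norm_num)
  have e2 := fun a => lpNorm_rpow_eq_integral hu 2 (by norm_num) a
  have e6 := fun a => lpNorm_rpow_eq_integral hu 6 (by norm_num) a
  have eg := fun a => lpNorm_rpow_eq_integral hg 2 (by norm_num) a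
  norm_num at e4 e2 e6 eg
  rw [F, quotient, lpNorm_congr_ae' h.weakGrad_ae_eq, e4, e2, e6, eg]
  congr 3
  · congr 1
    ring
  · rw [div_div, mul_comm (1 + α)]
  · rw [div_div, show (1 + α) * 6 = 3 * (2 * (1 + α)) by ring,
      mul_div_mul_left _ _ (by norm_num)]

theorem IsTestFunction.contDiff {φ : Plane → ℝ} (h : IsTestFunction φ) : ContDiff ℝ ∞ φ := h.1

theorem IsTestFunction.continuous {φ : Plane → ℝ} (h : IsTestFunction φ) : Continuous φ :=
  h.1.continuous

theorem IsTestFunction.differentiable {φ : Plane → ℝ} (h : IsTestFunction φ) :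
    Differentiable ℝ φ := h.1.differentiable (by simp)

theorem IsTestFunction.fderiv_apply {φ : Plane → ℝ} (h : IsTestFunction φ) (v : Plane) :
    IsTestFunction (fun x => fderiv ℝ φ x v) :=
  ⟨(h.1.fderiv_right (m := ∞) (by simp)).clm_apply contDiff_const, h.2.fderiv_apply ℝ v⟩

theorem IsTestFunction.integrable_smul {G : Type*} [NormedAddCommGroup G] [NormedSpace ℝ G]
    {φ : Plane → ℝ} (h : IsTestFunction φ) {f : Plane → G} (hf : LocallyIntegrable f) :
    Integrable (fun x => φ x • f x) :=
  hf.integrable_smul_left_of_hasCompactSupport h.continuous h.2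

theorem _root_.MeasureTheory.LocallyIntegrable.euclidean_apply {n : ℕ}
    {f : Plane → EuclideanSpace ℂ (Fin n)}
    (hf : LocallyIntegrable f) (i : Fin n) : LocallyIntegrable (fun x => f x i) := by
  intro x
  obtain ⟨s, hs, hfs⟩ := hf x
  exact ⟨s, hs, (EuclideanSpace.proj i : EuclideanSpace ℂ (Fin n) →L[ℂ] ℂ).integrable_comp hfs⟩

theorem HasWeakGradient.congr {u' : Plane → ℂ} {g' : Plane → EuclideanSpace ℂ (Fin 2)}
    (h : HasWeakGradient u g) (hu : u =ᵐ[volume] u') (hg : g =ᵐ[volume] g') :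
    HasWeakGradient u' g' := by
  refine ⟨h.1.congr hu, h.2.1.congr hg, fun φ hφ i => ?_⟩
  have h1 := h.2.2 φ hφ i
  have e1 : ∫ x, fderiv ℝ φ x (EuclideanSpace.single i (1 : ℝ)) • u' x
      = ∫ x, fderiv ℝ φ x (EuclideanSpace.single i (1 : ℝ)) • u x := by
    refine integral_congr_ae ?_
    filter_upwards [hu] with x hx
    rw [hx]
  have e2 : ∫ x, φ x • g' x i = ∫ x, φ x • g x i := by
    refine integral_congr_ae ?_
    filter_upwards [hg] with x hx
    rw [hx]
  rw [e1, e2, h1]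

theorem HasWeakGradient.add {u' : Plane → ℂ} {g' : Plane → EuclideanSpace ℂ (Fin 2)}
    (h : HasWeakGradient u g) (h' : HasWeakGradient u' g') :
    HasWeakGradient (u + u') (g + g') := by
  refine ⟨h.1.add h'.1, h.2.1.add h'.2.1, fun φ hφ i => ?_⟩
  simp only [Pi.add_apply, smul_add, PiLp.add_apply]
  rw [integral_add ((hφ.fderiv_apply _).integrable_smul h.1)
      ((hφ.fderiv_apply _).integrable_smul h'.1),
    integral_add (hφ.integrable_smul (h.2.1.euclidean_apply i))
      (hφ.integrable_smul (h'.2.1.euclidean_apply i)), h.2.2 φ hφ i, h'.2.2 φ hφ i]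
  ring

theorem HasWeakGradient.const_smul (h : HasWeakGradient u g) (c : ℝ) :
    HasWeakGradient (c • u) (c • g) := by
  refine ⟨h.1.smul c, h.2.1.smul c, fun φ hφ i => ?_⟩
  have e := h.2.2 φ hφ i
  simp only [Pi.smul_apply, PiLp.smul_apply]
  simp_rw [smul_comm _ c]
  rw [integral_smul, integral_smul, e, smul_neg]

/-- The gradient of a classically differentiable complex-valued function. -/
def grad (v : Plane → ℂ) (x : Plane) : EuclideanSpace ℂ (Fin 2) :=
  WithLp.toLp 2 fun i => fderiv ℝ v x (EuclideanSpace.single i (1 : ℝ))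

@[simp] theorem grad_apply (v : Plane → ℂ) (x : Plane) (i : Fin 2) :
    grad v x i = fderiv ℝ v x (EuclideanSpace.single i (1 : ℝ)) := rfl

theorem norm_grad_sq (v : Plane → ℂ) (x : Plane) :
    ‖grad v x‖ ^ 2 = ∑ i, ‖fderiv ℝ v x (EuclideanSpace.single i (1 : ℝ))‖ ^ 2 := by
  rw [EuclideanSpace.norm_sq_eq]
  rfl

theorem continuous_grad {v : Plane → ℂ} (hv : ContDiff ℝ ∞ v) : Continuous (grad v) := by
  refine (PiLp.continuous_toLp 2 _).comp (continuous_pi fun i => ?_)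
  exact (hv.continuous_fderiv (by simp)).clm_apply continuous_const

theorem hasCompactSupport_grad {v : Plane → ℂ} (hv : HasCompactSupport v) :
    HasCompactSupport (grad v) := by
  refine (hv.fderiv ℝ).mono fun x hx => ?_
  contrapose! hx
  rw [Function.notMem_support] at hx
  rw [Function.notMem_support]
  ext i
  simp [hx]

theorem hasWeakGradient_grad {v : Plane → ℂ} (hv : ContDiff ℝ ∞ v) :
    HasWeakGradient v (grad v) := by
  refine ⟨hv.continuous.locallyIntegrable, (continuous_grad hv).locallyIntegrable,
    fun φ hφ i => ?_⟩
  have hd : Continuous fun x => fderiv ℝ v x (EuclideanSpace.single i (1 : ℝ)) :=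
    (hv.continuous_fderiv (by simp)).clm_apply continuous_const
  have := integral_smul_fderiv_eq_neg_fderiv_smul_of_integrable (μ := (volume : Measure Plane))
    (f := φ) (g := v) (v := EuclideanSpace.single i (1 : ℝ))
    ((hφ.fderiv_apply _).integrable_smul hv.continuous.locallyIntegrable)
    (hφ.integrable_smul hd.locallyIntegrable)
    (hφ.integrable_smul hv.continuous.locallyIntegrable)
    (fun x _ => hφ.differentiable x) (fun x _ => hv.differentiable (by simp) x)
  simp only [grad_apply]
  rw [this, neg_neg]

/-! ### Real Lipschitz functions -/

theorem sum_sq_apply_single (L : Plane →L[ℝ] ℝ) :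
    ∑ i, L (EuclideanSpace.single i (1 : ℝ)) ^ 2 = ‖L‖ ^ 2 := by
  obtain ⟨y, rfl⟩ := (InnerProductSpace.toDual ℝ Plane).surjective L
  rw [LinearIsometryEquiv.norm_map, EuclideanSpace.norm_sq_eq]
  refine Finset.sum_congr rfl fun i _ => ?_
  rw [InnerProductSpace.toDual_apply_apply, EuclideanSpace.inner_single_right]
  simp

/-- The gradient of a real function, as a complex vector field. -/
def gradReal (v : Plane → ℝ) (x : Plane) : EuclideanSpace ℂ (Fin 2) :=
  WithLp.toLp 2 fun i => ((fderiv ℝ v x (EuclideanSpace.single i (1 : ℝ)) : ℝ) : ℂ)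

theorem norm_gradReal_sq (v : Plane → ℝ) (x : Plane) : ‖gradReal v x‖ ^ 2 = ‖fderiv ℝ v x‖ ^ 2 := by
  rw [EuclideanSpace.norm_sq_eq, ← sum_sq_apply_single]
  refine Finset.sum_congr rfl fun i _ => ?_
  simp [gradReal]

theorem norm_gradReal (v : Plane → ℝ) (x : Plane) : ‖gradReal v x‖ = ‖fderiv ℝ v x‖ :=
  (sq_eq_sq₀ (norm_nonneg _) (norm_nonneg _)).1 (norm_gradReal_sq v x)

theorem measurable_gradReal (v : Plane → ℝ) : Measurable (gradReal v) := by
  refine (PiLp.continuous_toLp 2 _).measurable.comp (measurable_pi_lambda _ fun i => ?_)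
  exact Complex.measurable_ofReal.comp (measurable_fderiv_apply_const ℝ v _)

/-- By Rademacher the classical gradient exists a.e., and Lipschitz functions may be integrated by
parts along each coordinate direction. The Lipschitz class is needed because polarization destroys
smoothness but preserves Lipschitz constants. -/
theorem hasWeakGradient_gradReal {v : Plane → ℝ} {L : ℝ≥0} (hv : LipschitzWith L v) :
    HasWeakGradient (toComplex v) (gradReal v) := by
  have hbd : ∀ x, ‖gradReal v x‖ ≤ L := fun x => by
    rw [norm_gradReal]
    exact norm_fderiv_le_of_lipschitz ℝ hv
  have hgl : LocallyIntegrable (gradReal v) :=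
    (memLp_top_of_bound (measurable_gradReal v).aestronglyMeasurable L
      (.of_forall hbd)).locallyIntegrable le_top
  refine ⟨(Complex.continuous_ofReal.comp hv.continuous).locallyIntegrable, hgl,
    fun φ hφ i => ?_⟩
  obtain ⟨D, hD⟩ := hφ.1.lipschitzWith_of_hasCompactSupport hφ.2 (by simp)
  have key := hv.integral_lineDeriv_mul_eq (μ := (volume : Measure Plane)) hD hφ.2
    (EuclideanSpace.single i (1 : ℝ))
  have e1 : ∫ x, fderiv ℝ φ x (EuclideanSpace.single i (1 : ℝ)) • toComplex v x
      = ((∫ x, fderiv ℝ φ x (EuclideanSpace.single i (1 : ℝ)) * v x : ℝ) : ℂ) := by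
    rw [← integral_complex_ofReal]
    simp [toComplex]
  have e2 : ∫ x, φ x • gradReal v x i
      = ((∫ x, φ x * fderiv ℝ v x (EuclideanSpace.single i (1 : ℝ)) : ℝ) : ℂ) := by
    rw [← integral_complex_ofReal]
    simp [gradReal]
  rw [e1, e2, ← Complex.ofReal_neg]
  congr 1
  have e3 : ∫ x, φ x * fderiv ℝ v x (EuclideanSpace.single i (1 : ℝ))
      = ∫ x, lineDeriv ℝ v x (EuclideanSpace.single i (1 : ℝ)) * φ x := by
    refine integral_congr_ae ?_
    filter_upwards [hv.ae_differentiableAt (μ := (volume : Measure Plane))] with x hx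
    rw [hx.lineDeriv_eq_fderiv, mul_comm]
  rw [e3, key, ← integral_neg]
  refine integral_congr_ae (.of_forall fun x => ?_)
  simp only
  rw [(hφ.differentiable x).lineDeriv_eq_fderiv]
  simp

/-! ### Scaling -/

theorem integral_comp_smul_plane {G : Type*} [NormedAddCommGroup G] [NormedSpace ℝ G]
    (f : Plane → G) {l : ℝ} (hl : 0 < l) : ∫ x, f (l • x) = (l ^ 2)⁻¹ • ∫ x, f x := by
  rw [Measure.integral_comp_smul]
  simp [abs_of_pos, hl]

theorem _root_.MeasureTheory.LocallyIntegrable.comp_smul_plane {G : Type*} [NormedAddCommGroup G]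
    {f : Plane → G} (hf : LocallyIntegrable f) {l : ℝ} (hl : l ≠ 0) :
    LocallyIntegrable (fun x => f (l • x)) := by
  rw [locallyIntegrable_iff] at hf ⊢
  intro k hk
  have hk' : IsCompact ((fun x : Plane => l • x) '' k) := hk.image (by fun_prop)
  have h1 := (integrable_indicator_iff hk'.measurableSet).2 (hf _ hk')
  have h2 := (integrable_comp_smul_iff (volume : Measure Plane)
    (((fun x : Plane => l • x) '' k).indicator f) hl).2 h1
  rw [← integrable_indicator_iff hk.measurableSet]
  refine h2.congr (.of_forall fun x => ?_)
  simp only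
  by_cases hx : x ∈ k
  · rw [indicator_of_mem hx, indicator_of_mem (mem_image_of_mem _ hx)]
  · rw [indicator_of_notMem hx, indicator_of_notMem]
    rintro ⟨y, hy, hxy⟩
    exact hx (smul_right_injective Plane hl hxy ▸ hy)

theorem HasWeakGradient.scale (h : HasWeakGradient u g) (s : ℝ) {l : ℝ} (hl : 0 < l) :
    HasWeakGradient (fun x => s • u (l • x)) (fun x => (s * l) • g (l • x)) := by
  refine ⟨(h.1.comp_smul_plane hl.ne').smul s, (h.2.1.comp_smul_plane hl.ne').smul (s * l),
    fun φ hφ i => ?_⟩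
  set φ' : Plane → ℝ := fun x => φ (l⁻¹ • x) with hφ'
  have ht : IsTestFunction φ' := by
    refine ⟨hφ.1.comp (contDiff_const_smul _), ?_⟩
    exact hφ.2.comp_homeomorph (Homeomorph.smulOfNeZero l⁻¹ (inv_ne_zero hl.ne'))
  have hd : ∀ y v, fderiv ℝ φ' y v = l⁻¹ • fderiv ℝ φ (l⁻¹ • y) v := by
    intro y v
    have h1 : HasFDerivAt φ' ((fderiv ℝ φ (l⁻¹ • y)).comp
        (l⁻¹ • ContinuousLinearMap.id ℝ Plane)) y :=
      (hφ.differentiable (l⁻¹ • y)).hasFDerivAt.comp y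
        ((hasFDerivAt_id y).const_smul l⁻¹)
    rw [h1.fderiv]
    simp
  have key := h.2.2 φ' ht i
  have e1 := integral_comp_smul_plane
    (fun y => fderiv ℝ φ (l⁻¹ • y) (EuclideanSpace.single i (1 : ℝ)) • u y) hl
  have e2 := integral_comp_smul_plane (fun y => φ (l⁻¹ • y) • g y i) hl
  simp only [smul_smul, inv_mul_cancel₀ hl.ne', one_smul] at e1 e2
  simp only [hd, smul_assoc] at key
  rw [integral_smul] at key
  simp only [smul_comm _ s, PiLp.smul_apply, smul_comm _ (s * l)]
  rw [integral_smul, integral_smul, e1, e2, ← neg_eq_iff_eq_neg.2 key]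
  simp only [smul_neg, Complex.real_smul]
  simp only [Complex.ofReal_mul, Complex.ofReal_inv]
  have : (l : ℂ) ≠ 0 := by exact_mod_cast hl.ne'
  field_simp

theorem integral_norm_pow_scale {G : Type*} [NormedAddCommGroup G] [NormedSpace ℝ G]
    (f : Plane → G) (s : ℝ) {l : ℝ} (hl : 0 < l) (n : ℕ) :
    ∫ x, ‖s • f (l • x)‖ ^ n = |s| ^ n / l ^ 2 * ∫ x, ‖f x‖ ^ n := by
  simp only [norm_smul, mul_pow, Real.norm_eq_abs]
  rw [integral_const_mul, integral_comp_smul_plane (fun x => ‖f x‖ ^ n) hl, smul_eq_mul]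
  ring

end CubicQuintic

end

noncomputable section

namespace CubicQuintic

open Filter Topology Set
open scoped ENNReal NNReal RealInnerProductSpace

/-! ### Density of smooth compactly supported functions -/

open ContinuousLinearMap in
open scoped Convolution in
-- Convolution with ρ averages translates of f against the probability measure ρ dt. Cauchy–Schwarz
-- for that measure, Tonelli and translation invariance give the bound.
theorem lintegral_enorm_mollify_sq_le {G : Type*} [NormedAddCommGroup G] [NormedSpace ℝ G]
    {ρ : Plane → ℝ} (hρ : Continuous ρ) (h0 : ∀ x, 0 ≤ ρ x) (hi : Integrable ρ)
    (h1 : ∫ x, ρ x = 1) {f : Plane → G} (hf : StronglyMeasurable f) :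
    ∫⁻ x, ‖(ρ ⋆[lsmul ℝ ℝ, volume] f) x‖ₑ ^ 2 ≤ ∫⁻ x, ‖f x‖ₑ ^ 2 := by
  set ν : Measure Plane := volume.withDensity fun t => ENNReal.ofReal (ρ t) with hν
  have hρm : Measurable fun t => ENNReal.ofReal (ρ t) := hρ.measurable.ennreal_ofReal
  have hν1 : ν univ = 1 := by
    rw [hν, withDensity_apply _ MeasurableSet.univ, Measure.restrict_univ,
      ← ofReal_integral_eq_lintegral_ofReal hi (.of_forall h0), h1, ENNReal.ofReal_one]
  have hfin : IsFiniteMeasure ν := ⟨by rw [hν1]; exact ENNReal.one_lt_top⟩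
  have hpt : ∀ x, ‖(ρ ⋆[lsmul ℝ ℝ, volume] f) x‖ₑ ^ 2 ≤ ∫⁻ t, ‖f (x - t)‖ₑ ^ 2 ∂ν := by
    intro x
    have hm : Measurable fun t => ‖f (x - t)‖ₑ :=
      (hf.comp_measurable (measurable_const.sub measurable_id)).enorm
    have e1 : ‖(ρ ⋆[lsmul ℝ ℝ, volume] f) x‖ₑ ≤ ∫⁻ t, ‖f (x - t)‖ₑ ∂ν := by
      rw [convolution_def, hν, lintegral_withDensity_eq_lintegral_mul _ hρm hm]
      refine (enorm_integral_le_lintegral_enorm _).trans (lintegral_mono fun t => ?_)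
      simp only [lsmul_apply, enorm_smul, Pi.mul_apply]
      rw [Real.enorm_of_nonneg (h0 t)]
    have e2 := ENNReal.lintegral_mul_le_Lp_mul_Lq ν Real.HolderConjugate.two_two
      hm.aemeasurable (g := fun _ => 1) aemeasurable_const
    simp only [Pi.mul_apply, mul_one, ENNReal.one_rpow, lintegral_const, hν1] at e2
    calc ‖(ρ ⋆[lsmul ℝ ℝ, volume] f) x‖ₑ ^ 2 ≤ ((∫⁻ t, ‖f (x - t)‖ₑ ^ (2 : ℝ) ∂ν) ^ (1 / 2 : ℝ)) ^ 2 := by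
          gcongr
          exact e1.trans e2
      _ = ∫⁻ t, ‖f (x - t)‖ₑ ^ 2 ∂ν := by
          rw [← ENNReal.rpow_natCast, ← ENNReal.rpow_mul]
          norm_num
  calc ∫⁻ x, ‖(ρ ⋆[lsmul ℝ ℝ, volume] f) x‖ₑ ^ 2
      ≤ ∫⁻ x, ∫⁻ t, ‖f (x - t)‖ₑ ^ 2 ∂ν := lintegral_mono hpt
    _ = ∫⁻ t, (∫⁻ x, ‖f (x - t)‖ₑ ^ 2) ∂ν := by
        have hm : Measurable (Function.uncurry fun (x t : Plane) => ‖f (x - t)‖ₑ ^ 2) :=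
          ((hf.comp_measurable (measurable_fst.sub measurable_snd)).enorm).pow_const 2
        exact lintegral_lintegral_swap hm.aemeasurable
    _ = ∫⁻ x, ‖f x‖ₑ ^ 2 := by
        rw [lintegral_congr fun t =>
          lintegral_sub_right_eq_self (μ := (volume : Measure Plane)) (fun x => ‖f x‖ₑ ^ 2) t,
          lintegral_const, hν1, mul_one]

theorem tendsto_zero_of_add_le_of_le_liminf {a b : ℕ → ℝ≥0∞} {c : ℝ≥0∞} (hc : c ≠ ⊤)
    (hab : ∀ n, a n + b n ≤ c) (hl : c ≤ liminf a atTop) : Tendsto b atTop (𝓝 0) := by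
  rw [ENNReal.tendsto_nhds_zero]
  intro ε hε
  rcases eq_or_ne c 0 with rfl | hc0
  · exact .of_forall fun n => (le_add_self.trans (hab n)).trans zero_le
  · have hlt : c - ε < liminf a atTop := (ENNReal.sub_lt_self hc hc0 hε.ne').trans_le hl
    filter_upwards [eventually_lt_of_lt_liminf hlt] with n hn
    have han : a n ≠ ⊤ := ne_top_of_le_ne_top hc (le_self_add.trans (hab n))
    have h1 : c ≤ a n + ε := tsub_le_iff_right.1 hn.le
    exact (ENNReal.add_le_add_iff_left han).1 ((hab n).trans h1)

/-- Fatou is applied to H n = 2|F n|² + 2|f|² − |F n − f|² ≥ 0, which tends to 4|f|². The norm bound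
leaves at most 4∫|f|² for ∫H n + ∫|F n − f|², so the second term must vanish in the limit. This
serves both mollification and truncation. -/
theorem tendsto_lintegral_sub_sq_of_ae {G X : Type*} [NormedAddCommGroup G] [MeasurableSpace X]
    {μ : Measure X} {f : X → G}
    {F : ℕ → X → G} (hf : AEStronglyMeasurable f μ)
    (hF : ∀ n, AEStronglyMeasurable (F n) μ)
    (hfin : ∫⁻ x, ‖f x‖ₑ ^ 2 ∂μ ≠ ⊤) (hle : ∀ n, ∫⁻ x, ‖F n x‖ₑ ^ 2 ∂μ ≤ ∫⁻ x, ‖f x‖ₑ ^ 2 ∂μ)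
    (hae : ∀ᵐ x ∂μ, Tendsto (fun n => F n x) atTop (𝓝 (f x))) :
    Tendsto (fun n => ∫⁻ x, ‖F n x - f x‖ₑ ^ 2 ∂μ) atTop (𝓝 0) := by
  have hpt : ∀ a b : G, ‖a - b‖ₑ ^ 2 ≤ 2 * ‖a‖ₑ ^ 2 + 2 * ‖b‖ₑ ^ 2 := by
    intro a b
    have h1 : ‖a - b‖ ^ 2 ≤ 2 * ‖a‖ ^ 2 + 2 * ‖b‖ ^ 2 := by
      have := norm_sub_le a b
      nlinarith [sq_nonneg (‖a‖ - ‖b‖), norm_nonneg (a - b), norm_nonneg a, norm_nonneg b]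
    have h2 := ENNReal.ofReal_le_ofReal h1
    rw [ENNReal.ofReal_add (by positivity) (by positivity), ENNReal.ofReal_mul (by norm_num),
      ENNReal.ofReal_mul (by norm_num), ENNReal.ofReal_pow (norm_nonneg _),
      ENNReal.ofReal_pow (norm_nonneg _), ENNReal.ofReal_pow (norm_nonneg _)] at h2
    simpa using h2
  set I := ∫⁻ x, ‖f x‖ₑ ^ 2 ∂μ
  have hfm : AEMeasurable (fun x => ‖f x‖ₑ ^ 2) μ := hf.enorm.pow_const 2
  have hFm : ∀ n, AEMeasurable (fun x => ‖F n x‖ₑ ^ 2) μ := fun n => (hF n).enorm.pow_const 2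
  have hdm : ∀ n, AEMeasurable (fun x => ‖F n x - f x‖ₑ ^ 2) μ :=
    fun n => ((hF n).sub hf).enorm.pow_const 2
  set H : ℕ → X → ℝ≥0∞ := fun n x => 2 * ‖F n x‖ₑ ^ 2 + 2 * ‖f x‖ₑ ^ 2 - ‖F n x - f x‖ₑ ^ 2
  have hHm : ∀ n, AEMeasurable (H n) μ := fun n =>
    (((hFm n).const_mul 2).add (hfm.const_mul 2)).sub (hdm n)
  refine tendsto_zero_of_add_le_of_le_liminf (a := fun n => ∫⁻ x, H n x ∂μ) (c := 4 * I)
    (ENNReal.mul_ne_top (by norm_num) hfin) (fun n => ?_) ?_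
  · rw [← lintegral_add_right' _ (hdm n)]
    have : ∀ x, H n x + ‖F n x - f x‖ₑ ^ 2 = 2 * ‖F n x‖ₑ ^ 2 + 2 * ‖f x‖ₑ ^ 2 := fun x =>
      tsub_add_cancel_of_le (hpt _ _)
    simp only [this]
    rw [lintegral_add_left' ((hFm n).const_mul 2), lintegral_const_mul'' _ (hFm n),
      lintegral_const_mul'' _ hfm]
    calc 2 * ∫⁻ x, ‖F n x‖ₑ ^ 2 ∂μ + 2 * I ≤ 2 * I + 2 * I := by
          gcongr
          exact hle n
      _ = 4 * I := by ring
  · calc 4 * I = ∫⁻ x, 4 * ‖f x‖ₑ ^ 2 ∂μ := (lintegral_const_mul'' _ hfm).symm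
      _ = ∫⁻ x, liminf (fun n => H n x) atTop ∂μ := by
          refine lintegral_congr_ae ?_
          filter_upwards [hae] with x hx
          have t1 : Tendsto (fun n => ‖F n x‖ₑ ^ 2) atTop (𝓝 (‖f x‖ₑ ^ 2)) :=
            ((ENNReal.continuous_pow 2).tendsto _).comp hx.enorm
          have t2 : Tendsto (fun n => ‖F n x - f x‖ₑ ^ 2) atTop (𝓝 0) := by
            have := ((ENNReal.continuous_pow 2).tendsto _).comp (hx.sub_const (f x)).enorm
            simpa [Function.comp_def] using this
          have t3 : Tendsto (fun n => H n x) atTop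
              (𝓝 (2 * ‖f x‖ₑ ^ 2 + 2 * ‖f x‖ₑ ^ 2 - 0)) := by
            refine ENNReal.Tendsto.sub ?_ t2 (Or.inr (by simp))
            exact (ENNReal.Tendsto.const_mul t1 (Or.inr (by norm_num))).add tendsto_const_nhds
          rw [t3.liminf_eq, tsub_zero]
          ring
      _ ≤ liminf (fun n => ∫⁻ x, H n x ∂μ) atTop := lintegral_liminf_le' hHm

theorem eLpNorm_two_eq {G X : Type*} [NormedAddCommGroup G] [MeasurableSpace X]
    {μ : Measure X} (f : X → G) : eLpNorm f 2 μ = (∫⁻ x, ‖f x‖ₑ ^ 2 ∂μ) ^ (1 / 2 : ℝ) := by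
  rw [eLpNorm_eq_lintegral_rpow_enorm_toReal (by norm_num) (by norm_num)]
  simp

open ContinuousLinearMap in
open scoped Convolution in
-- The derivative of the convolution falls on ρ, and y ↦ ρ (x - y) is itself a test function for the
-- weak gradient of u.
theorem grad_mollify {u : Plane → ℂ} {g : Plane → EuclideanSpace ℂ (Fin 2)}
    (h : HasWeakGradient u g) {ρ : Plane → ℝ} (hρ : IsTestFunction ρ) :
    grad (ρ ⋆[lsmul ℝ ℝ, volume] u) = ρ ⋆[lsmul ℝ ℝ, volume] g := by
  ext x i
  have hconv : ConvolutionExistsAt ρ g x (lsmul ℝ ℝ) volume :=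
    hρ.2.convolutionExists_left _ hρ.continuous h.2.1 x
  have hconv' : ConvolutionExistsAt (fderiv ℝ ρ) u x ((lsmul ℝ ℝ).precompL Plane) volume :=
    (hρ.2.fderiv ℝ).convolutionExists_left _ (hρ.1.continuous_fderiv (by simp)) h.1 x
  have e0 := (hρ.2.hasFDerivAt_convolution_left (lsmul ℝ ℝ : ℝ →L[ℝ] ℂ →L[ℝ] ℂ)
    (hρ.1.of_le (by simp)) h.1 x).fderiv
  rw [grad_apply, e0, convolution_def, convolution_def,
    ContinuousLinearMap.integral_apply hconv']
  have e1 : (∫ t, (lsmul ℝ ℝ (ρ t)) (g (x - t))) i = ∫ t, ρ t • g (x - t) i :=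
    ((EuclideanSpace.proj i : EuclideanSpace ℂ (Fin 2) →L[ℂ] ℂ).integral_comp_comm hconv).symm
  rw [e1]
  set φ : Plane → ℝ := fun y => ρ (x - y)
  have hφ : IsTestFunction φ :=
    ⟨hρ.1.comp (contDiff_const.sub contDiff_id), hρ.2.comp_homeomorph (Homeomorph.subLeft x)⟩
  have hd : ∀ y v, fderiv ℝ φ y v = -fderiv ℝ ρ (x - y) v := by
    intro y v
    have h1 : HasFDerivAt φ ((fderiv ℝ ρ (x - y)).comp (-ContinuousLinearMap.id ℝ Plane)) y :=
      (hρ.differentiable (x - y)).hasFDerivAt.comp y ((hasFDerivAt_id y).const_sub x)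
    rw [h1.fderiv]
    simp
  have key := h.2.2 φ hφ i
  simp only [hd, neg_smul, integral_neg, neg_inj] at key
  have e2 := integral_sub_left_eq_self
    (fun y => fderiv ℝ ρ (x - y) (EuclideanSpace.single i (1 : ℝ)) • u y) volume x
  have e3 := integral_sub_left_eq_self (fun y => φ y • g y i) volume x
  simp only [φ, sub_sub_cancel] at e2 e3
  rw [e3, ← key, ← e2]
  simp

open ContinuousLinearMap in
open scoped Convolution in
theorem tendsto_eLpNorm_mollify_sub {G : Type*} [NormedAddCommGroup G] [NormedSpace ℝ G]
    [CompleteSpace G] {f : Plane → G} (hf : StronglyMeasurable f) (hf2 : MemLp f 2 volume)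
    (φ : ℕ → ContDiffBump (0 : Plane)) (hφ : Tendsto (fun n => (φ n).rOut) atTop (𝓝 0))
    (hφ' : ∀ n, (φ n).rOut ≤ 2 * (φ n).rIn) :
    Tendsto (fun n => eLpNorm ((φ n).normed volume ⋆[lsmul ℝ ℝ, volume] f - f) 2 volume)
      atTop (𝓝 0) := by
  have hloc : LocallyIntegrable f := hf2.locallyIntegrable (by norm_num)
  have hae := ContDiffBump.ae_convolution_tendsto_right_of_locallyIntegrable hφ
    (.of_forall hφ') hloc
  have hfin : ∫⁻ x, ‖f x‖ₑ ^ 2 ≠ ⊤ := by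
    have := hf2.eLpNorm_ne_top
    rw [eLpNorm_two_eq] at this
    intro h
    rw [h] at this
    simp at this
  have hc : ∀ n, Continuous ((φ n).normed volume ⋆[lsmul ℝ ℝ, volume] f) := fun n =>
    ((φ n).hasCompactSupport_normed).continuous_convolution_left _ (φ n).continuous_normed hloc
  have := tendsto_lintegral_sub_sq_of_ae hf2.1 (fun n => (hc n).aestronglyMeasurable) hfin
    (fun n => lintegral_enorm_mollify_sq_le (φ n).continuous_normed (φ n).nonneg_normed
      (φ n).integrable_normed (φ n).integral_normed hf) hae
  simp only [eLpNorm_two_eq, Pi.sub_apply]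
  have h0 := ((ENNReal.continuous_rpow_const (y := (1 / 2 : ℝ))).tendsto 0).comp this
  simpa [Function.comp_def] using h0

open ContinuousLinearMap in
open scoped Convolution in
theorem exists_smooth_approx_of_hasCompactSupport {u : Plane → ℂ}
    {g : Plane → EuclideanSpace ℂ (Fin 2)} (h : HasWeakGradient u g)
    (hum : StronglyMeasurable u) (hgm : StronglyMeasurable g)
    (hu : MemLp u 2 volume) (hg : MemLp g 2 volume) (hc : HasCompactSupport u)
    {ε : ℝ≥0∞} (hε : 0 < ε) :
    ∃ v : Plane → ℂ, ContDiff ℝ ∞ v ∧ HasCompactSupport v ∧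
      eLpNorm (v - u) 2 volume ≤ ε ∧ eLpNorm (grad v - g) 2 volume ≤ ε := by
  -- The fixed ratio between outer and inner radius is what gives a.e. convergence of the
  -- mollifications.
  set φ : ℕ → ContDiffBump (0 : Plane) := fun n =>
    { rIn := 1 / (n + 1 : ℝ)
      rOut := 2 * (1 / (n + 1 : ℝ))
      rIn_pos := by positivity
      rIn_lt_rOut := by
        have : (0 : ℝ) < 1 / (n + 1 : ℝ) := by positivity
        linarith }
  have hφ : Tendsto (fun n => (φ n).rOut) atTop (𝓝 0) := by
    have := (tendsto_one_div_add_atTop_nhds_zero_nat (𝕜 := ℝ)).const_mul 2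
    simpa [φ] using this
  have t1 := tendsto_eLpNorm_mollify_sub hum hu φ hφ fun n => le_rfl
  have t2 := tendsto_eLpNorm_mollify_sub hgm hg φ hφ fun n => le_rfl
  obtain ⟨n, h1, h2⟩ := ((t1.eventually (Iic_mem_nhds hε)).and
    (t2.eventually (Iic_mem_nhds hε))).exists
  have ht : IsTestFunction ((φ n).normed volume) :=
    ⟨(φ n).contDiff_normed, (φ n).hasCompactSupport_normed⟩
  refine ⟨(φ n).normed volume ⋆[lsmul ℝ ℝ, volume] u, ?_, ht.2.convolution _ hc, h1, ?_⟩
  · exact ht.2.contDiff_convolution_left _ ht.1 h.1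
  · rw [grad_mollify h ht]
    exact h2

/-- The vector field `u ∇χ`. -/
def gradSmul (χ : Plane → ℝ) (u : Plane → ℂ) (x : Plane) : EuclideanSpace ℂ (Fin 2) :=
  WithLp.toLp 2 fun i => fderiv ℝ χ x (EuclideanSpace.single i (1 : ℝ)) • u x

theorem norm_gradSmul (χ : Plane → ℝ) (u : Plane → ℂ) (x : Plane) :
    ‖gradSmul χ u x‖ = ‖fderiv ℝ χ x‖ * ‖u x‖ := by
  rw [← sq_eq_sq₀ (norm_nonneg _) (by positivity), EuclideanSpace.norm_sq_eq, mul_pow,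
    ← sum_sq_apply_single, Finset.sum_mul]
  refine Finset.sum_congr rfl fun i _ => ?_
  simp [gradSmul, mul_pow]

theorem aestronglyMeasurable_gradSmul {χ : Plane → ℝ} {u : Plane → ℂ}
    (hu : AEStronglyMeasurable u volume) : AEStronglyMeasurable (gradSmul χ u) volume := by
  refine (PiLp.continuous_toLp 2 _).comp_aestronglyMeasurable
    (aemeasurable_pi_iff.2 fun i => ?_).aestronglyMeasurable
  exact (measurable_fderiv_apply_const ℝ χ _).aemeasurable.smul hu.aemeasurable

theorem HasWeakGradient.testFunction_smul {u : Plane → ℂ}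
    {g : Plane → EuclideanSpace ℂ (Fin 2)} (h : HasWeakGradient u g) {χ : Plane → ℝ}
    (hχ : IsTestFunction χ) :
    HasWeakGradient (fun x => χ x • u x) (fun x => χ x • g x + gradSmul χ u x) := by
  have hint : Integrable (gradSmul χ u) := by
    refine Integrable.mono' (g := fun x => ‖‖fderiv ℝ χ x‖ • u x‖) ?_
      (aestronglyMeasurable_gradSmul h.1.aestronglyMeasurable) (.of_forall fun x => ?_)
    · exact (h.1.integrable_smul_left_of_hasCompactSupport
        (hχ.1.continuous_fderiv (by simp)).norm (hχ.2.fderiv ℝ).norm).norm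
    · rw [norm_gradSmul, norm_smul, norm_norm]
  refine ⟨(hχ.integrable_smul h.1).locallyIntegrable,
    ((hχ.integrable_smul h.2.1).add hint).locallyIntegrable, fun φ hφ i => ?_⟩
  have hφχ : IsTestFunction (fun x => φ x * χ x) := ⟨hφ.1.mul hχ.1, hφ.2.mul_right⟩
  have key := h.2.2 _ hφχ i
  have hd : ∀ x v, fderiv ℝ (fun x => φ x * χ x) x v = fderiv ℝ φ x v * χ x
      + φ x * fderiv ℝ χ x v := by
    intro x v
    rw [fderiv_fun_mul (hφ.differentiable x) (hχ.differentiable x)]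
    simp
    ring
  have i1 : Integrable fun x =>
      fderiv ℝ φ x (EuclideanSpace.single i (1 : ℝ)) • χ x • u x :=
    (hφ.fderiv_apply _).integrable_smul (hχ.integrable_smul h.1).locallyIntegrable
  have i2 : Integrable fun x =>
      φ x • fderiv ℝ χ x (EuclideanSpace.single i (1 : ℝ)) • u x :=
    hφ.integrable_smul ((hχ.fderiv_apply _).integrable_smul h.1).locallyIntegrable
  have i3 : Integrable fun x => φ x • χ x • g x i :=
    hφ.integrable_smul (hχ.integrable_smul (h.2.1.euclidean_apply i)).locallyIntegrable
  simp only [hd, add_smul, mul_smul] at key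
  rw [integral_add i1 i2] at key
  have e : ∀ x, φ x • (χ x • g x + gradSmul χ u x) i
      = φ x • χ x • g x i + φ x • fderiv ℝ χ x (EuclideanSpace.single i (1 : ℝ)) • u x := by
    intro x
    simp [gradSmul]
  simp only [e]
  rw [integral_add i3 i2, ← neg_eq_iff_eq_neg.2 key]
  ring

theorem tendsto_eLpNorm_smul_sub {G : Type*} [NormedAddCommGroup G] [NormedSpace ℝ G]
    {f : Plane → G} (hf : MemLp f 2 volume) {χ : ℕ → Plane → ℝ} (hχ : ∀ n, Continuous (χ n))
    (h1 : ∀ n x, |χ n x| ≤ 1) (ht : ∀ x, Tendsto (fun n => χ n x) atTop (𝓝 1)) :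
    Tendsto (fun n => eLpNorm ((fun x => χ n x • f x) - f) 2 volume) atTop (𝓝 0) := by
  have hfin : ∫⁻ x, ‖f x‖ₑ ^ 2 ≠ ⊤ := by
    have := hf.eLpNorm_ne_top
    rw [eLpNorm_two_eq] at this
    intro h
    rw [h] at this
    simp at this
  have := tendsto_lintegral_sub_sq_of_ae (F := fun n x => χ n x • f x) hf.1
    (fun n => (hχ n).aestronglyMeasurable.smul hf.1) hfin (fun n => lintegral_mono fun x => ?_)
    (.of_forall fun x => by simpa using (ht x).smul_const (f x))
  · simp only [eLpNorm_two_eq, Pi.sub_apply]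
    have h0 := ((ENNReal.continuous_rpow_const (y := (1 / 2 : ℝ))).tendsto 0).comp this
    simpa [Function.comp_def] using h0
  · simp only
    gcongr
    rw [enorm_le_iff_norm_le, norm_smul, Real.norm_eq_abs]
    exact mul_le_of_le_one_left (norm_nonneg _) (h1 n x)

theorem exists_cutoff : ∃ χ : ℕ → Plane → ℝ, (∀ n, IsTestFunction (χ n)) ∧
    (∀ n x, |χ n x| ≤ 1) ∧ (∀ x, Tendsto (fun n => χ n x) atTop (𝓝 1)) ∧
    ∃ K : ℝ, 0 ≤ K ∧ ∀ n x, ‖fderiv ℝ (χ n) x‖ ≤ K * (1 / (n + 1 : ℝ)) := by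
  let χ : ContDiffBump (0 : Plane) := ⟨1, 2, by norm_num, by norm_num⟩
  have hc : ContDiff ℝ ∞ χ := χ.contDiff
  have hs : HasCompactSupport χ := χ.hasCompactSupport
  obtain ⟨K, hK⟩ := (hs.fderiv ℝ).exists_bound_of_continuous (hc.continuous_fderiv (by simp))
  have hpos : ∀ n : ℕ, (0 : ℝ) < 1 / (n + 1 : ℝ) := fun n => by positivity
  refine ⟨fun n x => χ ((1 / (n + 1 : ℝ)) • x), fun n => ⟨hc.comp (contDiff_const_smul _), ?_⟩,
    fun n x => ?_, fun x => ?_, K, (norm_nonneg _).trans (hK 0), fun n x => ?_⟩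
  · exact hs.comp_homeomorph (Homeomorph.smulOfNeZero _ (hpos n).ne')
  · rw [abs_of_nonneg χ.nonneg]
    exact χ.le_one
  · have t : Tendsto (fun n : ℕ => ‖(1 / (n + 1 : ℝ)) • x‖) atTop (𝓝 0) := by
      have := ((tendsto_one_div_add_atTop_nhds_zero_nat (𝕜 := ℝ)).smul_const x).norm
      simpa using this
    refine tendsto_const_nhds.congr' ?_
    filter_upwards [t.eventually (Iic_mem_nhds one_pos)] with n hn
    exact (χ.one_of_mem_closedBall (by simpa [χ] using hn)).symm
  · rw [fderiv_comp_smul, norm_smul, Real.norm_of_nonneg (hpos n).le, mul_comm]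
    gcongr
    exact hK _

theorem eLpNorm_le_eLpNorm_add {G : Type*} [NormedAddCommGroup G] {f g h : Plane → G} {p : ℝ≥0∞}
    (hp : 1 ≤ p) (h1 : AEStronglyMeasurable f volume) (h2 : AEStronglyMeasurable g volume)
    (h3 : AEStronglyMeasurable h volume) :
    eLpNorm (f - h) p volume ≤ eLpNorm (f - g) p volume + eLpNorm (g - h) p volume := by
  have := eLpNorm_add_le (h1.sub h2) (h2.sub h3) hp
  simpa using this

/-- Truncation reduces to compact support: the extra term u∇χₙ is O(1/n) in L² because χₙ lives at
scale n. Mollification then finishes, with a third of ε for each error. -/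
theorem exists_smooth_approx {u : Plane → ℂ} {g : Plane → EuclideanSpace ℂ (Fin 2)}
    (h : HasWeakGradient u g) (hu : MemLp u 2 volume) (hg : MemLp g 2 volume)
    {ε : ℝ≥0∞} (hε : 0 < ε) :
    ∃ v : Plane → ℂ, ContDiff ℝ ∞ v ∧ HasCompactSupport v ∧
      eLpNorm (v - u) 2 volume ≤ ε ∧ eLpNorm (grad v - g) 2 volume ≤ ε := by
  obtain ⟨χ, hχ, hχ1, hχt, K, hK0, hK⟩ := exists_cutoff
  have hδ : 0 < ε / 3 := ENNReal.div_pos hε.ne' (by norm_num)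
  have t1 := tendsto_eLpNorm_smul_sub hu (fun n => (hχ n).continuous) hχ1 hχt
  have t2 := tendsto_eLpNorm_smul_sub hg (fun n => (hχ n).continuous) hχ1 hχt
  have b3 : ∀ n, eLpNorm (gradSmul (χ n) u) 2 volume
      ≤ ENNReal.ofReal (K * (1 / (n + 1 : ℝ))) * eLpNorm u 2 volume := by
    intro n
    refine eLpNorm_le_mul_eLpNorm_of_ae_le_mul (.of_forall fun x => ?_) 2
    rw [norm_gradSmul]
    gcongr
    exact hK n x
  have t3 : Tendsto (fun n => eLpNorm (gradSmul (χ n) u) 2 volume) atTop (𝓝 0) := by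
    refine tendsto_of_tendsto_of_tendsto_of_le_of_le tendsto_const_nhds ?_ (fun n => zero_le) b3
    have e1 := ENNReal.tendsto_ofReal
      ((tendsto_one_div_add_atTop_nhds_zero_nat (𝕜 := ℝ)).const_mul K)
    have e2 := ENNReal.Tendsto.mul_const e1 (b := eLpNorm u 2 volume)
      (Or.inr hu.eLpNorm_ne_top)
    simpa using e2
  obtain ⟨n, ⟨h1, h2⟩, h3⟩ := (((t1.eventually (Iic_mem_nhds hδ)).and
    (t2.eventually (Iic_mem_nhds hδ))).and (t3.eventually (Iic_mem_nhds hδ))).exists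
  have hw := h.testFunction_smul (hχ n)
  set u₁ : Plane → ℂ := fun x => χ n x • u x
  set g₁ : Plane → EuclideanSpace ℂ (Fin 2) := fun x => χ n x • g x + gradSmul (χ n) u x
  have hgs : AEStronglyMeasurable (gradSmul (χ n) u) volume := aestronglyMeasurable_gradSmul hu.1
  have hχm := (hχ n).continuous.aestronglyMeasurable (μ := (volume : Measure Plane))
  have hg₁ : eLpNorm (g₁ - g) 2 volume ≤ ε / 3 + ε / 3 := by
    have e : g₁ - g = ((fun x => χ n x • g x) - g) + gradSmul (χ n) u := by
      ext x : 1
      simp only [g₁, Pi.sub_apply, Pi.add_apply]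
      abel
    rw [e]
    exact (eLpNorm_add_le ((hχm.smul hg.1).sub hg.1) hgs (by norm_num)).trans (add_le_add h2 h3)
  have hu₁m : AEStronglyMeasurable u₁ volume := hχm.smul hu.1
  have hg₁m : AEStronglyMeasurable g₁ volume := (hχm.smul hg.1).add hgs
  have mu₁ : MemLp u₁ 2 volume := by
    refine hu.of_le hu₁m (.of_forall fun x => ?_)
    rw [norm_smul, Real.norm_eq_abs]
    exact mul_le_of_le_one_left (norm_nonneg _) (hχ1 n x)
  have mg₁ : MemLp g₁ 2 volume := by
    refine MemLp.add (hg.of_le (hχm.smul hg.1) (.of_forall fun x => ?_))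
      ⟨hgs, (b3 n).trans_lt (ENNReal.mul_lt_top ENNReal.ofReal_lt_top hu.eLpNorm_lt_top)⟩
    rw [norm_smul, Real.norm_eq_abs]
    exact mul_le_of_le_one_left (norm_nonneg _) (hχ1 n x)
  have hsupp : HasCompactSupport u₁ := (hχ n).2.smul_right
  obtain ⟨R, hR⟩ := hsupp.isCompact.isBounded.subset_closedBall (0 : Plane)
  set u₂ : Plane → ℂ := (Metric.closedBall (0 : Plane) R).indicator (hu₁m.mk u₁)
  have hu₂ : u₁ =ᵐ[volume] u₂ := by
    filter_upwards [hu₁m.ae_eq_mk] with x hx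
    by_cases hxR : x ∈ Metric.closedBall (0 : Plane) R
    · simp only [u₂]
      rw [indicator_of_mem hxR, hx]
    · simp only [u₂]
      rw [indicator_of_notMem hxR]
      exact image_eq_zero_of_notMem_tsupport fun hx' => hxR (hR hx')
  have hg₂ : g₁ =ᵐ[volume] hg₁m.mk g₁ := hg₁m.ae_eq_mk
  obtain ⟨v, v1, v2, v3, v4⟩ := exists_smooth_approx_of_hasCompactSupport (hw.congr hu₂ hg₂)
    (hu₁m.stronglyMeasurable_mk.indicator Metric.isClosed_closedBall.measurableSet)
    hg₁m.stronglyMeasurable_mk (mu₁.ae_eq hu₂) (mg₁.ae_eq hg₂)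
    (HasCompactSupport.intro (isCompact_closedBall 0 R)
      fun x hx => indicator_of_notMem hx _) hδ
  have e3 : ε / 3 + ε / 3 + ε / 3 = ε := ENNReal.add_thirds ε
  refine ⟨v, v1, v2, ?_, ?_⟩
  · rw [eLpNorm_congr_ae ((ae_eq_refl v).sub hu₂.symm)] at v3
    calc _ ≤ _ := eLpNorm_le_eLpNorm_add (by norm_num) v1.continuous.aestronglyMeasurable
          hu₁m hu.1
      _ ≤ ε / 3 + ε / 3 := add_le_add v3 h1
      _ ≤ ε / 3 + ε / 3 + ε / 3 := le_self_add
      _ = ε := e3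
  · rw [eLpNorm_congr_ae ((ae_eq_refl (grad v)).sub hg₂.symm)] at v4
    calc _ ≤ _ := eLpNorm_le_eLpNorm_add (by norm_num)
          (continuous_grad v1).aestronglyMeasurable hg₁m hg.1
      _ ≤ ε / 3 + (ε / 3 + ε / 3) := add_le_add v4 hg₁
      _ = ε := by rw [← add_assoc, e3]

theorem exists_seq_smooth_approx {u : Plane → ℂ} {g : Plane → EuclideanSpace ℂ (Fin 2)}
    (h : HasWeakGradient u g) (hu : MemLp u 2 volume) (hg : MemLp g 2 volume) :
    ∃ v : ℕ → Plane → ℂ, (∀ n, ContDiff ℝ ∞ (v n) ∧ HasCompactSupport (v n)) ∧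
      Tendsto (fun n => eLpNorm (v n - u) 2 volume) atTop (𝓝 0) ∧
      Tendsto (fun n => eLpNorm (grad (v n) - g) 2 volume) atTop (𝓝 0) := by
  have hpos : ∀ n : ℕ, (0 : ℝ≥0∞) < ENNReal.ofReal (1 / (n + 1 : ℝ)) := fun n =>
    ENNReal.ofReal_pos.2 (by positivity)
  choose v h1 h2 h3 h4 using fun n : ℕ => exists_smooth_approx h hu hg (hpos n)
  have t := ENNReal.tendsto_ofReal (tendsto_one_div_add_atTop_nhds_zero_nat (𝕜 := ℝ))
  rw [ENNReal.ofReal_zero] at t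
  exact ⟨v, fun n => ⟨h1 n, h2 n⟩,
    tendsto_of_tendsto_of_tendsto_of_le_of_le tendsto_const_nhds t (fun n => zero_le) h3,
    tendsto_of_tendsto_of_tendsto_of_le_of_le tendsto_const_nhds t (fun n => zero_le) h4⟩

end CubicQuintic

end

noncomputable section

namespace CubicQuintic

open Filter Topology Set
open scoped ENNReal NNReal RealInnerProductSpace

/-! ### Gagliardo-Nirenberg inequalities -/

theorem lintegral_mul_sq_le {X : Type*} [MeasurableSpace X] {μ : Measure X} {f g : X → ℝ≥0∞}
    (hf : AEMeasurable f μ) (hg : AEMeasurable g μ) :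
    (∫⁻ x, f x * g x ∂μ) ^ 2 ≤ (∫⁻ x, f x ^ 2 ∂μ) * ∫⁻ x, g x ^ 2 ∂μ := by
  have h := ENNReal.lintegral_mul_le_Lp_mul_Lq μ Real.HolderConjugate.two_two hf hg
  simp only [Pi.mul_apply, ENNReal.rpow_two] at h
  calc (∫⁻ x, f x * g x ∂μ) ^ 2
      ≤ ((∫⁻ x, f x ^ 2 ∂μ) ^ (1 / 2 : ℝ) * (∫⁻ x, g x ^ 2 ∂μ) ^ (1 / 2 : ℝ)) ^ 2 := by gcongr
    _ = (∫⁻ x, f x ^ 2 ∂μ) * ∫⁻ x, g x ^ 2 ∂μ := by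
      rw [mul_pow, ← ENNReal.rpow_natCast, ← ENNReal.rpow_mul, ← ENNReal.rpow_natCast,
        ← ENNReal.rpow_mul]
      norm_num

theorem norm_fderiv_le_norm_grad (v : Plane → ℂ) (x : Plane) : ‖fderiv ℝ v x‖ ≤ ‖grad v x‖ := by
  refine ContinuousLinearMap.opNorm_le_bound _ (norm_nonneg _) fun y => ?_
  have hy : y = ∑ i, y i • EuclideanSpace.single i (1 : ℝ) := by
    ext j
    fin_cases j <;> simp
  have h1 : fderiv ℝ v x y = ∑ i, y i • grad v x i := by
    conv_lhs => rw [hy]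
    simp
  rw [h1]
  have h2 : ‖∑ i, y i • grad v x i‖ ≤ ∑ i, |y i| * ‖grad v x i‖ := by
    refine (norm_sum_le _ _).trans (Finset.sum_le_sum fun i _ => ?_)
    rw [norm_smul, Real.norm_eq_abs]
  refine h2.trans (abs_le_of_sq_le_sq' ?_ (by positivity)).2
  rw [mul_pow, EuclideanSpace.norm_sq_eq, EuclideanSpace.norm_sq_eq, mul_comm]
  have := Finset.sum_mul_sq_le_sq_mul_sq Finset.univ (fun i => |y i|) fun i => ‖grad v x i‖
  simpa using this

/-- This is the embedding of W^{1,1} in L² in the plane. The target is left general because it is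
applied to the real function |v|² and to the complex function |v|²v. -/
theorem exists_sobolev_const : ∃ c : ℝ≥0, ∀ {G : Type} [NormedAddCommGroup G] [NormedSpace ℝ G]
    (w : Plane → G), ContDiff ℝ 1 w → HasCompactSupport w →
    ∫⁻ x, ‖w x‖ₑ ^ 2 ≤ c * (∫⁻ x, ‖fderiv ℝ w x‖ₑ) ^ 2 := by
  refine ⟨eLpNormLESNormFDerivOneConst (volume : Measure Plane) ((2 : ℝ≥0) : ℝ) ^ 2,
    fun {G} _ _ w h1 h2 => ?_⟩
  have hp : NNReal.HolderConjugate (Module.finrank ℝ Plane : ℝ≥0) 2 := by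
    rw [finrank_euclideanSpace_fin]
    rw [NNReal.holderConjugate_iff]
    norm_num
  have := eLpNorm_le_eLpNorm_fderiv_one (volume : Measure Plane) h1 h2 hp
  have h3 := pow_le_pow_left' this 2
  rw [mul_pow, eLpNorm_one_eq_lintegral_enorm, ENNReal.coe_ofNat, eLpNorm_two_eq,
    ← ENNReal.rpow_natCast, ← ENNReal.rpow_mul] at h3
  norm_num at h3
  push_cast
  exact h3

/-- The W^{1,1} embedding is applied to |v|² and |v|²v, whose derivatives are at most 2|v||∇v| and
3|v|²|∇v|, followed by Cauchy–Schwarz. Both are smooth, unlike |v| and |v|³. The factor 9 = 3² also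
covers 4 = 2². -/
theorem exists_smooth_gagliardo_nirenberg : ∃ c : ℝ≥0, ∀ v : Plane → ℂ, ContDiff ℝ ∞ v →
    HasCompactSupport v →
    (∫⁻ x, ‖v x‖ₑ ^ 4 ≤ c * (∫⁻ x, ‖grad v x‖ₑ ^ 2) * ∫⁻ x, ‖v x‖ₑ ^ 2) ∧
    ∫⁻ x, ‖v x‖ₑ ^ 6 ≤ c * (∫⁻ x, ‖grad v x‖ₑ ^ 2) * ∫⁻ x, ‖v x‖ₑ ^ 4 := by
  obtain ⟨c, hc⟩ := exists_sobolev_const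
  refine ⟨9 * c, fun v hv hs => ?_⟩
  have hv1 : ContDiff ℝ 1 v := hv.of_le (by exact_mod_cast le_top)
  have hd : ∀ x, HasFDerivAt v (fderiv ℝ v x) x := fun x =>
    (hv1.differentiable (by simp) x).hasFDerivAt
  have hvm : Measurable fun x => ‖v x‖ₑ := hv.continuous.measurable.enorm
  have hgm : Measurable fun x => ‖grad v x‖ₑ := (continuous_grad hv).measurable.enorm
  have hsq : ∀ x, HasFDerivAt (fun x => ‖v x‖ ^ 2)
      (2 • (innerSL ℝ (v x)).comp (fderiv ℝ v x)) x := fun x => (hd x).norm_sq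
  have hsqn : ∀ x, ‖(2 • (innerSL ℝ (v x)).comp (fderiv ℝ v x) : Plane →L[ℝ] ℝ)‖
      ≤ 2 * (‖v x‖ * ‖grad v x‖) := by
    intro x
    rw [← Nat.cast_smul_eq_nsmul ℝ, norm_smul]
    push_cast
    rw [Real.norm_of_nonneg (by norm_num)]
    gcongr
    refine (ContinuousLinearMap.opNorm_comp_le _ _).trans ?_
    rw [innerSL_apply_norm]
    gcongr
    exact norm_fderiv_le_norm_grad v x
  constructor
  · have h1 := hc (fun x => ‖v x‖ ^ 2) (hv1.norm_sq ℝ)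
      (hs.comp_left (g := fun z : ℂ => ‖z‖ ^ 2) (by simp))
    have e1 : ∀ x, ‖‖v x‖ ^ 2‖ₑ ^ 2 = ‖v x‖ₑ ^ 4 := fun x => by
      rw [enorm_pow, enorm_norm, ← pow_mul]
    have e2 : ∀ x, ‖fderiv ℝ (fun x => ‖v x‖ ^ 2) x‖ₑ ≤ 2 * (‖v x‖ₑ * ‖grad v x‖ₑ) := by
      intro x
      rw [(hsq x).fderiv]
      have := ENNReal.ofReal_le_ofReal (hsqn x)
      rw [ENNReal.ofReal_mul (by norm_num), ENNReal.ofReal_mul (norm_nonneg _)] at this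
      simpa only [ofReal_norm, ENNReal.ofReal_ofNat] using this
    simp only [e1] at h1
    calc _ ≤ _ := h1
      _ ≤ c * (∫⁻ x, 2 * (‖v x‖ₑ * ‖grad v x‖ₑ)) ^ 2 := by
          gcongr
          exact e2 _
      _ = c * 4 * (∫⁻ x, ‖v x‖ₑ * ‖grad v x‖ₑ) ^ 2 := by
          rw [lintegral_const_mul _ (f := fun x => ‖v x‖ₑ * ‖grad v x‖ₑ) (hvm.mul hgm), mul_pow]
          ring
      _ ≤ c * 4 * ((∫⁻ x, ‖v x‖ₑ ^ 2) * ∫⁻ x, ‖grad v x‖ₑ ^ 2) := by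
          gcongr
          exact lintegral_mul_sq_le hvm.aemeasurable hgm.aemeasurable
      _ ≤ c * 9 * ((∫⁻ x, ‖v x‖ₑ ^ 2) * ∫⁻ x, ‖grad v x‖ₑ ^ 2) := by
          gcongr
          norm_num
      _ = _ := by
          push_cast
          ring
  · have hw1 : ContDiff ℝ 1 fun x => ‖v x‖ ^ 2 • v x := (hv1.norm_sq ℝ).smul hv1
    have hws : HasCompactSupport fun x => ‖v x‖ ^ 2 • v x :=
      hs.mono fun x hx h0 => hx (by
        change ‖v x‖ ^ 2 • v x = 0
        rw [h0, smul_zero])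
    have h1 := hc _ hw1 hws
    have e1 : ∀ x, ‖‖v x‖ ^ 2 • v x‖ₑ ^ 2 = ‖v x‖ₑ ^ 6 := fun x => by
      rw [enorm_smul, enorm_pow, enorm_norm]
      ring
    have e2 : ∀ x, ‖fderiv ℝ (fun x => ‖v x‖ ^ 2 • v x) x‖ₑ
        ≤ 3 * (‖v x‖ₑ ^ 2 * ‖grad v x‖ₑ) := by
      intro x
      rw [((hsq x).fun_smul (hd x)).fderiv]
      have h3 : ‖(‖v x‖ ^ 2 • fderiv ℝ v x +
          (2 • (innerSL ℝ (v x)).comp (fderiv ℝ v x) : Plane →L[ℝ] ℝ).smulRight (v x))‖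
          ≤ 3 * (‖v x‖ ^ 2 * ‖grad v x‖) := by
        refine (norm_add_le _ _).trans ?_
        rw [norm_smul, ContinuousLinearMap.norm_smulRight_apply, norm_pow, norm_norm]
        have i1 := mul_le_mul_of_nonneg_left (norm_fderiv_le_norm_grad v x)
          (sq_nonneg ‖v x‖)
        have i2 := mul_le_mul_of_nonneg_right (hsqn x) (norm_nonneg (v x))
        nlinarith
      have := ENNReal.ofReal_le_ofReal h3
      rw [ENNReal.ofReal_mul (by norm_num), ENNReal.ofReal_mul (by positivity),
        ENNReal.ofReal_pow (norm_nonneg _)] at this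
      simpa only [ofReal_norm, ENNReal.ofReal_ofNat] using this
    simp only [e1] at h1
    calc _ ≤ _ := h1
      _ ≤ c * (∫⁻ x, 3 * (‖v x‖ₑ ^ 2 * ‖grad v x‖ₑ)) ^ 2 := by
          gcongr
          exact e2 _
      _ = c * 9 * (∫⁻ x, ‖v x‖ₑ ^ 2 * ‖grad v x‖ₑ) ^ 2 := by
          rw [lintegral_const_mul _ (f := fun x => ‖v x‖ₑ ^ 2 * ‖grad v x‖ₑ)
            ((hvm.pow_const 2).mul hgm), mul_pow]
          ring
      _ ≤ c * 9 * ((∫⁻ x, (‖v x‖ₑ ^ 2) ^ 2) * ∫⁻ x, ‖grad v x‖ₑ ^ 2) := by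
          gcongr
          exact lintegral_mul_sq_le (hvm.pow_const 2).aemeasurable hgm.aemeasurable
      _ = _ := by
          simp only [← pow_mul]
          push_cast
          ring

/-- `u` belongs to `H¹`, with weak gradient `g`. -/
structure IsH1 (u : Plane → ℂ) (g : Plane → EuclideanSpace ℂ (Fin 2)) : Prop where
  hasWeakGradient : HasWeakGradient u g
  memLp : MemLp u 2 volume
  memLp_grad : MemLp g 2 volume

theorem MemH1.exists_isH1 {u : Plane → ℂ} (h : MemH1 u) : ∃ g, IsH1 u g :=
  let ⟨g, h1, h2⟩ := h.2
  ⟨g, h1, h.1, h2⟩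

theorem IsH1.memH1 {u : Plane → ℂ} {g : Plane → EuclideanSpace ℂ (Fin 2)} (h : IsH1 u g) :
    MemH1 u := ⟨h.2, g, h.1, h.3⟩

theorem isH1_grad {v : Plane → ℂ} (hv : ContDiff ℝ ∞ v) (hs : HasCompactSupport v) :
    IsH1 v (grad v) :=
  ⟨hasWeakGradient_grad hv, hv.continuous.memLp_of_hasCompactSupport hs,
    (continuous_grad hv).memLp_of_hasCompactSupport (hasCompactSupport_grad hs)⟩

section

variable {u u' : Plane → ℂ} {g g' : Plane → EuclideanSpace ℂ (Fin 2)}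

theorem IsH1.add (h : IsH1 u g) (h' : IsH1 u' g') : IsH1 (u + u') (g + g') :=
  ⟨h.1.add h'.1, h.2.add h'.2, h.3.add h'.3⟩

theorem IsH1.const_smul (h : IsH1 u g) (c : ℝ) : IsH1 (c • u) (c • g) :=
  ⟨h.1.const_smul c, h.2.const_smul c, h.3.const_smul c⟩

theorem IsH1.sub (h : IsH1 u g) (h' : IsH1 u' g') : IsH1 (u - u') (g - g') := by
  have := h.add (h'.const_smul (-1))
  simpa [sub_eq_add_neg] using this

theorem IsH1.congr (h : IsH1 u g) (hu : u =ᵐ[volume] u') (hg : g =ᵐ[volume] g') : IsH1 u' g' :=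
  ⟨h.1.congr hu hg, h.2.ae_eq hu, h.3.ae_eq hg⟩

theorem memLp_two_comp_smul {G : Type*} [NormedAddCommGroup G] [NormedSpace ℝ G] {f : Plane → G}
    (hf : MemLp f 2 volume) {l : ℝ} (hl : 0 < l) : MemLp (fun x => f (l • x)) 2 volume := by
  have hm : AEStronglyMeasurable (fun x => f (l • x)) volume :=
    ((hf.locallyIntegrable (by norm_num)).comp_smul_plane hl.ne').aestronglyMeasurable
  have h1 := (memLp_iff_integrable_norm_pow hf.1 two_ne_zero).1 hf
  refine (memLp_iff_integrable_norm_pow hm two_ne_zero).2 ?_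
  exact (integrable_comp_smul_iff volume (fun x => ‖f x‖ ^ 2) hl.ne').2 h1

theorem IsH1.scale (h : IsH1 u g) (s : ℝ) {l : ℝ} (hl : 0 < l) :
    IsH1 (fun x => s • u (l • x)) (fun x => (s * l) • g (l • x)) :=
  ⟨h.1.scale s hl, (memLp_two_comp_smul h.2 hl).const_smul s,
    (memLp_two_comp_smul h.3 hl).const_smul (s * l)⟩

end

theorem tendsto_eLpNorm_of_tendsto_sub {G X : Type*} [NormedAddCommGroup G] [MeasurableSpace X]
    {μ : Measure X} {f : X → G} {F : ℕ → X → G} {p : ℝ≥0∞} (hp : 1 ≤ p) (hf : MemLp f p μ)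
    (hF : ∀ n, AEStronglyMeasurable (F n) μ)
    (h : Tendsto (fun n => eLpNorm (F n - f) p μ) atTop (𝓝 0)) :
    Tendsto (fun n => eLpNorm (F n) p μ) atTop (𝓝 (eLpNorm f p μ)) := by
  have u1 : ∀ n, eLpNorm (F n) p μ ≤ eLpNorm f p μ + eLpNorm (F n - f) p μ := fun n => by
    have := eLpNorm_add_le hf.1 ((hF n).sub hf.1) hp
    simpa using this
  have u2 : ∀ n, eLpNorm f p μ - eLpNorm (F n - f) p μ ≤ eLpNorm (F n) p μ := fun n => by
    have := eLpNorm_sub_le (hF n) ((hF n).sub hf.1) hp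
    rw [sub_sub_cancel] at this
    exact tsub_le_iff_right.2 this
  refine tendsto_of_tendsto_of_tendsto_of_le_of_le ?_ ?_ u2 u1
  · have := ENNReal.Tendsto.sub (tendsto_const_nhds (x := eLpNorm f p μ) (f := atTop)) h
      (Or.inl hf.eLpNorm_ne_top)
    simpa using this
  · have := (tendsto_const_nhds (x := eLpNorm f p μ) (f := atTop)).add h
    simpa using this

theorem eLpNorm_pow_eq_lintegral {G X : Type*} [NormedAddCommGroup G] [MeasurableSpace X]
    {μ : Measure X} (f : X → G) {n : ℕ} (hn : n ≠ 0) :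
    eLpNorm f n μ ^ n = ∫⁻ x, ‖f x‖ₑ ^ n ∂μ := by
  rw [eLpNorm_eq_lintegral_rpow_enorm_toReal (by exact_mod_cast hn) (by simp)]
  simp only [ENNReal.toReal_natCast, ENNReal.rpow_natCast, one_div]
  rw [← ENNReal.rpow_natCast, ← ENNReal.rpow_mul, inv_mul_cancel₀ (by exact_mod_cast hn),
    ENNReal.rpow_one]

theorem integral_norm_pow_eq_toReal {G X : Type*} [NormedAddCommGroup G] [MeasurableSpace X]
    {μ : Measure X} {f : X → G} (hf : AEStronglyMeasurable f μ) (n : ℕ) :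
    ∫ x, ‖f x‖ ^ n ∂μ = (∫⁻ x, ‖f x‖ₑ ^ n ∂μ).toReal := by
  rw [integral_eq_lintegral_of_nonneg_ae (.of_forall fun x => by positivity)
    (continuous_pow n |>.comp_aestronglyMeasurable hf.norm)]
  congr 1
  refine lintegral_congr fun x => ?_
  rw [ENNReal.ofReal_pow (norm_nonneg _), ofReal_norm]

theorem tendsto_integral_norm_pow_of_tendsto_sub {G X : Type*} [NormedAddCommGroup G]
    [MeasurableSpace X] {μ : Measure X} {f : X → G} {F : ℕ → X → G} {n : ℕ} (hn : n ≠ 0)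
    (hf : MemLp f n μ) (hF : ∀ k, AEStronglyMeasurable (F k) μ)
    (h : Tendsto (fun k => eLpNorm (F k - f) n μ) atTop (𝓝 0)) :
    Tendsto (fun k => ∫ x, ‖F k x‖ ^ n ∂μ) atTop (𝓝 (∫ x, ‖f x‖ ^ n ∂μ)) := by
  have hn1 : (1 : ℝ≥0∞) ≤ n := by exact_mod_cast Nat.one_le_iff_ne_zero.2 hn
  have t := tendsto_eLpNorm_of_tendsto_sub hn1 hf hF h
  simp only [integral_norm_pow_eq_toReal (hF _), integral_norm_pow_eq_toReal hf.1,
    ← eLpNorm_pow_eq_lintegral _ hn]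
  exact (ENNReal.tendsto_toReal (ENNReal.pow_ne_top hf.eLpNorm_ne_top)).comp
    (((ENNReal.continuous_pow n).tendsto _).comp t)

/-- The Gagliardo-Nirenberg inequalities on `H¹`. -/
theorem exists_gagliardo_nirenberg_lintegral : ∃ c : ℝ≥0, ∀ (u : Plane → ℂ)
    (g : Plane → EuclideanSpace ℂ (Fin 2)), IsH1 u g →
    (∫⁻ x, ‖u x‖ₑ ^ 4 ≤ c * ((∫⁻ x, ‖g x‖ₑ ^ 2) * ∫⁻ x, ‖u x‖ₑ ^ 2)) ∧
    ∫⁻ x, ‖u x‖ₑ ^ 6 ≤ c ^ 2 * ((∫⁻ x, ‖g x‖ₑ ^ 2) ^ 2 * ∫⁻ x, ‖u x‖ₑ ^ 2) := by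
  obtain ⟨c, hc⟩ := exists_smooth_gagliardo_nirenberg
  refine ⟨c, fun u g h => ?_⟩
  obtain ⟨v, hv, tv, tg⟩ := exists_seq_smooth_approx h.1 h.2 h.3
  have hvm : ∀ n, AEStronglyMeasurable (v n) volume := fun n =>
    (hv n).1.continuous.aestronglyMeasurable
  have hgm : ∀ n, AEStronglyMeasurable (grad (v n)) volume := fun n =>
    (continuous_grad (hv n).1).aestronglyMeasurable
  obtain ⟨ns, hns, hae⟩ := (tendstoInMeasure_of_tendsto_eLpNorm (by norm_num) hvm h.2.1
    tv).exists_seq_tendsto_ae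
  have tA : Tendsto (fun n => ∫⁻ x, ‖grad (v (ns n)) x‖ₑ ^ 2) atTop (𝓝 (∫⁻ x, ‖g x‖ₑ ^ 2)) := by
    have := ((ENNReal.continuous_pow 2).tendsto _).comp
      ((tendsto_eLpNorm_of_tendsto_sub (by norm_num) h.3 hgm tg).comp hns.tendsto_atTop)
    simpa only [Function.comp_def, ← Nat.cast_ofNat (R := ℝ≥0∞) (n := 2),
      eLpNorm_pow_eq_lintegral _ two_ne_zero] using this
  have tB : Tendsto (fun n => ∫⁻ x, ‖v (ns n) x‖ₑ ^ 2) atTop (𝓝 (∫⁻ x, ‖u x‖ₑ ^ 2)) := by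
    have := ((ENNReal.continuous_pow 2).tendsto _).comp
      ((tendsto_eLpNorm_of_tendsto_sub (by norm_num) h.2 hvm tv).comp hns.tendsto_atTop)
    simpa only [Function.comp_def, ← Nat.cast_ofNat (R := ℝ≥0∞) (n := 2),
      eLpNorm_pow_eq_lintegral _ two_ne_zero] using this
  have hA : ∫⁻ x, ‖g x‖ₑ ^ 2 ≠ ⊤ := by
    rw [← eLpNorm_pow_eq_lintegral _ two_ne_zero]
    exact ENNReal.pow_ne_top h.3.eLpNorm_ne_top
  have hB : ∫⁻ x, ‖u x‖ₑ ^ 2 ≠ ⊤ := by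
    rw [← eLpNorm_pow_eq_lintegral _ two_ne_zero]
    exact ENNReal.pow_ne_top h.2.eLpNorm_ne_top
  -- The left sides pass to the limit by Fatou along an a.e. convergent subsequence, while the right
  -- sides converge because v n → u in H¹.
  have fatou : ∀ k : ℕ, ∫⁻ x, ‖u x‖ₑ ^ k ≤ liminf (fun n => ∫⁻ x, ‖v (ns n) x‖ₑ ^ k) atTop := by
    intro k
    calc ∫⁻ x, ‖u x‖ₑ ^ k = ∫⁻ x, liminf (fun n => ‖v (ns n) x‖ₑ ^ k) atTop := by
          refine lintegral_congr_ae ?_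
          filter_upwards [hae] with x hx
          exact (((ENNReal.continuous_pow k).tendsto _).comp hx.enorm).liminf_eq.symm
      _ ≤ _ := lintegral_liminf_le' fun n => (hvm _).enorm.pow_const k
  constructor
  · refine (fatou 4).trans ?_
    have t := ENNReal.Tendsto.const_mul (a := (c : ℝ≥0∞))
      (ENNReal.Tendsto.mul tA (Or.inr hB) tB (Or.inr hA)) (Or.inr ENNReal.coe_ne_top)
    rw [← t.liminf_eq]
    refine liminf_le_liminf (.of_forall fun n => ?_)
    rw [← mul_assoc]
    exact (hc _ (hv _).1 (hv _).2).1
  · refine (fatou 6).trans ?_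
    have t := ENNReal.Tendsto.const_mul (a := (c : ℝ≥0∞) ^ 2)
      (ENNReal.Tendsto.mul (((ENNReal.continuous_pow 2).tendsto _).comp tA)
        (Or.inr hB) tB (Or.inr (ENNReal.pow_ne_top hA)))
      (Or.inr (ENNReal.pow_ne_top ENNReal.coe_ne_top))
    rw [← t.liminf_eq]
    refine liminf_le_liminf (.of_forall fun n => ?_)
    -- Feeding the L⁴ bound into the L⁶ bound eliminates the fourth powers; hence the square of c.
    have h1 := (hc _ (hv (ns n)).1 (hv (ns n)).2).1
    refine (hc _ (hv (ns n)).1 (hv (ns n)).2).2.trans ?_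
    calc _ ≤ c * (∫⁻ x, ‖grad (v (ns n)) x‖ₑ ^ 2) *
          (c * (∫⁻ x, ‖grad (v (ns n)) x‖ₑ ^ 2) * ∫⁻ x, ‖v (ns n) x‖ₑ ^ 2) := by gcongr
      _ = _ := by
          simp only [Function.comp_apply]
          ring

theorem memLp_of_lintegral_ne_top {G X : Type*} [NormedAddCommGroup G] [MeasurableSpace X]
    {μ : Measure X} {f : X → G} (hf : AEStronglyMeasurable f μ) {n : ℕ} (hn : n ≠ 0)
    (h : ∫⁻ x, ‖f x‖ₑ ^ n ∂μ ≠ ⊤) : MemLp f n μ := by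
  refine ⟨hf, lt_top_iff_ne_top.2 fun h' => h ?_⟩
  rw [← eLpNorm_pow_eq_lintegral f hn, h', ENNReal.top_pow hn]

section

variable {u : Plane → ℂ} {g : Plane → EuclideanSpace ℂ (Fin 2)}

theorem lintegral_sq_ne_top {G X : Type*} [NormedAddCommGroup G] [MeasurableSpace X]
    {μ : Measure X} {f : X → G} (hf : MemLp f 2 μ) : ∫⁻ x, ‖f x‖ₑ ^ 2 ∂μ ≠ ⊤ := by
  rw [← eLpNorm_pow_eq_lintegral _ two_ne_zero]
  exact ENNReal.pow_ne_top hf.eLpNorm_ne_top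

theorem IsH1.memLp_four (h : IsH1 u g) : MemLp u 4 volume := by
  obtain ⟨c, hc⟩ := exists_gagliardo_nirenberg_lintegral
  refine memLp_of_lintegral_ne_top h.2.1 (n := 4) (by norm_num)
    (ne_top_of_le_ne_top ?_ (hc u g h).1)
  exact ENNReal.mul_ne_top ENNReal.coe_ne_top
    (ENNReal.mul_ne_top (lintegral_sq_ne_top h.3) (lintegral_sq_ne_top h.2))

theorem IsH1.memLp_six (h : IsH1 u g) : MemLp u 6 volume := by
  obtain ⟨c, hc⟩ := exists_gagliardo_nirenberg_lintegral
  refine memLp_of_lintegral_ne_top h.2.1 (n := 6) (by norm_num)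
    (ne_top_of_le_ne_top ?_ (hc u g h).2)
  exact ENNReal.mul_ne_top (ENNReal.pow_ne_top ENNReal.coe_ne_top)
    (ENNReal.mul_ne_top (ENNReal.pow_ne_top (lintegral_sq_ne_top h.3)) (lintegral_sq_ne_top h.2))

theorem exists_gagliardo_nirenberg : ∃ c : ℝ, 0 < c ∧ ∀ (u : Plane → ℂ)
    (g : Plane → EuclideanSpace ℂ (Fin 2)), IsH1 u g →
    ∫ x, ‖u x‖ ^ 4 ≤ c * ((∫ x, ‖g x‖ ^ 2) * ∫ x, ‖u x‖ ^ 2) := by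
  obtain ⟨c, hc⟩ := exists_gagliardo_nirenberg_lintegral
  refine ⟨c + 1, by positivity, fun u g h => ?_⟩
  have h1 := (hc u g h).1
  have hpos : 0 ≤ (∫ x, ‖g x‖ ^ 2) * ∫ x, ‖u x‖ ^ 2 :=
    mul_nonneg (integral_nonneg fun x => by positivity) (integral_nonneg fun x => by positivity)
  have h2 := ENNReal.toReal_mono (ENNReal.mul_ne_top ENNReal.coe_ne_top
    (ENNReal.mul_ne_top (lintegral_sq_ne_top h.3) (lintegral_sq_ne_top h.2))) h1
  rw [ENNReal.toReal_mul, ENNReal.toReal_mul, ← integral_norm_pow_eq_toReal h.2.1,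
    ← integral_norm_pow_eq_toReal h.2.1, ← integral_norm_pow_eq_toReal h.3.1,
    ENNReal.coe_toReal] at h2
  linarith

theorem IsH1.exists_smooth_seq (h : IsH1 u g) : ∃ v : ℕ → Plane → ℂ,
    (∀ n, ContDiff ℝ ∞ (v n) ∧ HasCompactSupport (v n)) ∧
    Tendsto (fun n => ∫ x, ‖grad (v n) x‖ ^ 2) atTop (𝓝 (∫ x, ‖g x‖ ^ 2)) ∧
    Tendsto (fun n => ∫ x, ‖v n x‖ ^ 2) atTop (𝓝 (∫ x, ‖u x‖ ^ 2)) ∧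
    Tendsto (fun n => ∫ x, ‖v n x‖ ^ 6) atTop (𝓝 (∫ x, ‖u x‖ ^ 6)) ∧
    Tendsto (fun n => ∫ x, ‖v n x‖ ^ 4) atTop (𝓝 (∫ x, ‖u x‖ ^ 4)) := by
  obtain ⟨v, hv, tv, tg⟩ := exists_seq_smooth_approx h.1 h.2 h.3
  have hvm : ∀ n, AEStronglyMeasurable (v n) volume := fun n =>
    (hv n).1.continuous.aestronglyMeasurable
  have hgm : ∀ n, AEStronglyMeasurable (grad (v n)) volume := fun n =>
    (continuous_grad (hv n).1).aestronglyMeasurable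
  obtain ⟨c, hc⟩ := exists_gagliardo_nirenberg_lintegral
  have tB : Tendsto (fun n => ∫⁻ x, ‖(v n - u) x‖ₑ ^ 2) atTop (𝓝 0) := by
    have := ((ENNReal.continuous_pow 2).tendsto _).comp tv
    simpa only [Function.comp_def, ← Nat.cast_ofNat (R := ℝ≥0∞) (n := 2),
      eLpNorm_pow_eq_lintegral _ two_ne_zero, ne_eq, two_ne_zero, not_false_eq_true,
      zero_pow] using this
  have tA : Tendsto (fun n => ∫⁻ x, ‖(grad (v n) - g) x‖ₑ ^ 2) atTop (𝓝 0) := by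
    have := ((ENNReal.continuous_pow 2).tendsto _).comp tg
    simpa only [Function.comp_def, ← Nat.cast_ofNat (R := ℝ≥0∞) (n := 2),
      eLpNorm_pow_eq_lintegral _ two_ne_zero, ne_eq, two_ne_zero, not_false_eq_true,
      zero_pow] using this
  -- Gagliardo–Nirenberg for the difference upgrades convergence in H¹ to convergence in L⁴ and L⁶.
  have hsub : ∀ n, IsH1 (v n - u) (grad (v n) - g) := fun n =>
    (isH1_grad (hv n).1 (hv n).2).sub h
  have key : ∀ k : ℕ, k ≠ 0 → Tendsto (fun n => ∫⁻ x, ‖(v n - u) x‖ₑ ^ k) atTop (𝓝 0) →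
      Tendsto (fun n => eLpNorm (v n - u) k volume) atTop (𝓝 0) := by
    intro k hk ht
    have e : ∀ n, eLpNorm (v n - u) k volume
        = (∫⁻ x, ‖(v n - u) x‖ₑ ^ k) ^ ((k : ℝ)⁻¹) := fun n => by
      rw [← eLpNorm_pow_eq_lintegral _ hk, ← ENNReal.rpow_natCast, ← ENNReal.rpow_mul,
        mul_inv_cancel₀ (by exact_mod_cast hk), ENNReal.rpow_one]
    simp only [e]
    have := ((ENNReal.continuous_rpow_const (y := (k : ℝ)⁻¹)).tendsto 0).comp ht
    rwa [ENNReal.zero_rpow_of_pos (by positivity)] at this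
  refine ⟨v, hv, tendsto_integral_norm_pow_of_tendsto_sub two_ne_zero h.3 hgm tg,
    tendsto_integral_norm_pow_of_tendsto_sub two_ne_zero h.2 hvm tv,
    tendsto_integral_norm_pow_of_tendsto_sub (by norm_num) h.memLp_six hvm
      (key 6 (by norm_num) ?_),
    tendsto_integral_norm_pow_of_tendsto_sub (by norm_num) h.memLp_four hvm
      (key 4 (by norm_num) ?_)⟩
  · have t : Tendsto (fun n => (c : ℝ≥0∞) ^ 2 * ((∫⁻ x, ‖(grad (v n) - g) x‖ₑ ^ 2) ^ 2 *
        ∫⁻ x, ‖(v n - u) x‖ₑ ^ 2)) atTop (𝓝 0) := by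
      have := ENNReal.Tendsto.const_mul (a := (c : ℝ≥0∞) ^ 2)
        (ENNReal.Tendsto.mul (((ENNReal.continuous_pow 2).tendsto _).comp tA)
          (Or.inr ENNReal.zero_ne_top) tB (Or.inr (by simp)))
        (Or.inr (ENNReal.pow_ne_top ENNReal.coe_ne_top))
      simpa [Function.comp_def] using this
    exact tendsto_of_tendsto_of_tendsto_of_le_of_le tendsto_const_nhds t (fun n => zero_le)
      fun n => (hc _ _ (hsub n)).2
  · have t : Tendsto (fun n => (c : ℝ≥0∞) * ((∫⁻ x, ‖(grad (v n) - g) x‖ₑ ^ 2) *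
        ∫⁻ x, ‖(v n - u) x‖ₑ ^ 2)) atTop (𝓝 0) := by
      have := ENNReal.Tendsto.const_mul (a := (c : ℝ≥0∞))
        (ENNReal.Tendsto.mul tA
          (Or.inr ENNReal.zero_ne_top) tB (Or.inr ENNReal.zero_ne_top))
        (Or.inr ENNReal.coe_ne_top)
      simpa using this
    exact tendsto_of_tendsto_of_tendsto_of_le_of_le tendsto_const_nhds t (fun n => zero_le)
      fun n => (hc _ _ (hsub n)).1

end

end CubicQuintic

end

noncomputable section

namespace CubicQuintic

open Filter Topology Set
open scoped ENNReal NNReal RealInnerProductSpace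

/-! ### Lower semicontinuity of the Dirichlet integral -/

/-- Banach–Alaoglu through the Riesz isomorphism. Taking the limit along a free ultrafilter replaces
the extraction of a subsequence, and testing against G₀ itself gives the norm bound. -/
theorem exists_weak_limit {H : Type*} [NormedAddCommGroup H] [InnerProductSpace ℂ H]
    [CompleteSpace H] {G : ℕ → H} {a : ℝ} (ha : Tendsto (fun n => ‖G n‖) atTop (𝓝 a)) :
    ∃ G₀ : H, ‖G₀‖ ≤ a ∧ ∀ y, Tendsto (fun n => inner ℂ y (G n)) (hyperfilter ℕ)
      (𝓝 (inner ℂ y G₀)) := by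
  obtain ⟨M, hM⟩ := ha.bddAbove_range
  let T : ℕ → WeakDual ℂ H := fun n => StrongDual.toWeakDual (InnerProductSpace.toDual ℂ H (G n))
  have hc := WeakDual.isCompact_closedBall (𝕜 := ℂ) (E := H) 0 M
  obtain ⟨T₀, -, hT₀⟩ := hc.ultrafilter_le_nhds' ((hyperfilter ℕ).map T) (by
    refine Ultrafilter.mem_map.2 (univ_mem' fun n => ?_)
    simp only [mem_preimage, Metric.mem_closedBall, dist_zero_right]
    have : ‖WeakDual.toStrongDual (T n)‖ = ‖G n‖ := (InnerProductSpace.toDual ℂ H).norm_map (G n)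
    rw [this]
    exact hM ⟨n, rfl⟩)
  have hev : ∀ y, Tendsto (fun n => T n y) (hyperfilter ℕ) (𝓝 (T₀ y)) := fun y =>
    ((WeakDual.eval_continuous y).tendsto T₀).comp hT₀
  set G₀ : H := (InnerProductSpace.toDual ℂ H).symm (WeakDual.toStrongDual T₀) with hG₀
  have h0 : ∀ y, T₀ y = inner ℂ G₀ y := fun y => by
    rw [hG₀, InnerProductSpace.toDual_symm_apply]
    rfl
  have h1 : ∀ y, Tendsto (fun n => inner ℂ (G n) y) (hyperfilter ℕ) (𝓝 (inner ℂ G₀ y)) :=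
    fun y => by
      rw [← h0 y]
      exact hev y
  have h2 : ∀ y, Tendsto (fun n => inner ℂ y (G n)) (hyperfilter ℕ) (𝓝 (inner ℂ y G₀)) :=
    fun y => by
      have := (Complex.continuous_conj.tendsto _).comp (h1 y)
      simpa only [Function.comp_def, inner_conj_symm] using this
  refine ⟨G₀, ?_, h2⟩
  have h3 : ‖G₀‖ * ‖G₀‖ ≤ ‖G₀‖ * a := by
    have t1 := (h2 G₀).norm
    have t2 := (ha.mono_left Nat.hyperfilter_le_atTop).const_mul ‖G₀‖
    have := le_of_tendsto_of_tendsto t1 t2 (.of_forall fun n => norm_inner_le_norm _ _)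
    rw [inner_self_eq_norm_sq_to_K] at this
    simpa [sq] using this
  have ha0 : 0 ≤ a := ge_of_tendsto ha (.of_forall fun n => norm_nonneg _)
  rcases (norm_nonneg G₀).eq_or_lt with h | h
  · rw [← h]
    exact ha0
  · exact le_of_mul_le_mul_left h3 h

theorem norm_toLp_sq {G : Type*} [NormedAddCommGroup G] {f : Plane → G}
    (hf : MemLp f 2 volume) : ‖hf.toLp f‖ ^ 2 = ∫ x, ‖f x‖ ^ 2 := by
  have h := lpNorm_pow_eq_integral hf.1 2 two_ne_zero
  rw [← toReal_eLpNorm hf.1] at h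
  rw [Lp.norm_toLp]
  exact h

/-- A weak L² limit of the gradients is a weak gradient of the pointwise limit, and the norm is
weakly lower semicontinuous. Only local integrability of the majorant is required, since the
functions are tested against derivatives of compactly supported functions. -/
theorem exists_isWeakGradient_of_tendsto {u : ℕ → Plane → ℂ}
    {g : ℕ → Plane → EuclideanSpace ℂ (Fin 2)} {w : Plane → ℂ} {h : Plane → ℝ} {a : ℝ}
    (hu : ∀ n, HasWeakGradient (u n) (g n)) (hg : ∀ n, MemLp (g n) 2 volume)
    (ha : Tendsto (fun n => ∫ x, ‖g n x‖ ^ 2) atTop (𝓝 a))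
    (hh : LocallyIntegrable h) (hb : ∀ n, ∀ᵐ x, ‖u n x‖ ≤ h x)
    (hw : ∀ᵐ x, Tendsto (fun n => u n x) atTop (𝓝 (w x))) :
    ∃ g₀, HasWeakGradient w g₀ ∧ MemLp g₀ 2 volume ∧ ∫ x, ‖g₀ x‖ ^ 2 ≤ a := by
  have hwm : AEStronglyMeasurable w volume :=
    aestronglyMeasurable_of_tendsto_ae atTop (fun n => (hu n).1.aestronglyMeasurable) hw
  have hwb : ∀ᵐ x, ‖w x‖ ≤ h x := by
    filter_upwards [hw, ae_all_iff.2 hb] with x h1 h2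
    exact le_of_tendsto h1.norm (.of_forall h2)
  have hwl : LocallyIntegrable w := by
    refine hh.mono hwm ?_
    filter_upwards [hwb] with x hx
    exact hx.trans (le_abs_self _)
  have ha0 : 0 ≤ a := ge_of_tendsto ha
    (.of_forall fun n => integral_nonneg fun x => by positivity)
  set G : ℕ → Lp (EuclideanSpace ℂ (Fin 2)) 2 (volume : Measure Plane) := fun n => (hg n).toLp (g n)
  have hG : Tendsto (fun n => ‖G n‖) atTop (𝓝 (√a)) := by
    have := (Real.continuous_sqrt.tendsto a).comp ha
    refine this.congr fun n => ?_
    rw [Function.comp_apply, ← norm_toLp_sq (hg n), Real.sqrt_sq (norm_nonneg _)]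
  obtain ⟨G₀, hn, hlim⟩ := exists_weak_limit hG
  have hmem : MemLp (G₀ : Plane → EuclideanSpace ℂ (Fin 2)) 2 volume := Lp.memLp G₀
  refine ⟨G₀, ⟨hwl, hmem.locallyIntegrable (by norm_num), fun φ hφ i => ?_⟩, hmem, ?_⟩
  · set y : Plane → EuclideanSpace ℂ (Fin 2) := fun x => (φ x : ℂ) • EuclideanSpace.single i (1 : ℂ)
    have hyc : Continuous y := (Complex.continuous_ofReal.comp hφ.continuous).smul continuous_const
    have hys : HasCompactSupport y := hφ.2.mono fun x hx h0 => hx (by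
      change (φ x : ℂ) • EuclideanSpace.single i (1 : ℂ) = 0
      rw [h0, Complex.ofReal_zero, zero_smul])
    have hy : MemLp y 2 volume := hyc.memLp_of_hasCompactSupport hys
    have hin : ∀ k : Lp (EuclideanSpace ℂ (Fin 2)) 2 (volume : Measure Plane),
        inner ℂ (hy.toLp y) k = ∫ x, φ x • k x i := by
      intro k
      rw [L2.inner_def]
      refine integral_congr_ae ?_
      filter_upwards [hy.coeFn_toLp] with x hx
      rw [hx]
      simp only [y, inner_smul_left, EuclideanSpace.inner_single_left]
      simp
    have t1 := hlim (hy.toLp y)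
    simp only [hin] at t1
    have e1 : ∀ n, ∫ x, φ x • G n x i
        = -∫ x, fderiv ℝ φ x (EuclideanSpace.single i (1 : ℝ)) • u n x := by
      intro n
      rw [(hu n).2.2 φ hφ i, neg_neg]
      refine integral_congr_ae ?_
      filter_upwards [(hg n).coeFn_toLp] with x hx
      rw [hx]
    simp only [e1] at t1
    have t2 : Tendsto (fun n => -∫ x, fderiv ℝ φ x (EuclideanSpace.single i (1 : ℝ)) • u n x)
        atTop (𝓝 (-∫ x, fderiv ℝ φ x (EuclideanSpace.single i (1 : ℝ)) • w x)) := by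
      refine (tendsto_integral_of_dominated_convergence
        (fun x => ‖fderiv ℝ φ x (EuclideanSpace.single i (1 : ℝ)) • h x‖) (fun n => ?_) ?_
        (fun n => ?_) ?_).neg
      · exact ((hφ.fderiv_apply _).integrable_smul (hu n).1).aestronglyMeasurable
      · exact ((hφ.fderiv_apply _).integrable_smul hh).norm
      · filter_upwards [hb n] with x hx
        rw [norm_smul, norm_smul]
        gcongr
        exact hx.trans (le_abs_self _)
      · filter_upwards [hw] with x hx
        exact hx.const_smul _
    have := tendsto_nhds_unique t1 (t2.mono_left Nat.hyperfilter_le_atTop)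
    rw [this, neg_neg]
  · have e := norm_toLp_sq hmem
    rw [Lp.toLp_coeFn] at e
    rw [← e]
    calc ‖G₀‖ ^ 2 ≤ √a ^ 2 := by gcongr
      _ = a := Real.sq_sqrt ha0

end CubicQuintic

end

noncomputable section

namespace CubicQuintic

open Filter Topology Set
open scoped ENNReal NNReal RealInnerProductSpace

/-! ### Polarization -/

/-- The reflection in the line `⟪e, x⟫ = t`, where `e` is a unit vector. -/
def reflect (e : Plane) (t : ℝ) (x : Plane) : Plane :=
  (ℝ ∙ e)ᗮ.reflection x + (2 * t) • e

/-- The polarization of `v` with respect to the half plane `⟪e, x⟫ ≤ t`. -/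
def polarize (e : Plane) (t : ℝ) (v : Plane → ℝ) (x : Plane) : ℝ :=
  if ⟪e, x⟫ ≤ t then max (v x) (v (reflect e t x)) else min (v x) (v (reflect e t x))

section Reflect

variable {e : Plane} {t : ℝ}

theorem reflect_apply (he : ‖e‖ = 1) (x : Plane) :
    reflect e t x = x - (2 * (⟪e, x⟫ - t)) • e := by
  rw [reflect, Submodule.reflection_orthogonal_apply, Submodule.reflection_singleton_apply, he]
  simp only [RCLike.ofReal_real_eq_id, id_eq, one_pow, div_one]
  module

theorem inner_reflect (he : ‖e‖ = 1) (x : Plane) : ⟪e, reflect e t x⟫ = 2 * t - ⟪e, x⟫ := by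
  rw [reflect_apply he, inner_sub_right, inner_smul_right, real_inner_self_eq_norm_sq, he]
  ring

theorem reflect_reflect (he : ‖e‖ = 1) (x : Plane) : reflect e t (reflect e t x) = x := by
  rw [reflect_apply he (reflect e t x), inner_reflect he, reflect_apply he]
  module

theorem norm_reflect_sq (he : ‖e‖ = 1) (x : Plane) :
    ‖reflect e t x‖ ^ 2 = ‖x‖ ^ 2 + 4 * t * (t - ⟪e, x⟫) := by
  rw [reflect_apply he, norm_sub_sq_real, norm_smul, mul_pow, he, inner_smul_right,
    Real.norm_eq_abs, sq_abs, real_inner_comm]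
  ring

theorem dist_reflect (x y : Plane) : dist (reflect e t x) (reflect e t y) = dist x y := by
  simp [reflect]

/-- For points on opposite sides of the line the correction is nonpositive: reflecting one of them
does not increase the distance. This is what preserves the Lipschitz constant under polarization. -/
theorem dist_reflect_sq (he : ‖e‖ = 1) (x y : Plane) :
    dist (reflect e t x) y ^ 2 = dist x y ^ 2 + 4 * (⟪e, x⟫ - t) * (⟪e, y⟫ - t) := by
  have h1 : reflect e t x - y = (x - y) - (2 * (⟪e, x⟫ - t)) • e := by
    rw [reflect_apply he]
    abel
  rw [dist_eq_norm, dist_eq_norm, h1, norm_sub_sq_real, norm_smul, mul_pow, he, inner_smul_right,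
    Real.norm_eq_abs, sq_abs, inner_sub_left, real_inner_comm e x, real_inner_comm e y]
  ring

theorem reflect_eq_self (he : ‖e‖ = 1) {x : Plane} (hx : ⟪e, x⟫ = t) : reflect e t x = x := by
  rw [reflect_apply he, hx, sub_self, mul_zero, zero_smul, sub_zero]

theorem measurePreserving_reflect : MeasurePreserving (reflect e t) := by
  have h1 := ((ℝ ∙ e)ᗮ.reflection : Plane ≃ₗᵢ[ℝ] Plane).measurePreserving
  exact (measurePreserving_add_right volume ((2 * t) • e)).comp h1

theorem continuous_reflect : Continuous (reflect e t) := by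
  unfold reflect
  fun_prop

theorem hasFDerivAt_reflect (x : Plane) : HasFDerivAt (reflect e t)
    (((ℝ ∙ e)ᗮ.reflection : Plane ≃ₗᵢ[ℝ] Plane).toContinuousLinearEquiv : Plane →L[ℝ] Plane) x :=
  (((ℝ ∙ e)ᗮ.reflection : Plane ≃ₗᵢ[ℝ] Plane).toContinuousLinearEquiv.hasFDerivAt).add_const _

theorem norm_fderiv_comp_reflect {v : Plane → ℝ} {x : Plane}
    (hv : DifferentiableAt ℝ v (reflect e t x)) :
    ‖fderiv ℝ (fun y => v (reflect e t y)) x‖ = ‖fderiv ℝ v (reflect e t x)‖ := by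
  have h : HasFDerivAt (fun y => v (reflect e t y)) _ x :=
    hv.hasFDerivAt.comp x (hasFDerivAt_reflect x)
  rw [h.fderiv]
  exact ContinuousLinearMap.opNorm_comp_linearIsometryEquiv _ _

theorem integral_comp_reflect (he : ‖e‖ = 1) (f : Plane → ℝ) :
    ∫ x, f (reflect e t x) = ∫ x, f x := by
  let m : Plane ≃ₜ Plane :=
    { toFun := reflect e t
      invFun := reflect e t
      left_inv := reflect_reflect he
      right_inv := reflect_reflect he
      continuous_toFun := continuous_reflect
      continuous_invFun := continuous_reflect }
  exact (measurePreserving_reflect (e := e) (t := t)).integral_comp m.measurableEmbedding f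

theorem integral_eq_of_add_comp_reflect (he : ‖e‖ = 1) {f g : Plane → ℝ} (hf : Integrable f)
    (hg : Integrable g)
    (h : ∀ᵐ x, f x + f (reflect e t x) = g x + g (reflect e t x)) : ∫ x, f x = ∫ x, g x := by
  have hf' : Integrable fun x => f (reflect e t x) :=
    measurePreserving_reflect.integrable_comp_of_integrable hf
  have hg' : Integrable fun x => g (reflect e t x) :=
    measurePreserving_reflect.integrable_comp_of_integrable hg
  have := integral_congr_ae h
  rw [integral_add hf hf', integral_add hg hg', integral_comp_reflect he,
    integral_comp_reflect he] at this
  linarith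

/-- On each orbit {x, σx} of the reflection σ, polarization either does nothing or exchanges the two
values. Hence the sum over the orbit of any function of the value is unchanged, and so is its
integral. -/
theorem polarize_pair (he : ‖e‖ = 1) (v : Plane → ℝ) (x : Plane) :
    (polarize e t v x = v x ∧ polarize e t v (reflect e t x) = v (reflect e t x)) ∨
    (polarize e t v x = v (reflect e t x) ∧ polarize e t v (reflect e t x) = v x) := by
  rcases eq_or_ne ⟪e, x⟫ t with h | h
  · left
    rw [reflect_eq_self he h]
    simp [polarize, h, reflect_eq_self he h]
  · unfold polarize
    rw [inner_reflect he, reflect_reflect he]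
    rcases lt_or_gt_of_ne h with h | h
    · rw [if_pos h.le, if_neg (by linarith)]
      rcases le_total (v x) (v (reflect e t x)) with h' | h'
      · right
        exact ⟨max_eq_right h', min_eq_right h'⟩
      · left
        exact ⟨max_eq_left h', min_eq_left h'⟩
    · rw [if_neg (by linarith), if_pos (by linarith)]
      rcases le_total (v x) (v (reflect e t x)) with h' | h'
      · left
        exact ⟨min_eq_left h', max_eq_left h'⟩
      · right
        exact ⟨min_eq_right h', max_eq_right h'⟩

theorem LipschitzWith.polarize {L : ℝ≥0} {v : Plane → ℝ} (hv : LipschitzWith L v)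
    (he : ‖e‖ = 1) : LipschitzWith L (polarize e t v) := by
  have hvσ : LipschitzWith L fun x => v (reflect e t x) := LipschitzWith.of_dist_le_mul
    fun x y => (hv.dist_le_mul _ _).trans (by rw [dist_reflect])
  have hmax : LipschitzWith L fun x => max (v x) (v (reflect e t x)) := by
    simpa using hv.max hvσ
  have hmin : LipschitzWith L fun x => min (v x) (v (reflect e t x)) := by
    simpa using hv.min hvσ
  -- Across the line, a maximum is compared with a minimum. Each of the four differences between a
  -- value at x or σx and a value at y or σy is at most L times the distance of x and y.
  have key : ∀ x y : Plane, ⟪e, x⟫ ≤ t → t < ⟪e, y⟫ →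
      dist (CubicQuintic.polarize e t v x) (CubicQuintic.polarize e t v y) ≤ L * dist x y := by
    intro x y hx hy
    simp only [CubicQuintic.polarize, if_pos hx, if_neg (not_le.2 hy)]
    have hd : dist (reflect e t x) y ≤ dist x y := by
      refine (abs_le_of_sq_le_sq' ?_ dist_nonneg).2
      rw [dist_reflect_sq he]
      nlinarith
    have hd' : dist x (reflect e t y) ≤ dist x y := by
      rw [← reflect_reflect (t := t) he x, dist_reflect, reflect_reflect he]
      exact hd
    have b1 := abs_le.1 (hv.dist_le_mul x y)
    have b2 := abs_le.1 (hv.dist_le_mul (reflect e t x) (reflect e t y))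
    have b3 := abs_le.1 ((hv.dist_le_mul (reflect e t x) y).trans
      (mul_le_mul_of_nonneg_left hd L.2))
    have b4 := abs_le.1 ((hv.dist_le_mul x (reflect e t y)).trans
      (mul_le_mul_of_nonneg_left hd' L.2))
    rw [dist_reflect] at b2
    rw [Real.dist_eq, abs_le]
    rcases le_total (v x) (v (reflect e t x)) with h1 | h1 <;>
    rcases le_total (v y) (v (reflect e t y)) with h2 | h2 <;>
    simp only [max_eq_left, max_eq_right, min_eq_left, min_eq_right, h1, h2] <;>
    constructor <;> linarith
  refine LipschitzWith.of_dist_le_mul fun x y => ?_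
  rcases le_or_gt ⟪e, x⟫ t with hx | hx <;> rcases le_or_gt ⟪e, y⟫ t with hy | hy
  · simp only [CubicQuintic.polarize, if_pos hx, if_pos hy]
    exact hmax.dist_le_mul x y
  · exact key x y hx hy
  · rw [dist_comm, dist_comm x]
    exact key y x hy hx
  · simp only [CubicQuintic.polarize, if_neg (not_le.2 hx), if_neg (not_le.2 hy)]
    exact hmin.dist_le_mul x y

end Reflect

/-- Two functions that touch from one side at a point have the same derivative there. -/
theorem fderiv_eq_of_le_of_eq {f g : Plane → ℝ} {x : Plane} (hf : DifferentiableAt ℝ f x)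
    (hg : DifferentiableAt ℝ g x) (h : ∀ y, f y ≤ g y) (hx : f x = g x) :
    fderiv ℝ f x = fderiv ℝ g x := by
  have hm : IsLocalMin (fun y => g y - f y) x := .of_forall fun y => by
    simp only [hx, sub_self]
    linarith [h y]
  have := hm.fderiv_eq_zero
  rw [fderiv_fun_sub hg hf, sub_eq_zero] at this
  exact this.symm

/-- Where f ≠ g the maximum and the minimum are locally f and g in some order. Where f = g, the
maximum touches f from above and the minimum touches g from below, so the derivatives agree in
pairs. -/
theorem norm_fderiv_max_min {f g : Plane → ℝ} {x : Plane} (hf : DifferentiableAt ℝ f x)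
    (hg : DifferentiableAt ℝ g x) (hM : DifferentiableAt ℝ (fun y => max (f y) (g y)) x)
    (hm : DifferentiableAt ℝ (fun y => min (f y) (g y)) x) :
    ‖fderiv ℝ (fun y => max (f y) (g y)) x‖ ^ 2 + ‖fderiv ℝ (fun y => min (f y) (g y)) x‖ ^ 2
      = ‖fderiv ℝ f x‖ ^ 2 + ‖fderiv ℝ g x‖ ^ 2 := by
  rcases lt_trichotomy (f x) (g x) with h | h | h
  · have hev : ∀ᶠ y in 𝓝 x, f y < g y :=
      hf.continuousAt.eventually_lt hg.continuousAt h
    have e1 : (fun y => max (f y) (g y)) =ᶠ[𝓝 x] g := hev.mono fun y hy => max_eq_right hy.le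
    have e2 : (fun y => min (f y) (g y)) =ᶠ[𝓝 x] f := hev.mono fun y hy => min_eq_left hy.le
    rw [e1.fderiv_eq, e2.fderiv_eq]
    ring
  · rw [← fderiv_eq_of_le_of_eq hf hM (fun y => le_max_left _ _) (by simp [h]),
      fderiv_eq_of_le_of_eq hm hg (fun y => min_le_right _ _) (by simp [h])]
  · have hev : ∀ᶠ y in 𝓝 x, g y < f y :=
      hg.continuousAt.eventually_lt hf.continuousAt h
    have e1 : (fun y => max (f y) (g y)) =ᶠ[𝓝 x] f := hev.mono fun y hy => max_eq_left hy.le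
    have e2 : (fun y => min (f y) (g y)) =ᶠ[𝓝 x] g := hev.mono fun y hy => min_eq_right hy.le
    rw [e1.fderiv_eq, e2.fderiv_eq]

theorem volume_line_eq_zero {e : Plane} (he : ‖e‖ = 1) (t : ℝ) :
    volume {x : Plane | ⟪e, x⟫ = t} = 0 := by
  have hne : LinearMap.ker (innerₛₗ ℝ e) ≠ ⊤ := by
    intro h
    rw [LinearMap.ker_eq_top] at h
    have := congrArg (fun f => f e) h
    simp [he] at this
  have h0 := Measure.addHaar_submodule (volume : Measure Plane) _ hne
  have : {x : Plane | ⟪e, x⟫ = t} = (fun x => x + (-(t • e))) ⁻¹' (LinearMap.ker (innerₛₗ ℝ e)) := by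
    ext x
    simp only [mem_ofPred_eq, mem_preimage, SetLike.mem_coe, LinearMap.mem_ker, innerₛₗ_apply_apply,
      inner_add_right, inner_neg_right, inner_smul_right, real_inner_self_eq_norm_sq, he]
    constructor <;> intro h <;> linarith
  rw [this, measure_preimage_add_right]
  exact h0

/-- Off the reflecting line, which is null, the polarization P and P ∘ σ are locally the maximum and
the minimum of v and v ∘ σ, in some order; σ is an isometry, so it does not affect the norm of a
derivative. -/
theorem ae_norm_fderiv_polarize {e : Plane} {t : ℝ} (he : ‖e‖ = 1) {L : ℝ≥0} {v : Plane → ℝ}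
    (hv : LipschitzWith L v) :
    ∀ᵐ x, ‖fderiv ℝ (polarize e t v) x‖ ^ 2 + ‖fderiv ℝ (polarize e t v) (reflect e t x)‖ ^ 2
      = ‖fderiv ℝ v x‖ ^ 2 + ‖fderiv ℝ v (reflect e t x)‖ ^ 2 := by
  set P := polarize e t v
  have hP : LipschitzWith L P := LipschitzWith.polarize hv he
  have hvσ : LipschitzWith L fun x => v (reflect e t x) := LipschitzWith.of_dist_le_mul
    fun x y => (hv.dist_le_mul _ _).trans (by rw [dist_reflect])
  have hmax : LipschitzWith L fun x => max (v x) (v (reflect e t x)) := by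
    simpa using hv.max hvσ
  have hmin : LipschitzWith L fun x => min (v x) (v (reflect e t x)) := by
    simpa using hv.min hvσ
  have hq := (measurePreserving_reflect (e := e) (t := t)).quasiMeasurePreserving
  have dv := hv.ae_differentiableAt (μ := (volume : Measure Plane))
  have dP := hP.ae_differentiableAt (μ := (volume : Measure Plane))
  have hl : ∀ᵐ x : Plane, ⟪e, x⟫ ≠ t := by
    rw [ae_iff]
    simpa using volume_line_eq_zero he t
  have hcont : Continuous fun x : Plane => ⟪e, x⟫ := by fun_prop
  have hPe : ∀ x : Plane, P (reflect e t x) =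
      if ⟪e, x⟫ < t then min (v x) (v (reflect e t x)) else max (v x) (v (reflect e t x)) := by
    intro x
    rcases eq_or_ne ⟪e, x⟫ t with h | h
    · simp [P, polarize, h, reflect_eq_self he h]
    · simp only [P, polarize, inner_reflect he, reflect_reflect he]
      rcases lt_or_gt_of_ne h with h | h
      · rw [if_neg (by linarith), if_pos h, min_comm]
      · rw [if_pos (by linarith), if_neg (by linarith), max_comm]
  filter_upwards [dv, hq.ae dv, dP, hq.ae dP, hvσ.ae_differentiableAt (μ := (volume : Measure Plane)),
    hmax.ae_differentiableAt (μ := (volume : Measure Plane)),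
    hmin.ae_differentiableAt (μ := (volume : Measure Plane)), hl] with x h1 h2 h3 h4 h5 h6 h7 h8
  rw [← norm_fderiv_comp_reflect h4, ← norm_fderiv_comp_reflect h2, ← norm_fderiv_max_min h1 h5 h6 h7]
  rcases lt_or_gt_of_ne h8 with h | h
  · have hev : ∀ᶠ y in 𝓝 x, ⟪e, y⟫ < t := hcont.continuousAt.eventually_lt continuousAt_const h
    have e1 : P =ᶠ[𝓝 x] fun y => max (v y) (v (reflect e t y)) :=
      hev.mono fun y hy => if_pos (le_of_lt hy)
    have e2 : (fun y => P (reflect e t y)) =ᶠ[𝓝 x] fun y => min (v y) (v (reflect e t y)) :=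
      hev.mono fun y hy => (hPe y).trans (if_pos hy)
    rw [e1.fderiv_eq, e2.fderiv_eq]
  · have hev : ∀ᶠ y in 𝓝 x, t < ⟪e, y⟫ := continuousAt_const.eventually_lt hcont.continuousAt h
    have e1 : P =ᶠ[𝓝 x] fun y => min (v y) (v (reflect e t y)) :=
      hev.mono fun y hy => if_neg (not_le.2 hy)
    have e2 : (fun y => P (reflect e t y)) =ᶠ[𝓝 x] fun y => max (v y) (v (reflect e t y)) :=
      hev.mono fun y hy => (hPe y).trans (if_neg (not_lt.2 (le_of_lt hy)))
    rw [e1.fderiv_eq, e2.fderiv_eq, add_comm]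

end CubicQuintic

end

noncomputable section

namespace CubicQuintic

open Filter Topology Set
open scoped ENNReal NNReal RealInnerProductSpace

/-! ### Symmetrization -/

theorem exists_subseq_tendsto_of_countable {ι : Type*} [Countable ι] {v : ℕ → ι → ℝ} {M : ι → ℝ}
    (h : ∀ n i, |v n i| ≤ M i) : ∃ φ : ℕ → ℕ, StrictMono φ ∧ ∃ w : ι → ℝ,
      ∀ i, Tendsto (fun n => v (φ n) i) atTop (𝓝 (w i)) := by
  have hc : IsCompact (univ.pi fun i => Icc (-M i) (M i)) :=
    isCompact_univ_pi fun i => isCompact_Icc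
  obtain ⟨w, -, φ, hφ, hw⟩ := hc.tendsto_subseq (x := v) fun n i _ => abs_le.1 (h n i)
  exact ⟨φ, hφ, w, fun i => tendsto_pi_nhds.1 hw i⟩

/-- The pointwise part of Arzelà–Ascoli: diagonal extraction on a countable dense set, then the
common Lipschitz constant spreads convergence to every point. -/
theorem exists_subseq_tendsto_of_lipschitz {v : ℕ → Plane → ℝ} {L : ℝ≥0} {M : ℝ}
    (hv : ∀ n, LipschitzWith L (v n)) (h : ∀ n x, |v n x| ≤ M) :
    ∃ φ : ℕ → ℕ, StrictMono φ ∧ ∃ w : Plane → ℝ,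
      ∀ x, Tendsto (fun n => v (φ n) x) atTop (𝓝 (w x)) := by
  obtain ⟨s, hs, hsd⟩ := TopologicalSpace.exists_countable_dense Plane
  have := hs.to_subtype
  obtain ⟨φ, hφ, w, hw⟩ := exists_subseq_tendsto_of_countable
    (v := fun n (i : s) => v n i) (M := fun _ => M) fun n i => h n i
  have hcau : ∀ x, CauchySeq fun n => v (φ n) x := by
    intro x
    rw [Metric.cauchySeq_iff]
    intro ε hε
    obtain ⟨y, hys, hy⟩ := hsd.exists_dist_lt x (ε := ε / (3 * (L + 1))) (by positivity)
    obtain ⟨N, hN⟩ := Metric.cauchySeq_iff.1 (hw ⟨y, hys⟩).cauchySeq (ε / 3) (by positivity)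
    refine ⟨N, fun m hm n hn => ?_⟩
    have h1 := (hv (φ m)).dist_le_mul x y
    have h2 := (hv (φ n)).dist_le_mul y x
    rw [dist_comm y x] at h2
    have h3 : (L : ℝ) * dist x y < ε / 3 := by
      rw [lt_div_iff₀ (by positivity)] at hy
      have hL : (0 : ℝ) ≤ L := L.2
      nlinarith [dist_nonneg (x := x) (y := y)]
    have h4 := hN m hm n hn
    simp only at h4
    linarith [dist_triangle (v (φ m) x) (v (φ m) y) (v (φ n) x),
      dist_triangle (v (φ m) y) (v (φ n) y) (v (φ n) x)]
  choose w' hw' using fun x => cauchySeq_tendsto_of_complete (hcau x)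
  exact ⟨φ, hφ, w', hw'⟩

/-- Nonnegative Lipschitz functions supported in a ball. -/
structure IsBump (L : ℝ≥0) (R : ℝ) (v : Plane → ℝ) : Prop where
  nonneg : ∀ x, 0 ≤ v x
  lipschitz : LipschitzWith L v
  eq_zero : ∀ x, R < ‖x‖ → v x = 0

namespace IsBump

variable {L : ℝ≥0} {R : ℝ} {v : Plane → ℝ}

theorem hasCompactSupport (h : IsBump L R v) : HasCompactSupport v :=
  HasCompactSupport.intro (isCompact_closedBall 0 R) fun x hx => h.eq_zero x (by
    simpa using hx)

theorem continuous (h : IsBump L R v) : Continuous v := h.lipschitz.continuous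

theorem integrable_pow (h : IsBump L R v) {k : ℕ} (hk : k ≠ 0) :
    Integrable fun x => v x ^ k := by
  refine (h.continuous.pow k).integrable_of_hasCompactSupport ?_
  exact h.hasCompactSupport.comp_left (g := fun t : ℝ => t ^ k) (zero_pow hk)

theorem norm_fderiv_le (h : IsBump L R v) (x : Plane) : ‖fderiv ℝ v x‖ ≤ L :=
  norm_fderiv_le_of_lipschitz ℝ h.lipschitz

theorem integrable_norm_fderiv_sq (h : IsBump L R v) :
    Integrable fun x => ‖fderiv ℝ v x‖ ^ 2 := by
  have hm : AEStronglyMeasurable (fun x => ‖fderiv ℝ v x‖ ^ 2) volume :=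
    ((measurable_fderiv ℝ v).norm.pow_const 2).aestronglyMeasurable
  have hi : Integrable ((Metric.closedBall (0 : Plane) R).indicator fun _ => (L : ℝ) ^ 2) :=
    (integrable_indicator_iff Metric.isClosed_closedBall.measurableSet).2
      (integrableOn_const measure_closedBall_lt_top.ne)
  refine hi.mono' hm (.of_forall fun x => ?_)
  rw [Real.norm_of_nonneg (by positivity)]
  by_cases hx : x ∈ Metric.closedBall (0 : Plane) R
  · rw [indicator_of_mem hx]
    gcongr
    exact h.norm_fderiv_le x
  · have h0 : v =ᶠ[𝓝 x] fun _ => 0 := by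
      filter_upwards [Metric.isClosed_closedBall.isOpen_compl.mem_nhds hx] with y hy
      exact h.eq_zero y (by simpa using hy)
    rw [h0.fderiv_eq, indicator_of_notMem hx]
    simp

theorem isH1 (h : IsBump L R v) : IsH1 (toComplex v) (gradReal v) := by
  refine ⟨hasWeakGradient_gradReal h.lipschitz, ?_, ?_⟩
  · exact (Complex.continuous_ofReal.comp h.continuous).memLp_of_hasCompactSupport
      (h.hasCompactSupport.comp_left Complex.ofReal_zero)
  · refine (memLp_iff_integrable_norm_pow (measurable_gradReal v).aestronglyMeasurable
      two_ne_zero).2 ?_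
    simp only [norm_gradReal_sq]
    exact h.integrable_norm_fderiv_sq

theorem le_bound (h : IsBump L R v) (hR : 0 ≤ R) (x : Plane) : |v x| ≤ L * (2 * R + 1) := by
  rw [abs_of_nonneg (h.nonneg x)]
  rcases lt_or_ge R ‖x‖ with hx | hx
  · rw [h.eq_zero x hx]
    positivity
  -- Comparison with a point just outside the support gives a bound common to all functions of the
  -- class.
  · set y : Plane := EuclideanSpace.single 0 (R + 1)
    have hy : ‖y‖ = R + 1 := by
      simp only [y, PiLp.norm_single, Real.norm_eq_abs]
      exact abs_of_nonneg (by linarith)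
    have h1 := (abs_le.1 (h.lipschitz.dist_le_mul x y)).2
    rw [h.eq_zero y (by linarith)] at h1
    have h2 : dist x y ≤ 2 * R + 1 := by
      rw [dist_eq_norm]
      linarith [norm_sub_le x y]
    have := mul_le_mul_of_nonneg_left h2 L.2
    simp only [NNReal.val_eq_coe] at this
    linarith

/-- For 0 ≤ t the origin lies in the half plane that receives the larger values. A point of that
half plane has a reflection at least as far from the origin, so no mass leaves the ball. -/
theorem polarize (h : IsBump L R v) {e : Plane} {t : ℝ} (he : ‖e‖ = 1) (ht : 0 ≤ t) :
    IsBump L R (polarize e t v) := by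
  refine ⟨fun x => ?_, LipschitzWith.polarize h.lipschitz he, fun x hx => ?_⟩
  · rcases polarize_pair (t := t) he v x with h1 | h1 <;> rw [h1.1] <;> exact h.nonneg _
  · simp only [CubicQuintic.polarize]
    rw [h.eq_zero x hx]
    split_ifs with hxt
    · rw [h.eq_zero _, max_self]
      have := norm_reflect_sq (t := t) he x
      refine lt_of_lt_of_le hx (abs_le_of_sq_le_sq' ?_ (norm_nonneg _)).2
      rw [this]
      nlinarith
    · exact min_eq_left (h.nonneg _)

theorem integral_polarize_pow (h : IsBump L R v) {e : Plane} {t : ℝ} (he : ‖e‖ = 1) (ht : 0 ≤ t)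
    {k : ℕ} (hk : k ≠ 0) : ∫ x, CubicQuintic.polarize e t v x ^ k = ∫ x, v x ^ k := by
  refine integral_eq_of_add_comp_reflect (t := t) he ((h.polarize he ht).integrable_pow hk)
    (h.integrable_pow hk) (.of_forall fun x => ?_)
  rcases polarize_pair (t := t) he v x with h1 | h1 <;> rw [h1.1, h1.2]
  ring

theorem integral_norm_fderiv_polarize_sq (h : IsBump L R v) {e : Plane} {t : ℝ} (he : ‖e‖ = 1)
    (ht : 0 ≤ t) :
    ∫ x, ‖fderiv ℝ (CubicQuintic.polarize e t v) x‖ ^ 2 = ∫ x, ‖fderiv ℝ v x‖ ^ 2 :=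
  integral_eq_of_add_comp_reflect he (h.polarize he ht).integrable_norm_fderiv_sq
    h.integrable_norm_fderiv_sq (ae_norm_fderiv_polarize he h.lipschitz)

theorem integrable_moment (h : IsBump L R v) : Integrable fun x => ‖x‖ ^ 2 * v x :=
  ((continuous_norm.pow 2).mul h.continuous).integrable_of_hasCompactSupport
    (h.hasCompactSupport.mono fun x hx h0 => hx (by
      change ‖x‖ ^ 2 * v x = 0
      rw [h0, mul_zero]))

/-- The reflection that exchanges a and b carries the larger of each pair of values to the side of
the origin. This never raises the moment, and it lowers it strictly near a, where the values really
are exchanged. -/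
theorem integral_moment_polarize_lt (h : IsBump L R v) {a b : Plane} (hab : ‖a‖ < ‖b‖)
    (hv : v a < v b) : ∃ (e : Plane) (t : ℝ), ‖e‖ = 1 ∧ 0 ≤ t ∧
      ∫ x, ‖x‖ ^ 2 * CubicQuintic.polarize e t v x < ∫ x, ‖x‖ ^ 2 * v x := by
  have hne : b - a ≠ 0 := by
    intro h0
    rw [sub_eq_zero.1 h0] at hab
    exact lt_irrefl _ hab
  have hpos : 0 < ‖b - a‖ := norm_pos_iff.2 hne
  set e : Plane := ‖b - a‖⁻¹ • (b - a) with he_def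
  have he : ‖e‖ = 1 := by
    rw [he_def, norm_smul, norm_inv, norm_norm, inv_mul_cancel₀ hpos.ne']
  -- The signed distance from the origin to the perpendicular bisector of a and b; it is positive
  -- because a is closer to the origin.
  set t : ℝ := ‖b - a‖⁻¹ * ((‖b‖ ^ 2 - ‖a‖ ^ 2) / 2) with ht_def
  have ht : 0 < t := by
    have : ‖a‖ ^ 2 < ‖b‖ ^ 2 := by gcongr
    have : 0 < (‖b‖ ^ 2 - ‖a‖ ^ 2) / 2 := by linarith
    positivity
  have hea : ⟪e, a⟫ - t = -(‖b - a‖ / 2) := by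
    have h1 : ‖b - a‖ ^ 2 = ‖b‖ ^ 2 - 2 * ⟪b, a⟫ + ‖a‖ ^ 2 := norm_sub_sq_real b a
    rw [he_def, inner_smul_left, inner_sub_left, real_inner_self_eq_norm_sq, ht_def]
    simp only [conj_trivial]
    field_simp
    linarith
  have hσa : reflect e t a = b := by
    rw [reflect_apply he, hea, he_def, smul_smul]
    have : 2 * -(‖b - a‖ / 2) * ‖b - a‖⁻¹ = -1 := by
      field_simp
    rw [this]
    simp
  refine ⟨e, t, he, ht.le, ?_⟩
  set P := CubicQuintic.polarize e t v with hP_def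
  have hP : IsBump L R P := h.polarize he ht.le
  -- The drop of the moment density, summed over the orbit {x, σx}. It is continuous, nonnegative
  -- and nonzero at a, so its integral, twice the drop of the moment, is positive.
  set d : Plane → ℝ := fun x => (‖x‖ ^ 2 * v x - ‖x‖ ^ 2 * P x)
    + (‖reflect e t x‖ ^ 2 * v (reflect e t x) - ‖reflect e t x‖ ^ 2 * P (reflect e t x)) with hd
  have i1 : Integrable fun x => ‖x‖ ^ 2 * v x - ‖x‖ ^ 2 * P x :=
    h.integrable_moment.sub hP.integrable_moment
  have i2 : Integrable fun x => ‖reflect e t x‖ ^ 2 * v (reflect e t x)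
      - ‖reflect e t x‖ ^ 2 * P (reflect e t x) :=
    measurePreserving_reflect.integrable_comp_of_integrable i1
  have hid : ∫ x, d x = 2 * (∫ x, ‖x‖ ^ 2 * v x) - 2 * ∫ x, ‖x‖ ^ 2 * P x := by
    rw [hd, integral_add i1 i2,
      integral_comp_reflect he (fun x => ‖x‖ ^ 2 * v x - ‖x‖ ^ 2 * P x),
      integral_sub h.integrable_moment hP.integrable_moment]
    ring
  have hdx : ∀ x, d x = 0 ∨ d x = 4 * t * (t - ⟪e, x⟫) * (v (reflect e t x) - v x) := by
    intro x
    rcases polarize_pair (t := t) he v x with h1 | h1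
    · left
      simp only [hd, P, h1.1, h1.2]
      ring
    · right
      simp only [hd, P, h1.1, h1.2, norm_reflect_sq he]
      ring
  have hd0 : ∀ x, 0 ≤ d x := by
    intro x
    have hn := norm_reflect_sq (t := t) he x
    rcases le_total ⟪e, x⟫ t with hx | hx
    · have hPx : P x = max (v x) (v (reflect e t x)) := if_pos hx
      rcases polarize_pair (t := t) he v x with h1 | h1
      · simp only [hd, P, h1.1, h1.2]
        linarith
      · have h3 : v x ≤ v (reflect e t x) := by
          rw [← h1.1]
          change v x ≤ P x
          rw [hPx]
          exact le_max_left _ _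
        simp only [hd, P, h1.1, h1.2, hn]
        have : 0 ≤ 4 * t * (t - ⟪e, x⟫) * (v (reflect e t x) - v x) :=
          mul_nonneg (mul_nonneg (by positivity) (by linarith)) (by linarith)
        linarith
    · rcases hx.eq_or_lt with hx | hx
      · rcases hdx x with h1 | h1 <;> rw [h1]
        rw [← hx]
        simp
      have hPx : P x = min (v x) (v (reflect e t x)) := if_neg (not_le.2 hx)
      rcases polarize_pair (t := t) he v x with h1 | h1
      · simp only [hd, P, h1.1, h1.2]
        linarith
      · have h3 : v (reflect e t x) ≤ v x := by
          rw [← h1.1]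
          change P x ≤ v x
          rw [hPx]
          exact min_le_left _ _
        simp only [hd, P, h1.1, h1.2, hn]
        have : 0 ≤ 4 * t * (⟪e, x⟫ - t) * (v x - v (reflect e t x)) :=
          mul_nonneg (mul_nonneg (by positivity) (by linarith)) (by linarith)
        linarith
  have hda : d a ≠ 0 := by
    have hlt : ⟪e, a⟫ < t := by linarith
    have hPa : P a = v (reflect e t a) := by
      change (if ⟪e, a⟫ ≤ t then _ else _) = _
      rw [if_pos hlt.le, hσa, max_eq_right hv.le]
    rcases polarize_pair (t := t) he v a with h1 | h1
    · exfalso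
      have : P a = v a := h1.1
      rw [hPa, hσa] at this
      linarith
    · have hn := norm_reflect_sq (t := t) he a
      have e1 : d a = 4 * t * (t - ⟪e, a⟫) * (v (reflect e t a) - v a) := by
        simp only [hd, P, h1.1, h1.2, hn]
        ring
      rw [e1, hσa]
      have : 0 < 4 * t * (t - ⟪e, a⟫) * (v b - v a) :=
        mul_pos (mul_pos (by positivity) (by linarith)) (by linarith)
      exact this.ne'
  have hdc : Continuous d := by
    have c1 : Continuous fun x => ‖x‖ ^ 2 * v x - ‖x‖ ^ 2 * P x :=
      ((continuous_norm.pow 2).mul h.continuous).sub ((continuous_norm.pow 2).mul hP.continuous)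
    exact c1.add (c1.comp continuous_reflect)
  have := integral_pos_of_integrable_nonneg_nonzero hdc (i1.add i2) hd0 hda
  rw [hid] at this
  linarith

end IsBump

/-- Among the bumps with the same L and R, the same power integrals and no larger Dirichlet
integral, one has least second moment: compactness is Arzelà–Ascoli, and the constraints are closed
by dominated convergence and by lower semicontinuity of the Dirichlet integral. The class is stable
under polarization, so a minimizer that failed to decrease radially could be improved. -/
theorem exists_symmetrization {L : ℝ≥0} {R : ℝ} (hR : 0 ≤ R) {v : Plane → ℝ} (hv : IsBump L R v) :
    ∃ w : Plane → ℝ, IsBump L R w ∧ (∀ x y, ‖x‖ < ‖y‖ → w y ≤ w x) ∧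
      (∀ k : ℕ, k ≠ 0 → ∫ x, w x ^ k = ∫ x, v x ^ k) ∧
      ∫ x, ‖fderiv ℝ w x‖ ^ 2 ≤ ∫ x, ‖fderiv ℝ v x‖ ^ 2 := by
  let K : Set (Plane → ℝ) := {w | IsBump L R w ∧ (∀ k : ℕ, k ≠ 0 → ∫ x, w x ^ k = ∫ x, v x ^ k) ∧
    ∫ x, ‖fderiv ℝ w x‖ ^ 2 ≤ ∫ x, ‖fderiv ℝ v x‖ ^ 2}
  have hvK : v ∈ K := ⟨hv, fun _ _ => rfl, le_rfl⟩
  let J : (Plane → ℝ) → ℝ := fun w => ∫ x, ‖x‖ ^ 2 * w x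
  have hJ0 : ∀ w ∈ K, 0 ≤ J w := fun w hw => integral_nonneg fun x =>
    mul_nonneg (by positivity) (hw.1.nonneg x)
  suffices h : ∃ w ∈ K, ∀ w' ∈ K, J w ≤ J w' by
    obtain ⟨w, ⟨hw1, hw2, hw3⟩, hmin⟩ := h
    refine ⟨w, hw1, fun a b hab => ?_, hw2, hw3⟩
    by_contra! hlt
    obtain ⟨e, t, he, ht, hlt'⟩ := hw1.integral_moment_polarize_lt hab hlt
    refine absurd (hmin (polarize e t w) ⟨hw1.polarize he ht, fun k hk => ?_, ?_⟩)
      (not_le.2 hlt')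
    · rw [hw1.integral_polarize_pow he ht hk, hw2 k hk]
    · rw [hw1.integral_norm_fderiv_polarize_sq he ht]
      exact hw3
  have hne : (J '' K).Nonempty := ⟨J v, v, hvK, rfl⟩
  have hbdd : BddBelow (J '' K) := ⟨0, by
    rintro _ ⟨w, hw, rfl⟩
    exact hJ0 w hw⟩
  obtain ⟨j, -, hj, hjK⟩ := exists_seq_tendsto_sInf hne hbdd
  choose w hwK hwj using hjK
  obtain ⟨φ, hφ, w₁, hw₁⟩ := exists_subseq_tendsto_of_lipschitz
    (fun n => (hwK n).1.lipschitz) fun n x => (hwK n).1.le_bound hR x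
  have hbd : ∀ n, ∫ x, ‖fderiv ℝ (w (φ n)) x‖ ^ 2
      ∈ Icc (0 : ℝ) (∫ x, ‖fderiv ℝ v x‖ ^ 2) := fun n =>
    ⟨integral_nonneg fun x => by positivity, (hwK (φ n)).2.2⟩
  -- A second extraction makes the Dirichlet integrals converge, as the semicontinuity lemma
  -- requires.
  obtain ⟨a, ha, ψ, hψ, hlim⟩ := isCompact_Icc.tendsto_subseq hbd
  set z : ℕ → Plane → ℝ := fun n => w (φ (ψ n)) with hz
  have hzK : ∀ n, z n ∈ K := fun n => hwK _
  have hz₁ : ∀ x, Tendsto (fun n => z n x) atTop (𝓝 (w₁ x)) := fun x =>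
    (hw₁ x).comp hψ.tendsto_atTop
  have hb₁ : IsBump L R w₁ := by
    refine ⟨fun x => ge_of_tendsto (hz₁ x) (.of_forall fun n => (hzK n).1.nonneg x), ?_,
      fun x hx => ?_⟩
    · exact LipschitzWith.of_dist_le_mul fun x y => le_of_tendsto ((hz₁ x).dist (hz₁ y))
        (.of_forall fun n => (hzK n).1.lipschitz.dist_le_mul x y)
    · refine tendsto_nhds_unique (hz₁ x) ?_
      simp only [(hzK _).1.eq_zero x hx]
      exact tendsto_const_nhds
  set M : ℝ := L * (2 * R + 1)
  have hM0 : 0 ≤ M := by positivity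
  set h : Plane → ℝ := (Metric.closedBall (0 : Plane) R).indicator fun _ => M
  have hzh : ∀ n x, |z n x| ≤ h x := by
    intro n x
    by_cases hx : x ∈ Metric.closedBall (0 : Plane) R
    · simp only [h, indicator_of_mem hx]
      exact (hzK n).1.le_bound hR x
    · simp only [h, indicator_of_notMem hx]
      rw [(hzK n).1.eq_zero x (by simpa using hx), abs_zero]
  have hint : ∀ c : ℝ, Integrable ((Metric.closedBall (0 : Plane) R).indicator fun _ => c) :=
    fun c => (integrable_indicator_iff Metric.isClosed_closedBall.measurableSet).2
      (integrableOn_const measure_closedBall_lt_top.ne)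
  have hpow : ∀ k : ℕ, k ≠ 0 → ∫ x, w₁ x ^ k = ∫ x, v x ^ k := by
    intro k hk
    have t : Tendsto (fun n => ∫ x, z n x ^ k) atTop (𝓝 (∫ x, w₁ x ^ k)) := by
      refine tendsto_integral_of_dominated_convergence
        ((Metric.closedBall (0 : Plane) R).indicator fun _ => M ^ k)
        (fun n => ((hzK n).1.continuous.pow k).aestronglyMeasurable) (hint _)
        (fun n => .of_forall fun x => ?_) (.of_forall fun x => (hz₁ x).pow k)
      rw [norm_pow, Real.norm_eq_abs]
      refine (pow_le_pow_left₀ (abs_nonneg _) (hzh n x) k).trans ?_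
      by_cases hx : x ∈ Metric.closedBall (0 : Plane) R
      · simp only [h, indicator_of_mem hx, le_refl]
      · simp only [h, indicator_of_notMem hx, zero_pow hk, le_refl]
    refine tendsto_nhds_unique t ?_
    simp only [(hzK _).2.1 k hk]
    exact tendsto_const_nhds
  have hgrad : ∫ x, ‖fderiv ℝ w₁ x‖ ^ 2 ≤ a := by
    obtain ⟨g₀, hg₀, -, hle⟩ := exists_isWeakGradient_of_tendsto (u := fun n => toComplex (z n))
      (g := fun n => gradReal (z n)) (w := toComplex w₁) (h := h) (a := a)
      (fun n => (hzK n).1.isH1.1) (fun n => (hzK n).1.isH1.3)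
      (by simp only [norm_gradReal_sq]; exact hlim) (hint M).locallyIntegrable
      (fun n => .of_forall fun x => by simpa [toComplex] using hzh n x)
      (.of_forall fun x => (Complex.continuous_ofReal.tendsto _).comp (hz₁ x))
    have e := hg₀.ae_eq hb₁.isH1.1
    calc ∫ x, ‖fderiv ℝ w₁ x‖ ^ 2 = ∫ x, ‖g₀ x‖ ^ 2 := by
          refine integral_congr_ae ?_
          filter_upwards [e] with x hx
          rw [hx, norm_gradReal_sq]
      _ ≤ a := hle
  refine ⟨w₁, ⟨hb₁, hpow, hgrad.trans ha.2⟩, fun w' hw' => ?_⟩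
  have t : Tendsto (fun n => J (z n)) atTop (𝓝 (J w₁)) := by
    refine tendsto_integral_of_dominated_convergence
      ((Metric.closedBall (0 : Plane) R).indicator fun _ => R ^ 2 * M)
      (fun n => ((continuous_norm.pow 2).mul (hzK n).1.continuous).aestronglyMeasurable) (hint _)
      (fun n => .of_forall fun x => ?_) (.of_forall fun x => (hz₁ x).const_mul _)
    rw [norm_mul, norm_pow, norm_norm, Real.norm_eq_abs]
    have hx' := hzh n x
    by_cases hx : x ∈ Metric.closedBall (0 : Plane) R
    · simp only [h, indicator_of_mem hx] at hx' ⊢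
      have hxR : ‖x‖ ≤ R := by simpa using hx
      gcongr
    · simp only [h, indicator_of_notMem hx] at hx' ⊢
      rw [le_antisymm hx' (abs_nonneg _), mul_zero]
  have t' : Tendsto (fun n => J (z n)) atTop (𝓝 (sInf (J '' K))) := by
    have := hj.comp (hφ.comp hψ).tendsto_atTop
    refine this.congr fun n => ?_
    simp only [Function.comp_apply, ← hwj, hz]
  rw [tendsto_nhds_unique t t']
  exact csInf_le hbdd ⟨w', hw', rfl⟩

end CubicQuintic

end

noncomputable section

namespace CubicQuintic

open Filter Topology Set
open scoped ENNReal NNReal RealInnerProductSpace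

/-! ### The quotient -/

theorem quotient_mono {α A B D E A' B' D' : ℝ} (hα : 0 < α) (hA : 0 ≤ A) (hB : 0 ≤ B) (hD : 0 ≤ D)
    (hE : 0 ≤ E) (hA' : A ≤ A') (hB' : B ≤ B') (hD' : D ≤ D') :
    quotient α A B D E ≤ quotient α A' B' D' E := by
  unfold quotient
  have h1 : 0 ≤ A' := hA.trans hA'
  have h2 : 0 ≤ B' := hB.trans hB'
  gcongr

theorem quotient_nonneg {α A B D E : ℝ} (hA : 0 ≤ A) (hB : 0 ≤ B) (hD : 0 ≤ D)
    (hE : 0 ≤ E) : 0 ≤ quotient α A B D E := by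
  unfold quotient
  positivity

theorem tendsto_quotient {α : ℝ} (hα : 0 < α) {a b d e : ℕ → ℝ} {A B D E : ℝ}
    (ha : Tendsto a atTop (𝓝 A)) (hb : Tendsto b atTop (𝓝 B)) (hd : Tendsto d atTop (𝓝 D))
    (he : Tendsto e atTop (𝓝 E)) (hE : E ≠ 0) :
    Tendsto (fun n => quotient α (a n) (b n) (d n) (e n)) atTop (𝓝 (quotient α A B D E)) := by
  unfold quotient
  refine (((ha.rpow_const (Or.inr ?_)).mul (hb.rpow_const (Or.inr ?_))).mul
    (hd.rpow_const (Or.inr ?_))).div he hE <;> positivity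

/-- With a = s² and b = l², these are the four integrals of s·u(l·). Invariance amounts to the two
exponent identities p + q + 3r = 2 and q + r = 1. -/
theorem quotient_scale {α A B D E a b : ℝ} (hα : 0 < α) (hA : 0 ≤ A) (hB : 0 ≤ B) (hD : 0 ≤ D)
    (ha : 0 < a) (hb : 0 < b) :
    quotient α (a * A) (a / b * B) (a ^ 3 / b * D) (a ^ 2 / b * E) = quotient α A B D E := by
  unfold quotient
  have h1 : (1 + α) ≠ 0 := by positivity
  set p := 1 / (1 + α) with hp
  set q := (2 + α) / (2 * (1 + α)) with hq
  set r := α / (2 * (1 + α)) with hr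
  have e1 : p + q + 3 * r = 2 := by
    rw [hp, hq, hr]
    field_simp
    ring
  have e2 : q + r = 1 := by
    rw [hq, hr]
    field_simp
    ring
  have key : a ^ p * (a / b) ^ q * (a ^ 3 / b) ^ r = a ^ 2 / b := by
    rw [Real.div_rpow ha.le hb.le, Real.div_rpow (by positivity) hb.le, ← Real.rpow_natCast a 3,
      ← Real.rpow_mul ha.le]
    push_cast
    have e3 : a ^ p * (a ^ q / b ^ q) * (a ^ (3 * r) / b ^ r)
        = (a ^ p * a ^ q * a ^ (3 * r)) / (b ^ q * b ^ r) := by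
      field_simp
    rw [e3, ← Real.rpow_add ha, ← Real.rpow_add ha, ← Real.rpow_add hb, e1, e2, Real.rpow_one,
      Real.rpow_two]
  rw [Real.mul_rpow ha.le hA, Real.mul_rpow (by positivity) hB, Real.mul_rpow (by positivity) hD]
  have e4 : a ^ p * A ^ p * ((a / b) ^ q * B ^ q) * ((a ^ 3 / b) ^ r * D ^ r)
      = (a ^ p * (a / b) ^ q * (a ^ 3 / b) ^ r) * (A ^ p * B ^ q * D ^ r) := by ring
  rw [e4, key, mul_div_mul_left _ _ (by positivity)]

theorem IsH1.F_eq {α : ℝ} {u : Plane → ℂ} {g : Plane → EuclideanSpace ℂ (Fin 2)} (h : IsH1 u g) :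
    F α u = quotient α (∫ x, ‖g x‖ ^ 2) (∫ x, ‖u x‖ ^ 2) (∫ x, ‖u x‖ ^ 6) (∫ x, ‖u x‖ ^ 4) :=
  F_eq_quotient h.1

theorem bddBelow_F_image (α : ℝ) : BddBelow (F α '' H1Nonzero) := by
  refine ⟨0, ?_⟩
  rintro _ ⟨u, hu, rfl⟩
  obtain ⟨g, hg⟩ := hu.1.exists_isH1
  rw [hg.F_eq]
  exact quotient_nonneg (integral_nonneg fun x => by positivity)
    (integral_nonneg fun x => by positivity) (integral_nonneg fun x => by positivity)
    (integral_nonneg fun x => by positivity)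

theorem integral_norm_pow_eq_zero_iff {G : Type*} [NormedAddCommGroup G] {f : Plane → G} {k : ℕ}
    (hk : k ≠ 0) (hf : Integrable fun x => ‖f x‖ ^ k) :
    ∫ x, ‖f x‖ ^ k = 0 ↔ f =ᵐ[volume] 0 := by
  rw [integral_eq_zero_iff_of_nonneg (fun x => by positivity) hf]
  constructor <;> intro h <;> filter_upwards [h] with x hx
  · simpa [hk] using hx
  · simp [hx, hk]

theorem IsH1.integrable_pow_two {u : Plane → ℂ} {g : Plane → EuclideanSpace ℂ (Fin 2)}
    (h : IsH1 u g) : Integrable fun x => ‖u x‖ ^ 2 :=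
  (memLp_iff_integrable_norm_pow h.2.1 (n := 2) (by norm_num)).1 h.2

theorem IsH1.integrable_pow_four {u : Plane → ℂ} {g : Plane → EuclideanSpace ℂ (Fin 2)}
    (h : IsH1 u g) : Integrable fun x => ‖u x‖ ^ 4 :=
  (memLp_iff_integrable_norm_pow h.2.1 (n := 4) (by norm_num)).1 h.memLp_four

theorem IsH1.integrable_pow_six {u : Plane → ℂ} {g : Plane → EuclideanSpace ℂ (Fin 2)}
    (h : IsH1 u g) : Integrable fun x => ‖u x‖ ^ 6 :=
  (memLp_iff_integrable_norm_pow h.2.1 (n := 6) (by norm_num)).1 h.memLp_six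

theorem IsH1.integral_pow_four_pos {u : Plane → ℂ} {g : Plane → EuclideanSpace ℂ (Fin 2)}
    (h : IsH1 u g) (hu : ¬ u =ᵐ[volume] 0) : 0 < ∫ x, ‖u x‖ ^ 4 := by
  refine lt_of_le_of_ne (integral_nonneg fun x => by positivity) fun h0 => hu ?_
  exact (integral_norm_pow_eq_zero_iff (by norm_num) h.integrable_pow_four).1 h0.symm

theorem IsH1.mem_H1Nonzero {u : Plane → ℂ} {g : Plane → EuclideanSpace ℂ (Fin 2)}
    (h : IsH1 u g) (hu : ∫ x, ‖u x‖ ^ 4 ≠ 0) : u ∈ H1Nonzero :=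
  ⟨h.memH1, fun h0 => hu ((integral_norm_pow_eq_zero_iff (by norm_num) h.integrable_pow_four).2 h0)⟩

theorem C_le {α : ℝ} {u : Plane → ℂ} (hu : u ∈ H1Nonzero) : C α ≤ F α u :=
  csInf_le (bddBelow_F_image α) ⟨u, hu, rfl⟩

/-! ### Radially decreasing competitors -/

/-- Nonnegative Lipschitz functions with compact support that decrease with the distance from the
origin. -/
structure IsRadialBump (w : Plane → ℝ) : Prop where
  isBump : ∃ L R, 0 ≤ R ∧ IsBump L R w
  antitone : ∀ x y, ‖x‖ < ‖y‖ → w y ≤ w x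

namespace IsRadialBump

variable {w : Plane → ℝ}

theorem continuous (h : IsRadialBump w) : Continuous w :=
  let ⟨_, _, _, hb⟩ := h.isBump
  hb.continuous

theorem nonneg (h : IsRadialBump w) (x : Plane) : 0 ≤ w x :=
  let ⟨_, _, _, hb⟩ := h.isBump
  hb.nonneg x

theorem isH1 (h : IsRadialBump w) : IsH1 (toComplex w) (gradReal w) :=
  let ⟨_, _, _, hb⟩ := h.isBump
  hb.isH1

theorem norm_toComplex_pow (h : IsRadialBump w) (x : Plane) (k : ℕ) :
    ‖toComplex w x‖ ^ k = w x ^ k := by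
  rw [toComplex, Complex.norm_real, Real.norm_of_nonneg (h.nonneg x)]

theorem F_eq (h : IsRadialBump w) (α : ℝ) : F α (toComplex w) =
    quotient α (∫ x, ‖fderiv ℝ w x‖ ^ 2) (∫ x, w x ^ 2) (∫ x, w x ^ 6) (∫ x, w x ^ 4) := by
  rw [h.isH1.F_eq]
  simp only [norm_gradReal_sq, h.norm_toComplex_pow]

/-- Continuity extends the comparison to points of equal norm, by approaching y from outside along
its ray; in particular w is radially symmetric. -/
theorem le_of_norm_le (h : IsRadialBump w) {x y : Plane} (hxy : ‖x‖ ≤ ‖y‖) : w y ≤ w x := by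
  rcases eq_or_ne y 0 with rfl | hy
  · have : x = 0 := by simpa using hxy
    rw [this]
  have t : Tendsto (fun n : ℕ => w ((1 + 1 / (n + 1 : ℝ)) • y)) atTop (𝓝 (w y)) := by
    have h1 := (tendsto_one_div_add_atTop_nhds_zero_nat (𝕜 := ℝ)).const_add 1
    have h2 := (h.continuous.tendsto _).comp (h1.smul_const y)
    simpa [Function.comp_def] using h2
  refine le_of_tendsto t (.of_forall fun n => h.antitone _ _ (hxy.trans_lt ?_))
  have hn : (0 : ℝ) < 1 / (n + 1 : ℝ) := by positivity
  rw [norm_smul, Real.norm_of_nonneg (by positivity)]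
  have := norm_pos_iff.2 hy
  nlinarith

theorem integral_scale_pow (w : Plane → ℝ) (s : ℝ) {l : ℝ} (hl : 0 < l) (k : ℕ) :
    ∫ x, (s * w (l • x)) ^ k = s ^ k / l ^ 2 * ∫ x, w x ^ k := by
  simp only [mul_pow]
  rw [integral_const_mul, integral_comp_smul_plane (fun x => w x ^ k) hl, smul_eq_mul]
  ring

theorem integral_norm_fderiv_scale (w : Plane → ℝ) (s : ℝ) {l : ℝ} (hl : 0 < l) :
    ∫ x, ‖fderiv ℝ (fun x => s * w (l • x)) x‖ ^ 2 = s ^ 2 * ∫ x, ‖fderiv ℝ w x‖ ^ 2 := by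
  have e : ∀ x, ‖fderiv ℝ (fun x => s * w (l • x)) x‖ ^ 2
      = (s * l) ^ 2 * ‖fderiv ℝ w (l • x)‖ ^ 2 := by
    intro x
    have h1 : fderiv ℝ (fun x => s * w (l • x)) x = s • fderiv ℝ (fun x => w (l • x)) x :=
      congrFun (fderiv_const_smul_field (𝕜 := ℝ) (f := fun x => w (l • x)) s) x
    rw [h1, fderiv_comp_smul, norm_smul, norm_smul, mul_pow, mul_pow, Real.norm_eq_abs,
      Real.norm_eq_abs, sq_abs, sq_abs]
    ring
  simp only [e]
  rw [integral_const_mul, integral_comp_smul_plane (fun x => ‖fderiv ℝ w x‖ ^ 2) hl, smul_eq_mul]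
  field_simp

theorem scale (h : IsRadialBump w) {s l : ℝ} (hs : 0 < s) (hl : 0 < l) :
    IsRadialBump fun x => s * w (l • x) := by
  obtain ⟨L, R, hR, hb⟩ := h.isBump
  refine ⟨⟨s.toNNReal * L * l.toNNReal, R / l, by positivity, fun x => ?_, ?_, fun x hx => ?_⟩,
    fun x y hxy => ?_⟩
  · exact mul_nonneg hs.le (h.nonneg _)
  · refine LipschitzWith.of_dist_le_mul fun x y => ?_
    have h1 := hb.lipschitz.dist_le_mul (l • x) (l • y)
    rw [dist_smul₀, Real.norm_of_nonneg hl.le] at h1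
    push_cast
    rw [Real.coe_toNNReal _ hs.le, Real.coe_toNNReal _ hl.le]
    have e : dist (s * w (l • x)) (s * w (l • y)) = s * dist (w (l • x)) (w (l • y)) := by
      rw [Real.dist_eq, Real.dist_eq, ← mul_sub, abs_mul, abs_of_pos hs]
    rw [e]
    calc _ ≤ s * (L * (l * dist x y)) := by gcongr
      _ = _ := by ring
  · rw [hb.eq_zero, mul_zero]
    rw [norm_smul, Real.norm_of_nonneg hl.le]
    rw [div_lt_iff₀ hl] at hx
    linarith
  · refine mul_le_mul_of_nonneg_left (h.antitone _ _ ?_) hs.le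
    rw [norm_smul, norm_smul]
    have : 0 < ‖l‖ := norm_pos_iff.2 hl.ne'
    gcongr

end IsRadialBump

/-- Difference quotients of |v| are dominated by those of v in each coordinate direction; this
removes the phase of a complex competitor. -/
theorem norm_fderiv_norm_le {v : Plane → ℂ} {x : Plane} (hv : DifferentiableAt ℝ v x)
    (hV : DifferentiableAt ℝ (fun y => ‖v y‖) x) :
    ‖fderiv ℝ (fun y => ‖v y‖) x‖ ^ 2 ≤ ‖grad v x‖ ^ 2 := by
  rw [← sum_sq_apply_single, norm_grad_sq]
  refine Finset.sum_le_sum fun i _ => ?_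
  rw [← sq_abs, ← Real.norm_eq_abs]
  gcongr
  set e : Plane := EuclideanSpace.single i (1 : ℝ)
  have h1 := (hV.hasFDerivAt.hasLineDerivAt e).tendsto_slope_zero
  have h2 := (hv.hasFDerivAt.hasLineDerivAt e).tendsto_slope_zero
  refine le_of_tendsto_of_tendsto h1.norm h2.norm (.of_forall fun t => ?_)
  change ‖t⁻¹ • (‖v (x + t • e)‖ - ‖v x‖)‖ ≤ ‖t⁻¹ • (v (x + t • e) - v x)‖
  rw [norm_smul, norm_smul]
  gcongr
  simpa using abs_norm_sub_norm_le (v (x + t • e)) (v x)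

theorem exists_isRadialBump {v : Plane → ℂ} (hv : ContDiff ℝ ∞ v)
    (hs : HasCompactSupport v) : ∃ w, IsRadialBump w ∧
    (∀ k : ℕ, k ≠ 0 → ∫ x, w x ^ k = ∫ x, ‖v x‖ ^ k) ∧
    ∫ x, ‖fderiv ℝ w x‖ ^ 2 ≤ ∫ x, ‖grad v x‖ ^ 2 := by
  obtain ⟨L, hL⟩ := hv.lipschitzWith_of_hasCompactSupport hs (by simp)
  obtain ⟨R, hR⟩ := hs.isCompact.isBounded.subset_closedBall (0 : Plane)
  have hb : IsBump L (max R 0) fun x => ‖v x‖ := by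
    refine ⟨fun x => norm_nonneg _, ?_, fun x hx => ?_⟩
    · exact LipschitzWith.of_dist_le_mul fun x y => by
        refine le_trans ?_ (hL.dist_le_mul x y)
        rw [Real.dist_eq, dist_eq_norm]
        exact abs_norm_sub_norm_le _ _
    · have : x ∉ tsupport v := fun h => by
        have := hR h
        rw [mem_closedBall_zero_iff] at this
        exact absurd (this.trans (le_max_left R 0)) (not_le.2 hx)
      rw [image_eq_zero_of_notMem_tsupport this, norm_zero]
  obtain ⟨w, hw, hwa, hwk, hwd⟩ := exists_symmetrization (le_max_right R 0) hb
  refine ⟨w, ⟨⟨L, max R 0, le_max_right _ _, hw⟩, hwa⟩, hwk, hwd.trans ?_⟩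
  refine integral_mono_ae hb.integrable_norm_fderiv_sq ?_ ?_
  · exact (memLp_iff_integrable_norm_pow (continuous_grad hv).aestronglyMeasurable
      two_ne_zero).1 (isH1_grad hv hs).3
  · filter_upwards [hb.lipschitz.ae_differentiableAt (μ := (volume : Measure Plane))] with x hx
    exact norm_fderiv_norm_le (hv.differentiable (by simp) x) hx

theorem exists_isRadialBump_quotient_lt {α : ℝ} (hα : 0 < α) {u : Plane → ℂ} (hu : u ∈ H1Nonzero)
    {c : ℝ} (hc : F α u < c) :
    ∃ w, IsRadialBump w ∧ 0 < ∫ x, w x ^ 4 ∧ F α (toComplex w) < c := by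
  obtain ⟨g, hg⟩ := hu.1.exists_isH1
  obtain ⟨v, hv, tA, tB, tD, tE⟩ := hg.exists_smooth_seq
  have hE := hg.integral_pow_four_pos hu.2
  have t := tendsto_quotient hα tA tB tD tE hE.ne'
  rw [← hg.F_eq] at t
  obtain ⟨n, h1, h2⟩ := ((t.eventually (gt_mem_nhds hc)).and
    (tE.eventually (lt_mem_nhds hE))).exists
  obtain ⟨w, hw, hwk, hwd⟩ := exists_isRadialBump (hv n).1 (hv n).2
  refine ⟨w, hw, ?_, ?_⟩
  · rw [hwk 4 (by norm_num)]
    exact h2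
  · rw [hw.F_eq, hwk 2 (by norm_num), hwk 4 (by norm_num), hwk 6 (by norm_num)]
    refine lt_of_le_of_lt (quotient_mono hα (integral_nonneg fun x => by positivity)
      (integral_nonneg fun x => by positivity) (integral_nonneg fun x => by positivity)
      (integral_nonneg fun x => by positivity) hwd le_rfl le_rfl) h1

theorem H1Nonzero_nonempty : H1Nonzero.Nonempty := by
  let χ : ContDiffBump (0 : Plane) := ⟨1, 2, by norm_num, by norm_num⟩
  have hc : Continuous fun x => (χ x : ℂ) := Complex.continuous_ofReal.comp χ.continuous
  have hs : ContDiff ℝ ∞ fun x => (χ x : ℂ) :=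
    Complex.ofRealCLM.contDiff.comp χ.contDiff
  refine ⟨fun x => (χ x : ℂ), (isH1_grad hs
    (χ.hasCompactSupport.comp_left Complex.ofReal_zero)).memH1, fun h => ?_⟩
  have h0 := (hc.ae_eq_iff_eq volume continuous_const (g := fun _ => (0 : ℂ))).1 h
  have h1 := congrFun h0 0
  have h2 : χ (0 : Plane) = 1 := χ.one_of_mem_closedBall (Metric.mem_closedBall_self (by norm_num [χ]))
  simp only [h2] at h1
  norm_num at h1

theorem exists_minimizing_seq {α : ℝ} (hα : 0 < α) : ∃ w : ℕ → Plane → ℝ,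
    (∀ n, IsRadialBump (w n)) ∧ (∀ n, ∫ x, w n x ^ 2 = 1) ∧ (∀ n, ∫ x, w n x ^ 4 = 1) ∧
    Tendsto (fun n => quotient α (∫ x, ‖fderiv ℝ (w n) x‖ ^ 2) 1 (∫ x, w n x ^ 6) 1) atTop
      (𝓝 (C α)) := by
  have key : ∀ n : ℕ, ∃ w, IsRadialBump w ∧ ∫ x, w x ^ 2 = 1 ∧ ∫ x, w x ^ 4 = 1 ∧
      C α ≤ quotient α (∫ x, ‖fderiv ℝ w x‖ ^ 2) 1 (∫ x, w x ^ 6) 1 ∧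
      quotient α (∫ x, ‖fderiv ℝ w x‖ ^ 2) 1 (∫ x, w x ^ 6) 1 ≤ C α + 1 / (n + 1 : ℝ) := by
    intro n
    have hn : C α < C α + 1 / (n + 1 : ℝ) := by
      have : (0 : ℝ) < 1 / (n + 1 : ℝ) := by positivity
      linarith
    obtain ⟨_, ⟨u, hu, rfl⟩, huc⟩ := exists_lt_of_csInf_lt (H1Nonzero_nonempty.image (F α)) hn
    obtain ⟨w, hw, hE, hF⟩ := exists_isRadialBump_quotient_lt hα hu huc
    have hE' : ∫ x, ‖toComplex w x‖ ^ 4 ≠ 0 := by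
      simp only [hw.norm_toComplex_pow]
      exact hE.ne'
    have hmem := hw.isH1.mem_H1Nonzero hE'
    have hB : 0 < ∫ x, w x ^ 2 := by
      refine lt_of_le_of_ne (integral_nonneg fun x => by positivity) fun h0 => hmem.2 ?_
      refine (integral_norm_pow_eq_zero_iff two_ne_zero hw.isH1.integrable_pow_two).1 ?_
      simp only [hw.norm_toComplex_pow]
      exact h0.symm
    have hC := C_le (α := α) hmem
    rw [hw.F_eq] at hF hC
    set A := ∫ x, ‖fderiv ℝ w x‖ ^ 2
    set B := ∫ x, w x ^ 2
    set D := ∫ x, w x ^ 6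
    set E := ∫ x, w x ^ 4
    -- The squares a = B/E and b = B²/E of the two scaling parameters solve (a/b)B = 1 and (a²/b)E =
    -- 1.
    have hs : 0 < √(B / E) := by positivity
    have hl : 0 < √(B ^ 2 / E) := by positivity
    have hs2 : √(B / E) ^ 2 = B / E := Real.sq_sqrt (by positivity)
    have hl2 : √(B ^ 2 / E) ^ 2 = B ^ 2 / E := Real.sq_sqrt (by positivity)
    set w' : Plane → ℝ := fun x => √(B / E) * w (√(B ^ 2 / E) • x)
    have hA' : ∫ x, ‖fderiv ℝ w' x‖ ^ 2 = B / E * A := by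
      rw [IsRadialBump.integral_norm_fderiv_scale _ _ hl, hs2]
    have hD' : ∫ x, w' x ^ 6 = (B / E) ^ 3 / (B ^ 2 / E) * D := by
      rw [IsRadialBump.integral_scale_pow _ _ hl, hl2, show 6 = 2 * 3 by rfl, pow_mul, hs2]
    have e1 : B / E / (B ^ 2 / E) * B = 1 := by field_simp
    have e2 : (B / E) ^ 2 / (B ^ 2 / E) * E = 1 := by field_simp
    have hq := quotient_scale (α := α) (A := A) (B := B) (D := D) (E := E) hα
      (integral_nonneg fun x => by positivity) hB.le (integral_nonneg fun x => by
        have := hw.nonneg x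
        positivity) (a := B / E) (b := B ^ 2 / E) (by positivity) (by positivity)
    rw [e1, e2] at hq
    refine ⟨w', hw.scale hs hl, ?_, ?_, ?_, ?_⟩
    · rw [IsRadialBump.integral_scale_pow _ _ hl, hl2, hs2, e1]
    · rw [IsRadialBump.integral_scale_pow _ _ hl, hl2, show 4 = 2 * 2 by rfl, pow_mul, hs2]
      exact e2
    · rw [hA', hD', hq]
      exact hC
    · rw [hA', hD', hq]
      exact hF.le
  choose w h1 h2 h3 h4 h5 using key
  refine ⟨w, h1, h2, h3, tendsto_of_tendsto_of_tendsto_of_le_of_le tendsto_const_nhds ?_ h4 h5⟩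
  have := (tendsto_one_div_add_atTop_nhds_zero_nat (𝕜 := ℝ)).const_add (C α)
  simpa using this

end CubicQuintic

end

noncomputable section

namespace CubicQuintic

open Filter Topology Set
open scoped ENNReal NNReal RealInnerProductSpace

/-! ### Radial integration in the variable `‖x‖ ^ 2` -/

theorem measurable_norm_sq : Measurable fun x : Plane => ‖x‖ ^ 2 := by fun_prop

/-- The annulus p < |x|² < q has area π(q − p). In the variable |x|² radial integration thus carries
no weight, which is why profiles are written as functions of the squared norm. -/
theorem map_norm_sq_volume : (volume : Measure Plane).map (fun x => ‖x‖ ^ 2) =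
    ENNReal.ofReal Real.pi • volume.restrict (Ioi (0 : ℝ)) := by
  symm
  have : IsLocallyFiniteMeasure (ENNReal.ofReal Real.pi • volume.restrict (Ioi (0 : ℝ))) :=
    inferInstanceAs (IsLocallyFiniteMeasure (Real.pi.toNNReal • volume.restrict (Ioi (0 : ℝ))))
  refine Real.measure_ext_Ioo_rat fun p q => ?_
  rw [Measure.map_apply measurable_norm_sq measurableSet_Ioo, Measure.smul_apply,
    Measure.restrict_apply measurableSet_Ioo, Ioo_inter_Ioi, Real.volume_Ioo, smul_eq_mul]
  rcases le_or_gt (q : ℝ) 0 with hq | hq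
  · have e : (fun x : Plane => ‖x‖ ^ 2) ⁻¹' Ioo (p : ℝ) q = ∅ := by
      ext x
      simp only [mem_preimage, mem_Ioo, mem_empty_iff_false, iff_false, not_and, not_lt]
      intro _
      exact hq.trans (by positivity)
    rw [e, measure_empty, ENNReal.ofReal_of_nonpos (p := q - _), mul_zero]
    have := le_max_right (p : ℝ) 0
    simp only [sub_nonpos]
    exact hq.trans this
  have hball : ∀ r : ℝ, 0 ≤ r → volume (Metric.ball (0 : Plane) (√r))
      = ENNReal.ofReal Real.pi * ENNReal.ofReal r := by
    intro r hr
    rw [EuclideanSpace.volume_ball_fin_two, ← ENNReal.ofReal_pow (Real.sqrt_nonneg r),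
      Real.sq_sqrt hr, mul_comm, ENNReal.ofReal]
  rcases lt_or_ge (p : ℝ) 0 with hp | hp
  · have e : (fun x : Plane => ‖x‖ ^ 2) ⁻¹' Ioo (p : ℝ) q = Metric.ball 0 (√q) := by
      ext x
      simp only [mem_preimage, mem_Ioo, Metric.mem_ball, dist_zero_right,
        Real.lt_sqrt (norm_nonneg x), and_iff_right_iff_imp]
      intro _
      exact hp.trans_le (by positivity)
    rw [e, hball _ hq.le, max_eq_right hp.le, sub_zero]
  rw [max_eq_left hp]
  rcases le_or_gt q p with hqp | hqp
  · rw [Ioo_eq_empty (by exact_mod_cast not_lt.2 hqp), preimage_empty, measure_empty,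
      ENNReal.ofReal_of_nonpos (p := (q : ℝ) - _), mul_zero]
    simpa using hqp
  have e : (fun x : Plane => ‖x‖ ^ 2) ⁻¹' Ioo (p : ℝ) q
      = Metric.ball 0 (√q) \ Metric.closedBall 0 (√p) := by
    ext x
    simp only [mem_preimage, mem_Ioo, Set.mem_sdiff, Metric.mem_ball, Metric.mem_closedBall,
      dist_zero_right, Real.lt_sqrt (norm_nonneg x), Real.le_sqrt (norm_nonneg x) hp, not_le]
    tauto
  have hpq : (p : ℝ) < q := by exact_mod_cast hqp
  rw [e, measure_sdiff (Metric.closedBall_subset_ball (Real.sqrt_lt_sqrt hp hpq))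
    Metric.isClosed_closedBall.measurableSet.nullMeasurableSet measure_closedBall_lt_top.ne,
    Measure.addHaar_closedBall_eq_addHaar_ball, hball _ hq.le, hball _ hp,
    ENNReal.ofReal_sub _ hp, ENNReal.mul_sub fun _ _ => ENNReal.ofReal_ne_top]

theorem integral_comp_norm_sq (f : ℝ → ℝ) (hf : AEStronglyMeasurable f (volume.restrict (Ioi 0))) :
    ∫ x : Plane, f (‖x‖ ^ 2) = Real.pi * ∫ s in Ioi 0, f s := by
  have h := integral_map measurable_norm_sq.aemeasurable (μ := (volume : Measure Plane)) (f := f)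
    (by rw [map_norm_sq_volume]; exact hf.smul_measure _)
  rw [← h, map_norm_sq_volume, integral_smul_measure, ENNReal.toReal_ofReal Real.pi_pos.le,
    smul_eq_mul]

theorem integrable_comp_norm_sq_iff {f : ℝ → ℝ} 
    (hf : AEStronglyMeasurable f (volume.restrict (Ioi 0))) :
    Integrable (fun x : Plane => f (‖x‖ ^ 2)) ↔ IntegrableOn f (Ioi 0) := by
  have h := integrable_map_measure (μ := (volume : Measure Plane)) (g := f)
    (by rw [map_norm_sq_volume]; exact hf.smul_measure _) measurable_norm_sq.aemeasurable
  rw [map_norm_sq_volume, integrable_smul_measure (by simp [Real.pi_pos]) (by simp)] at h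
  exact h.symm

theorem ae_norm_sq {p : ℝ → Prop} (h : ∀ᵐ s ∂volume.restrict (Ioi 0), p s) :
    ∀ᵐ x : Plane, p (‖x‖ ^ 2) := by
  refine ae_of_ae_map measurable_norm_sq.aemeasurable ?_
  rw [map_norm_sq_volume]
  exact Measure.ae_smul_measure h _

/-! ### Selection from monotone functions -/

/-- Helly's selection theorem. A diagonal subsequence converges at the rationals, g(y) is the
infimum of the limits at rationals below y, and at a continuity point of g monotonicity squeezes the
sequence between two rationals. -/
theorem exists_subseq_tendsto_of_antitone {f : ℕ → ℝ → ℝ} {M : ℝ → ℝ} (hf : ∀ n, Antitone (f n))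
    (hM : ∀ n y, |f n y| ≤ M y) : ∃ φ : ℕ → ℕ, StrictMono φ ∧ ∃ g : ℝ → ℝ, Antitone g ∧
      ∀ y, ContinuousAt g y → Tendsto (fun n => f (φ n) y) atTop (𝓝 (g y)) := by
  obtain ⟨φ, hφ, w, hw⟩ := exists_subseq_tendsto_of_countable (v := fun n (q : ℚ) => f n q)
    (M := fun q => M q) fun n q => hM n q
  have hlow : ∀ n y, -M y ≤ f n y := fun n y => (abs_le.1 (hM n y)).1
  have hS : ∀ y : ℝ, ((w) '' {q : ℚ | (q : ℝ) < y}).Nonempty := fun y =>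
    let ⟨q, hq⟩ := exists_rat_lt y
    ⟨w q, q, hq, rfl⟩
  have hB : ∀ y : ℝ, BddBelow (w '' {q : ℚ | (q : ℝ) < y}) := fun y => by
    refine ⟨-M y, ?_⟩
    rintro _ ⟨q, hq, rfl⟩
    exact ge_of_tendsto (hw q) (.of_forall fun n => (hlow _ y).trans (hf _ (le_of_lt hq)))
  set g : ℝ → ℝ := fun y => sInf (w '' {q : ℚ | (q : ℝ) < y})
  have hg : Antitone g := fun y z hyz =>
    csInf_le_csInf (hB z) (hS y) (image_mono fun q hq => lt_of_lt_of_le hq hyz)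
  refine ⟨φ, hφ, g, hg, fun y hy => ?_⟩
  rw [Metric.tendsto_atTop]
  intro ε hε
  obtain ⟨_, ⟨q, hq, rfl⟩, hq'⟩ := exists_lt_of_csInf_lt (hS y) (show g y < g y + ε / 2 by linarith)
  have hr : ∃ r : ℚ, y < r ∧ g y - ε / 2 < w r := by
    have h1 := (hy.eventually (lt_mem_nhds (show g y - ε / 2 < g y by linarith)))
    obtain ⟨δ, hδ, h2⟩ := Metric.eventually_nhds_iff.1 h1
    obtain ⟨r, hr1, hr2⟩ := exists_rat_btwn (show y < y + δ / 2 by linarith)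
    refine ⟨r, hr1, (h2 (y := y + δ / 2) ?_).trans_le (csInf_le (hB _) ⟨r, hr2, rfl⟩)⟩
    rw [Real.dist_eq, add_sub_cancel_left, abs_of_pos (by linarith)]
    linarith
  obtain ⟨r, hr, hr'⟩ := hr
  obtain ⟨N, hN⟩ := eventually_atTop.1 (((hw q).eventually (gt_mem_nhds hq')).and
    ((hw r).eventually (lt_mem_nhds hr')))
  refine ⟨N, fun n hn => ?_⟩
  obtain ⟨h1, h2⟩ := hN n hn
  have h3 := hf (φ n) (le_of_lt hq)
  have h4 := hf (φ n) hr.le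
  rw [Real.dist_eq, abs_lt]
  constructor <;> linarith

/-! ### Radially decreasing functions -/

theorem norm_smul_single (t : ℝ) : ‖t • (EuclideanSpace.single 0 (1 : ℝ) : Plane)‖ = |t| := by
  rw [norm_smul, PiLp.norm_single, norm_one, mul_one, Real.norm_eq_abs]

/-- On the disc of radius ‖x‖ the function is at least w x. This is the radial decay that replaces
compactness at infinity and at the origin. -/
theorem IsRadialBump.mul_pow_le {w : Plane → ℝ} (h : IsRadialBump w) {k : ℕ} (hk : k ≠ 0)
    (x : Plane) : Real.pi * ‖x‖ ^ 2 * w x ^ k ≤ ∫ y, w y ^ k := by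
  obtain ⟨L, R, hR, hb⟩ := h.isBump
  calc Real.pi * ‖x‖ ^ 2 * w x ^ k = ∫ y in Metric.ball (0 : Plane) ‖x‖, w x ^ k := by
        rw [setIntegral_const, Measure.real, EuclideanSpace.volume_ball_fin_two, smul_eq_mul]
        simp [mul_comm, ENNReal.toReal_ofReal Real.pi_pos.le]
    _ ≤ ∫ y in Metric.ball (0 : Plane) ‖x‖, w y ^ k := by
        refine setIntegral_mono_on (integrableOn_const measure_ball_lt_top.ne)
          (hb.integrable_pow hk).integrableOn measurableSet_ball fun y hy => ?_
        have := h.nonneg x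
        have := h.le_of_norm_le (mem_ball_zero_iff.1 hy).le
        gcongr
    _ ≤ ∫ y, w y ^ k := setIntegral_le_integral (hb.integrable_pow hk)
        (.of_forall fun y => pow_nonneg (h.nonneg y) k)

theorem IsRadialBump.exists_subseq {w : ℕ → Plane → ℝ} (h : ∀ n, IsRadialBump (w n))
    (hB : ∀ n, ∫ x, w n x ^ 2 = 1) : ∃ φ : ℕ → ℕ, StrictMono φ ∧ ∃ f : ℝ → ℝ,
      AntitoneOn f (Ioi 0) ∧ Measurable f ∧ (∀ s, 0 ≤ f s) ∧
      ∀ᵐ x : Plane, Tendsto (fun n => w (φ n) x) atTop (𝓝 (f (‖x‖ ^ 2))) := by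
  set e : Plane := EuclideanSpace.single 0 1
  have hle : ∀ n (y : ℝ), w n (√(Real.exp y) • e) ^ 2 ≤ 1 / Real.exp y := by
    intro n y
    have h1 := (h n).mul_pow_le two_ne_zero (√(Real.exp y) • e)
    rw [hB, norm_smul_single, sq_abs, Real.sq_sqrt (Real.exp_pos y).le] at h1
    rw [le_div_iff₀ (Real.exp_pos y)]
    have h2 := Real.pi_gt_three
    have h3 : 0 ≤ w n (√(Real.exp y) • e) ^ 2 * Real.exp y := by positivity
    nlinarith
  -- The substitution |x|² = exp y turns the half line into ℝ, where Helly selection applies, with a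
  -- bound depending on y that blows up towards the origin. The exceptional radii are countable,
  -- hence the exceptional points of the plane are null.
  obtain ⟨φ, hφ, g, hg, hgt⟩ := exists_subseq_tendsto_of_antitone
    (f := fun n y => w n (√(Real.exp y) • e)) (M := fun y => √(1 / Real.exp y))
    (fun n y z hyz => (h n).le_of_norm_le (by
      rw [norm_smul_single, norm_smul_single, abs_of_nonneg (Real.sqrt_nonneg _),
        abs_of_nonneg (Real.sqrt_nonneg _)]
      gcongr))
    (fun n y => Real.abs_le_sqrt (hle n y))
  refine ⟨φ, hφ, fun s => max (g (Real.log s)) 0,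
    fun s hs t ht hst => max_le_max_right 0 (hg (Real.log_le_log hs hst)),
    (hg.measurable.comp Real.measurable_log).max measurable_const, fun s => le_max_right _ _, ?_⟩
  have hN : (Real.exp '' {y | ¬ ContinuousAt g y}).Countable := hg.countable_not_continuousAt.image _
  have h0 : ∀ᵐ s : ℝ ∂volume.restrict (Ioi 0), 0 < s ∧ ContinuousAt g (Real.log s) := by
    have h1 : ∀ᵐ s : ℝ ∂volume.restrict (Ioi 0), s ∉ Real.exp '' {y | ¬ ContinuousAt g y} :=
      ae_restrict_of_ae (measure_eq_zero_iff_ae_notMem.1 (hN.measure_zero volume))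
    filter_upwards [h1, ae_restrict_mem measurableSet_Ioi] with s hs hs0
    refine ⟨hs0, ?_⟩
    by_contra hc
    exact hs ⟨Real.log s, hc, Real.exp_log hs0⟩
  filter_upwards [ae_norm_sq h0] with x hx
  have h2 := (hgt _ hx.2).max (tendsto_const_nhds (x := (0 : ℝ)))
  simp only [max_eq_left ((h _).nonneg _)] at h2
  rw [Real.exp_log hx.1, Real.sqrt_sq (norm_nonneg x)] at h2
  refine h2.congr fun n => ?_
  refine le_antisymm ((h _).le_of_norm_le ?_) ((h _).le_of_norm_le ?_) <;>
    rw [norm_smul_single, abs_norm]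

end CubicQuintic

end

noncomputable section

namespace CubicQuintic

open Filter Topology Set
open scoped ENNReal NNReal RealInnerProductSpace

/-! ### Existence of a radially decreasing minimizer -/

theorem integrable_and_integral_le_of_tendsto {X : Type*} [MeasurableSpace X] {μ : Measure X}
    {f : ℕ → X → ℝ} {F : X → ℝ} {b : ℝ} (hf : ∀ n, Integrable (f n) μ) (h0 : ∀ n x, 0 ≤ f n x)
    (hb : Tendsto (fun n => ∫ x, f n x ∂μ) atTop (𝓝 b))
    (hF : ∀ᵐ x ∂μ, Tendsto (fun n => f n x) atTop (𝓝 (F x))) :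
    Integrable F μ ∧ ∫ x, F x ∂μ ≤ b := by
  have hm : AEStronglyMeasurable F μ :=
    aestronglyMeasurable_of_tendsto_ae atTop (fun n => (hf n).1) hF
  have hF0 : 0 ≤ᵐ[μ] F := by
    filter_upwards [hF] with x hx using ge_of_tendsto' hx fun n => h0 n x
  have hb0 : 0 ≤ b := ge_of_tendsto' hb fun n => integral_nonneg (h0 n)
  have key : ∫⁻ x, ENNReal.ofReal (F x) ∂μ ≤ ENNReal.ofReal b := by
    calc ∫⁻ x, ENNReal.ofReal (F x) ∂μ
        = ∫⁻ x, liminf (fun n => ENNReal.ofReal (f n x)) atTop ∂μ := by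
          refine lintegral_congr_ae ?_
          filter_upwards [hF] with x hx
          exact ((ENNReal.continuous_ofReal.tendsto _).comp hx).liminf_eq.symm
      _ ≤ liminf (fun n => ∫⁻ x, ENNReal.ofReal (f n x) ∂μ) atTop :=
          lintegral_liminf_le' fun n => (hf n).1.aemeasurable.ennreal_ofReal
      _ = ENNReal.ofReal b := by
          refine Tendsto.liminf_eq (((ENNReal.continuous_ofReal.tendsto _).comp hb).congr fun n => ?_)
          exact ofReal_integral_eq_lintegral_ofReal (hf n) (.of_forall (h0 n))
  have hi : Integrable F μ :=
    ⟨hm, (hasFiniteIntegral_iff_ofReal hF0).2 (key.trans_lt ENNReal.ofReal_lt_top)⟩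
  refine ⟨hi, ?_⟩
  rw [← ofReal_integral_eq_lintegral_ofReal hi hF0] at key
  exact (ENNReal.ofReal_le_ofReal_iff hb0).1 key

/-- A product of positive powers of A and D is bounded, and each factor is bounded below, so each is
bounded above. The lower bounds come from Gagliardo–Nirenberg for A and from B = E = 1 for D. -/
theorem exists_bound_of_quotient_le {α : ℝ} (hα : 0 < α) {c : ℝ} (hc : 0 < c) (K : ℝ) :
    ∃ M, ∀ A D, 1 ≤ c * A → 1 ≤ D → quotient α A 1 D 1 ≤ K → A ≤ M ∧ D ≤ M := by
  have hp : 0 < 1 / (1 + α) := by positivity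
  have hr : 0 < α / (2 * (1 + α)) := by positivity
  refine ⟨max (K ^ (1 / (1 + α))⁻¹) ((K * c ^ (1 / (1 + α))) ^ (α / (2 * (1 + α)))⁻¹),
    fun A D hA hD hq => ?_⟩
  have hA0 : 0 < A := pos_of_mul_pos_right (zero_lt_one.trans_le hA) hc.le
  have hD0 : 0 < D := zero_lt_one.trans_le hD
  unfold quotient at hq
  rw [Real.one_rpow, mul_one, div_one] at hq
  set p := 1 / (1 + α)
  set r := α / (2 * (1 + α))
  have hAp : 0 < A ^ p := Real.rpow_pos_of_pos hA0 p
  have hDr : 0 < D ^ r := Real.rpow_pos_of_pos hD0 r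
  have h1 : A ^ p ≤ K := by
    have := Real.one_le_rpow hD hr.le
    nlinarith
  have h2 : D ^ r ≤ K * c ^ p := by
    have h3 := Real.one_le_rpow hA hp.le
    rw [Real.mul_rpow hc.le hA0.le] at h3
    have h4 : 0 < c ^ p := Real.rpow_pos_of_pos hc p
    calc D ^ r ≤ D ^ r * (c ^ p * A ^ p) := le_mul_of_one_le_right hDr.le h3
      _ = A ^ p * D ^ r * c ^ p := by ring
      _ ≤ K * c ^ p := by gcongr
  refine ⟨le_max_of_le_left ?_, le_max_of_le_right ?_⟩
  · rw [← Real.rpow_rpow_inv hA0.le hp.ne']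
    exact Real.rpow_le_rpow hAp.le h1 (by positivity)
  · rw [← Real.rpow_rpow_inv hD0.le hr.ne']
    exact Real.rpow_le_rpow hDr.le h2 (by positivity)

namespace IsRadialBump

variable {w : Plane → ℝ}

theorem integrable_pow (h : IsRadialBump w) {k : ℕ} (hk : k ≠ 0) : Integrable fun x => w x ^ k :=
  let ⟨_, _, _, hb⟩ := h.isBump
  hb.integrable_pow hk

theorem one_le_integral_pow_six (h : IsRadialBump w) (hB : ∫ x, w x ^ 2 = 1)
    (hE : ∫ x, w x ^ 4 = 1) : 1 ≤ ∫ x, w x ^ 6 := by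
  -- Expanding the square gives D − 2E + B ≥ 0, that is D ≥ 1.
  have h1 : 0 ≤ ∫ x, (w x ^ 3 - w x) ^ 2 := integral_nonneg fun x => by positivity
  have e : ∀ x, (w x ^ 3 - w x) ^ 2 = w x ^ 6 - (2 * w x ^ 4 - w x ^ 2) := fun x => by ring
  have i2 := h.integrable_pow (k := 2) (by norm_num)
  have i4 := (h.integrable_pow (k := 4) (by norm_num)).const_mul 2
  have i42 : Integrable fun x => 2 * w x ^ 4 - w x ^ 2 := i4.sub i2
  simp only [e] at h1
  rw [integral_sub (h.integrable_pow (by norm_num)) i42, integral_sub i4 i2,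
    integral_const_mul, hB, hE] at h1
  linarith

end IsRadialBump

/-- An integrable majorant for the fourth powers of normalized radially decreasing functions. -/
def radialMajorant (M s : ℝ) : ℝ := if s ≤ 1 then (M * s⁻¹) ^ (2 / 3 : ℝ) else s ^ (-2 : ℝ)

theorem measurable_radialMajorant (M : ℝ) : Measurable (radialMajorant M) :=
  Measurable.ite measurableSet_Iic (by fun_prop) (by fun_prop)

theorem integrableOn_radialMajorant {M : ℝ} (hM : 0 ≤ M) :
    IntegrableOn (radialMajorant M) (Ioi 0) := by
  rw [← Ioc_union_Ioi_eq_Ioi zero_le_one]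
  refine IntegrableOn.union ?_ ?_
  · have h1 : IntegrableOn (fun s : ℝ => M ^ (2 / 3 : ℝ) * s ^ (-(2 / 3) : ℝ)) (Ioc 0 1) :=
      ((intervalIntegral.intervalIntegrable_rpow' (a := 0) (b := 1) (r := -(2 / 3))
        (by norm_num)).1).const_mul _
    refine h1.congr_fun (fun s hs => ?_) measurableSet_Ioc
    simp only [radialMajorant, if_pos hs.2]
    rw [Real.mul_rpow hM (inv_nonneg.2 hs.1.le), Real.inv_rpow hs.1.le, Real.rpow_neg hs.1.le]
  · refine (integrableOn_Ioi_rpow_of_lt (show (-2 : ℝ) < -1 by norm_num) zero_lt_one).congr_fun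
      (fun s hs => ?_) measurableSet_Ioi
    simp only [radialMajorant, if_neg (not_le.2 (mem_Ioi.1 hs))]

/-- The exponent 4 lies strictly between 2 and 6: in s = |x|², the L⁶ decay bounds w⁴ by a multiple
of s^(−2/3), integrable at 0, and the L² decay bounds it by s^(−2), integrable at infinity. -/
theorem IsRadialBump.pow_four_le {w : Plane → ℝ} (h : IsRadialBump w) {M : ℝ}
    (hB : ∫ x, w x ^ 2 = 1) (hD : ∫ x, w x ^ 6 ≤ M) {x : Plane} (hx : x ≠ 0) :
    w x ^ 4 ≤ radialMajorant M (‖x‖ ^ 2) := by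
  have hx0 : 0 < ‖x‖ ^ 2 := by positivity
  have hw := h.nonneg x
  have hpi := Real.pi_gt_three
  unfold radialMajorant
  split_ifs with h1
  · have h2 := (h.mul_pow_le (k := 6) (by norm_num) x).trans hD
    have h3 : w x ^ 6 ≤ M * (‖x‖ ^ 2)⁻¹ := by
      rw [← div_eq_mul_inv, le_div_iff₀ hx0]
      have : 0 ≤ w x ^ 6 * ‖x‖ ^ 2 := by positivity
      nlinarith
    calc w x ^ 4 = (w x ^ 6) ^ (2 / 3 : ℝ) := by
          rw [← Real.rpow_natCast (w x) 6, ← Real.rpow_mul hw, ← Real.rpow_natCast]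
          norm_num
      _ ≤ _ := Real.rpow_le_rpow (by positivity) h3 (by norm_num)
  · have h2 := h.mul_pow_le (k := 2) (by norm_num) x
    rw [hB] at h2
    have h3 : w x ^ 2 ≤ (‖x‖ ^ 2)⁻¹ := by
      rw [← one_div, le_div_iff₀ hx0]
      have : 0 ≤ w x ^ 2 * ‖x‖ ^ 2 := by positivity
      nlinarith
    calc w x ^ 4 = (w x ^ 2) ^ 2 := by ring
      _ ≤ (‖x‖ ^ 2)⁻¹ ^ 2 := by gcongr
      _ = _ := by
        rw [Real.rpow_neg hx0.le, inv_pow]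
        norm_num

theorem exists_radial_minimizer {α : ℝ} (hα : 0 < α) : ∃ f : ℝ → ℝ, AntitoneOn f (Ioi 0) ∧
    Measurable f ∧ (∀ s, 0 ≤ f s) ∧ ∃ g, IsH1 (toComplex fun x => f (‖x‖ ^ 2)) g ∧
      0 < ∫ x : Plane, f (‖x‖ ^ 2) ^ 4 ∧ F α (toComplex fun x => f (‖x‖ ^ 2)) = C α := by
  obtain ⟨w, hw, hB, hE, hq⟩ := exists_minimizing_seq hα
  obtain ⟨c, hc, hgn⟩ := exists_gagliardo_nirenberg
  have hA1 : ∀ n, 1 ≤ c * ∫ x, ‖fderiv ℝ (w n) x‖ ^ 2 := by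
    intro n
    have := hgn _ _ (hw n).isH1
    simp only [(hw n).norm_toComplex_pow, norm_gradReal_sq, hB, hE, mul_one] at this
    exact this
  have hD1 : ∀ n, 1 ≤ ∫ x, w n x ^ 6 := fun n => (hw n).one_le_integral_pow_six (hB n) (hE n)
  obtain ⟨K, hK⟩ := hq.bddAbove_range
  obtain ⟨M, hM⟩ := exists_bound_of_quotient_le hα hc K
  have hM' := fun n => hM _ _ (hA1 n) (hD1 n) (hK ⟨n, rfl⟩)
  -- Indexing by `Bool` extracts one subsequence for the Dirichlet and the sixth-power integrals
  -- together.
  obtain ⟨φ, hφ, l, hl⟩ := exists_subseq_tendsto_of_countable (ι := Bool) (M := fun _ => M)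
    (v := fun n b => if b then ∫ x, ‖fderiv ℝ (w n) x‖ ^ 2 else ∫ x, w n x ^ 6) (by
      rintro n (_ | _)
      · simpa [abs_of_nonneg (zero_le_one.trans (hD1 n))] using (hM' n).2
      · have : 0 ≤ ∫ x, ‖fderiv ℝ (w n) x‖ ^ 2 := integral_nonneg fun x => by positivity
        simpa [abs_of_nonneg this] using (hM' n).1)
  obtain ⟨ψ, hψ, f, hfa, hfm, hf0, hft⟩ :=
    IsRadialBump.exists_subseq (fun n => hw (φ n)) fun n => hB (φ n)
  set v : ℕ → Plane → ℝ := fun n => w (φ (ψ n))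
  have hv : ∀ n, IsRadialBump (v n) := fun n => hw _
  have tA : Tendsto (fun n => ∫ x, ‖fderiv ℝ (v n) x‖ ^ 2) atTop (𝓝 (l true)) := by
    simpa [Function.comp_def] using (hl true).comp hψ.tendsto_atTop
  have tD : Tendsto (fun n => ∫ x, v n x ^ 6) atTop (𝓝 (l false)) := by
    simpa [Function.comp_def] using (hl false).comp hψ.tendsto_atTop
  have hqC : quotient α (l true) 1 (l false) 1 = C α :=
    tendsto_nhds_unique (tendsto_quotient hα tA tendsto_const_nhds tD tendsto_const_nhds
      one_ne_zero) (hq.comp (hφ.comp hψ).tendsto_atTop)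
  set Q : Plane → ℝ := fun x => f (‖x‖ ^ 2)
  have hQn : ∀ x (k : ℕ), ‖toComplex Q x‖ ^ k = Q x ^ k := fun x k => by
    rw [toComplex, Complex.norm_real, Real.norm_of_nonneg (hf0 _)]
  obtain ⟨iB, hB'⟩ := integrable_and_integral_le_of_tendsto (F := fun x => Q x ^ 2) (b := 1)
    (fun n => (hv n).integrable_pow two_ne_zero) (fun n x => sq_nonneg _)
    (by simp only [v, hB, tendsto_const_nhds]) (hft.mono fun x hx => hx.pow 2)
  obtain ⟨iD, hD'⟩ := integrable_and_integral_le_of_tendsto (F := fun x => Q x ^ 6)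
    (fun n => (hv n).integrable_pow (by norm_num)) (fun n x => pow_nonneg ((hv n).nonneg x) 6)
    tD (hft.mono fun x hx => hx.pow 6)
  have hM0 : 0 ≤ M := zero_le_one.trans ((hD1 0).trans (hM' 0).2)
  have hx0 : ∀ᵐ x : Plane, x ≠ 0 := measure_eq_zero_iff_ae_notMem.1 (measure_singleton 0)
  -- The decisive step: the denominator must not drop, which dominated convergence ensures. The
  -- numerator only needs semicontinuity.
  have hE' : ∫ x, Q x ^ 4 = 1 := by
    refine tendsto_nhds_unique (tendsto_integral_of_dominated_convergence
      (F := fun n x => v n x ^ 4) (fun x => radialMajorant M (‖x‖ ^ 2))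
      (fun n => ((hv n).continuous.pow 4).aestronglyMeasurable) ?_ (fun n => ?_)
      (hft.mono fun x hx => hx.pow 4)) (by simp only [v, hE, tendsto_const_nhds])
    · exact (integrable_comp_norm_sq_iff
        (measurable_radialMajorant M).aestronglyMeasurable).2 (integrableOn_radialMajorant hM0)
    · filter_upwards [hx0] with x hx
      rw [Real.norm_of_nonneg (pow_nonneg ((hv n).nonneg x) 4)]
      exact (hv n).pow_four_le (hB _) (hM' _).2 hx
  -- By the L² decay all the functions lie below 1/|x|, which is locally integrable in the plane and
  -- so serves as majorant for the limit of the gradients.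
  have hloc : LocallyIntegrable fun x : Plane => ‖x‖⁻¹ := by
    refine locallyIntegrable_of_norm_le_rpow (C := 1) (α := 1) (by simp) (by simp) ?_
      (by fun_prop : Measurable fun x : Plane => ‖x‖⁻¹).aestronglyMeasurable
    exact .of_forall fun x => by simp [Real.rpow_neg_one]
  obtain ⟨g, hg, hg2, hgA⟩ := exists_isWeakGradient_of_tendsto (w := toComplex Q)
    (fun n => (hv n).isH1.1) (fun n => (hv n).isH1.3) (by simpa only [norm_gradReal_sq] using tA)
    hloc (fun n => by
      filter_upwards [hx0] with x hx
      have h1 := (hv n).mul_pow_le two_ne_zero x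
      rw [hB] at h1
      rw [toComplex, Complex.norm_real, Real.norm_of_nonneg ((hv n).nonneg x), ← one_div,
        le_div_iff₀ (norm_pos_iff.2 hx)]
      have := Real.pi_gt_three
      have : 0 ≤ (v n x * ‖x‖) ^ 2 := by positivity
      refine abs_le_one_iff_mul_self_le_one.2 ?_ |> (abs_le.1 · |>.2)
      nlinarith)
    (hft.mono fun x hx => (Complex.continuous_ofReal.tendsto _).comp hx)
  have hQm : AEStronglyMeasurable (toComplex Q) volume := hg.1.aestronglyMeasurable
  have hH : IsH1 (toComplex Q) g := by
    refine ⟨hg, ?_, hg2⟩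
    have := memLp_iff_integrable_norm_pow hQm (n := 2) two_ne_zero
    simp only [hQn] at this
    exact_mod_cast this.2 iB
  refine ⟨f, hfa, hfm, hf0, g, hH, by rw [hE']; exact one_pos, le_antisymm ?_ ?_⟩
  · rw [hH.F_eq, ← hqC]
    simp only [hQn, hE']
    exact quotient_mono hα (integral_nonneg fun x => by positivity)
      (integral_nonneg fun x => by positivity)
      (integral_nonneg fun x => pow_nonneg (hf0 _) _) zero_le_one hgA hB' hD'
  · refine C_le (hH.mem_H1Nonzero ?_)
    simp only [hQn, hE']
    exact one_ne_zero

end CubicQuintic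

end

noncomputable section

namespace CubicQuintic

open Filter Topology Set
open scoped ENNReal NNReal RealInnerProductSpace

/-! ### Normalization of the minimizer -/

theorem IsH1.energies_pos {u : Plane → ℂ} {g : Plane → EuclideanSpace ℂ (Fin 2)} (h : IsH1 u g)
    (hE : 0 < ∫ x, ‖u x‖ ^ 4) :
    0 < ∫ x, ‖g x‖ ^ 2 ∧ 0 < ∫ x, ‖u x‖ ^ 2 ∧ 0 < ∫ x, ‖u x‖ ^ 6 := by
  obtain ⟨c, hc, hgn⟩ := exists_gagliardo_nirenberg
  have h1 := pos_of_mul_pos_right (hE.trans_le (hgn u g h)) hc.le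
  have hA : 0 ≤ ∫ x, ‖g x‖ ^ 2 := integral_nonneg fun x => by positivity
  have hB : 0 ≤ ∫ x, ‖u x‖ ^ 2 := integral_nonneg fun x => by positivity
  refine ⟨pos_of_mul_pos_left h1 hB, pos_of_mul_pos_right h1 hA,
    lt_of_le_of_ne (integral_nonneg fun x => by positivity) fun h0 => hE.ne' ?_⟩
  have := (integral_norm_pow_eq_zero_iff (by norm_num) h.integrable_pow_six).1 h0.symm
  exact (integral_norm_pow_eq_zero_iff (by norm_num) h.integrable_pow_four).2 this

theorem exists_normalized_minimizer {α : ℝ} (hα : 0 < α) : ∃ f : ℝ → ℝ, AntitoneOn f (Ioi 0) ∧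
    Measurable f ∧ (∀ s, 0 ≤ f s) ∧ ∃ g, IsH1 (toComplex fun x => f (‖x‖ ^ 2)) g ∧
      F α (toComplex fun x => f (‖x‖ ^ 2)) = C α ∧ 0 < ∫ x, ‖g x‖ ^ 2 ∧
      ∫ x, ‖toComplex (fun x => f (‖x‖ ^ 2)) x‖ ^ 6 = 3 / 2 * α * ∫ x, ‖g x‖ ^ 2 ∧
      ∫ x, ‖toComplex (fun x => f (‖x‖ ^ 2)) x‖ ^ 4 = 2 * (1 + α) * ∫ x, ‖g x‖ ^ 2 := by
  obtain ⟨f, hfa, hfm, hf0, g, hg, hE, hF⟩ := exists_radial_minimizer hα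
  have hE : 0 < ∫ x, ‖toComplex (fun x => f (‖x‖ ^ 2)) x‖ ^ 4 := by
    simpa only [toComplex, Complex.norm_real, Real.norm_of_nonneg (hf0 _)] using hE
  obtain ⟨hA, hB, hD⟩ := hg.energies_pos hE
  set u := toComplex fun x => f (‖x‖ ^ 2)
  set A := ∫ x, ‖g x‖ ^ 2
  set B := ∫ x, ‖u x‖ ^ 2
  set D := ∫ x, ‖u x‖ ^ 6
  set E := ∫ x, ‖u x‖ ^ 4
  -- Scaling multiplies D/A by a²/b and E/A by a/b. Prescribing the values (3/2)α and 2(1+α)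
  -- determines a from the quotient of the two conditions and then b from the second.
  set a := (3 / 2 * α * A / D) / (2 * (1 + α) * A / E) with ha
  set b := a * E / (2 * (1 + α) * A) with hb
  have ha0 : 0 < a := by positivity
  have hb0 : 0 < b := by positivity
  have hs : 0 < √a := Real.sqrt_pos.2 ha0
  have hl : 0 < √b := Real.sqrt_pos.2 hb0
  have hs2 : √a ^ 2 = a := Real.sq_sqrt ha0.le
  have hl2 : √b ^ 2 = b := Real.sq_sqrt hb0.le
  have hu : (toComplex fun x => √a * f (b * ‖x‖ ^ 2)) = fun x => √a • u (√b • x) := by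
    funext x
    simp only [toComplex, u]
    rw [norm_smul, mul_pow, Real.norm_of_nonneg hl.le, hl2]
    simp
  have hg' := hg.scale √a hl
  rw [← hu] at hg'
  have eA : ∫ x, ‖(√a * √b) • g (√b • x)‖ ^ 2 = a * A := by
    rw [integral_norm_pow_scale _ _ hl, abs_of_pos (by positivity), mul_pow, hs2, hl2,
      mul_div_cancel_right₀ _ hb0.ne']
  have eB : ∫ x, ‖toComplex (fun x => √a * f (b * ‖x‖ ^ 2)) x‖ ^ 2 = a / b * B := by
    rw [hu, integral_norm_pow_scale _ _ hl, abs_of_pos hs, hs2, hl2]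
  have eD : ∫ x, ‖toComplex (fun x => √a * f (b * ‖x‖ ^ 2)) x‖ ^ 6 = a ^ 3 / b * D := by
    rw [hu, integral_norm_pow_scale _ _ hl, abs_of_pos hs, show 6 = 2 * 3 by rfl, pow_mul, hs2, hl2]
  have eE : ∫ x, ‖toComplex (fun x => √a * f (b * ‖x‖ ^ 2)) x‖ ^ 4 = a ^ 2 / b * E := by
    rw [hu, integral_norm_pow_scale _ _ hl, abs_of_pos hs, show 4 = 2 * 2 by rfl, pow_mul, hs2, hl2]
  refine ⟨fun s => √a * f (b * s), fun s hs' t ht hst => ?_, by fun_prop,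
    fun s => mul_nonneg hs.le (hf0 _), _, hg', ?_, ?_, ?_, ?_⟩
  · refine mul_le_mul_of_nonneg_left (hfa (mul_pos hb0 hs') (mul_pos hb0 ht) ?_) hs.le
    gcongr
  · rw [hg'.F_eq, eA, eB, eD, eE, quotient_scale hα hA.le hB.le hD.le ha0 hb0, ← hF, hg.F_eq]
  · rw [eA]
    positivity
  · rw [eA, eD, hb, ha]
    field_simp
  · rw [eA, eE, hb]
    field_simp

/-! ### The Euler–Lagrange equation -/

theorem integrable_pow_mul {Q : Plane → ℝ} (hm : AEStronglyMeasurable Q volume)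
    (h6 : Integrable fun x => ‖Q x‖ ^ 6) {φ : Plane → ℝ} (hφ : Continuous φ)
    (hc : HasCompactSupport φ) {k : ℕ} (hk : k ≤ 6) : Integrable fun x => φ x * Q x ^ k := by
  obtain ⟨b, hb⟩ := hc.exists_bound_of_continuous hφ
  have h1 : Integrable fun x => ‖φ x‖ + b * ‖Q x‖ ^ 6 :=
    (hφ.integrable_of_hasCompactSupport hc).norm.add (h6.const_mul b)
  refine h1.mono' (hφ.aestronglyMeasurable.mul (hm.pow k)) (.of_forall fun x => ?_)
  rw [norm_mul, norm_pow]
  have h2 : ‖Q x‖ ^ k ≤ 1 + ‖Q x‖ ^ 6 := by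
    rcases le_total ‖Q x‖ 1 with h | h
    · exact (pow_le_one₀ (norm_nonneg _) h).trans (le_add_of_nonneg_right (by positivity))
    · exact (pow_le_pow_right₀ h hk).trans (le_add_of_nonneg_left zero_le_one)
  calc ‖φ x‖ * ‖Q x‖ ^ k ≤ ‖φ x‖ * (1 + ‖Q x‖ ^ 6) := by gcongr
    _ = ‖φ x‖ + ‖φ x‖ * ‖Q x‖ ^ 6 := by ring
    _ ≤ _ := by
      gcongr
      exact hb x

theorem locallyIntegrable_pow {Q : Plane → ℝ} (hm : AEStronglyMeasurable Q volume)
    (h6 : Integrable fun x => ‖Q x‖ ^ 6) {k : ℕ} (hk : k ≤ 6) :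
    LocallyIntegrable fun x => Q x ^ k := by
  refine ((locallyIntegrable_const (1 : ℝ)).add h6.locallyIntegrable).mono (hm.pow k)
    (.of_forall fun x => ?_)
  simp only [Pi.add_apply]
  rw [norm_pow, Real.norm_of_nonneg (by positivity : 0 ≤ 1 + ‖Q x‖ ^ 6)]
  rcases le_total ‖Q x‖ 1 with h | h
  · exact (pow_le_one₀ (norm_nonneg _) h).trans (le_add_of_nonneg_right (by positivity))
  · exact (pow_le_pow_right₀ h hk).trans (le_add_of_nonneg_left zero_le_one)

/-- By the binomial theorem the integral is a polynomial in t, so no differentiation under the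
integral sign is needed; at t = 0 only the linear term survives. -/
theorem hasDerivAt_integral_pow {Q : Plane → ℝ} (hm : AEStronglyMeasurable Q volume)
    (h6 : Integrable fun x => ‖Q x‖ ^ 6) {φ : Plane → ℝ} (hφ : Continuous φ)
    (hc : HasCompactSupport φ) {n : ℕ} (hn : n ≤ 6) (hn0 : n ≠ 0) (hQ : Integrable fun x => Q x ^ n) :
    HasDerivAt (fun t : ℝ => ∫ x, (t * φ x + Q x) ^ n) (n * ∫ x, φ x * Q x ^ (n - 1)) 0 := by
  have hi : ∀ m ∈ Finset.range (n + 1), Integrable fun x => φ x ^ m * Q x ^ (n - m) := by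
    intro m _
    rcases eq_or_ne m 0 with rfl | hm0
    · simpa using hQ
    · exact integrable_pow_mul hm h6 (hφ.pow m) (hc.comp_left (g := fun y : ℝ => y ^ m)
        (zero_pow hm0)) ((Nat.sub_le n m).trans hn)
  have e : (fun t : ℝ => ∫ x, (t * φ x + Q x) ^ n) = fun t => ∑ m ∈ Finset.range (n + 1),
      t ^ m * ((n.choose m) * ∫ x, φ x ^ m * Q x ^ (n - m)) := by
    funext t
    have e1 : ∀ x, (t * φ x + Q x) ^ n = ∑ m ∈ Finset.range (n + 1),
        (t ^ m * n.choose m) * (φ x ^ m * Q x ^ (n - m)) := fun x => by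
      rw [add_pow]
      refine Finset.sum_congr rfl fun m _ => ?_
      rw [mul_pow]
      ring
    simp only [e1]
    rw [integral_finsetSum _ fun m hm' => (hi m hm').const_mul _]
    refine Finset.sum_congr rfl fun m _ => ?_
    rw [integral_const_mul, mul_assoc]
  rw [e]
  have h1 := HasDerivAt.fun_sum fun m (_ : m ∈ Finset.range (n + 1)) =>
    (hasDerivAt_pow m (0 : ℝ)).mul_const ((n.choose m) * ∫ x, φ x ^ m * Q x ^ (n - m))
  refine h1.congr_deriv ?_
  rw [Finset.sum_eq_single 1]
  · simp
  · intro m _ hm1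
    rcases eq_or_ne m 0 with rfl | hm0
    · simp
    · rw [zero_pow (by omega : m - 1 ≠ 0)]
      simp
  · intro h
    simp at h
    omega

theorem toComplex_grad_apply {φ : Plane → ℝ} (hφ : Differentiable ℝ φ) (x : Plane) (i : Fin 2) :
    grad (toComplex φ) x i = (fderiv ℝ φ x (EuclideanSpace.single i 1) : ℝ) := by
  rw [grad_apply]
  have h := (Complex.ofRealCLM.hasFDerivAt (x := φ x)).comp x (hφ x).hasFDerivAt
  have h2 : fderiv ℝ (toComplex φ) x = Complex.ofRealCLM.comp (fderiv ℝ φ x) := h.fderiv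
  rw [h2]
  rfl

theorem laplacian_eq_sum {φ : Plane → ℝ} (hφ : IsTestFunction φ) (x : Plane) :
    Laplacian.laplacian φ x = ∑ i : Fin 2, fderiv ℝ
      (fun y => fderiv ℝ φ y (EuclideanSpace.single i 1)) x (EuclideanSpace.single i 1) := by
  have h := congrFun (InnerProductSpace.laplacian_eq_iteratedFDeriv_orthonormalBasis φ
    (EuclideanSpace.basisFun (Fin 2) ℝ)) x
  rw [h]
  refine Finset.sum_congr rfl fun i _ => ?_
  have hd : DifferentiableAt ℝ (fderiv ℝ φ) x :=
    ((hφ.contDiff.fderiv_right (m := ∞) (by simp)).differentiable (by simp)) x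
  rw [iteratedFDeriv_two_apply, fderiv_clm_apply hd (differentiableAt_const _)]
  simp

/-- The weak gradient is tested against ∂ᵢφ, again a test function, and the results are summed over
i. Real parts appear because g is complex-valued although Q is real. -/
theorem integral_fderiv_mul_re {Q : Plane → ℝ} {g : Plane → EuclideanSpace ℂ (Fin 2)}
    (h : HasWeakGradient (toComplex Q) g) {φ : Plane → ℝ} (hφ : IsTestFunction φ) :
    ∫ x, ∑ i : Fin 2, fderiv ℝ φ x (EuclideanSpace.single i 1) * (g x i).re =
      -∫ x, Q x * Laplacian.laplacian φ x := by
  have hQ : LocallyIntegrable Q := by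
    intro x
    obtain ⟨s, hs, hi⟩ := h.1 x
    exact ⟨s, hs, hi.re⟩
  have h1 : ∀ i : Fin 2, Integrable fun x =>
      fderiv ℝ φ x (EuclideanSpace.single i 1) • g x i := fun i =>
    (hφ.fderiv_apply _).integrable_smul (h.2.1.euclidean_apply i)
  have h2 : ∀ i : Fin 2, Integrable fun x => fderiv ℝ
      (fun y => fderiv ℝ φ y (EuclideanSpace.single i 1)) x (EuclideanSpace.single i 1) * Q x :=
    fun i => ((hφ.fderiv_apply _).fderiv_apply _).integrable_smul hQ
  have e1 : ∀ x, Q x * Laplacian.laplacian φ x = ∑ i : Fin 2, fderiv ℝ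
      (fun y => fderiv ℝ φ y (EuclideanSpace.single i 1)) x (EuclideanSpace.single i 1) * Q x := by
    intro x
    rw [laplacian_eq_sum hφ, Finset.mul_sum]
    exact Finset.sum_congr rfl fun i _ => mul_comm _ _
  simp only [e1]
  have h1' : ∀ i : Fin 2, Integrable fun x =>
      fderiv ℝ φ x (EuclideanSpace.single i 1) * (g x i).re := fun i => by
    have := (h1 i).re
    simpa using this
  rw [integral_finsetSum _ fun i _ => h1' i, integral_finsetSum _ fun i _ => h2 i,
    ← Finset.sum_neg_distrib]
  refine Finset.sum_congr rfl fun i _ => ?_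
  have h3 := congrArg Complex.re (h.2.2 _ (hφ.fderiv_apply (EuclideanSpace.single i 1)) i)
  have e2 : ∀ x, fderiv ℝ (fun y => fderiv ℝ φ y (EuclideanSpace.single i 1)) x
      (EuclideanSpace.single i 1) • toComplex Q x = ((fderiv ℝ
      (fun y => fderiv ℝ φ y (EuclideanSpace.single i 1)) x (EuclideanSpace.single i 1) * Q x : ℝ)
        : ℂ) := fun x => by
    rw [toComplex, Complex.real_smul, Complex.ofReal_mul]
  simp only [e2] at h3
  rw [integral_complex_ofReal, Complex.ofReal_re, Complex.neg_re] at h3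
  have e3 := integral_re (h1 i)
  simp only [Complex.smul_re, RCLike.re_to_complex, smul_eq_mul] at e3
  rw [e3, h3, neg_neg]

theorem hasDerivAt_integral_norm_grad_sq {Q : Plane → ℝ} {g : Plane → EuclideanSpace ℂ (Fin 2)}
    (h : IsH1 (toComplex Q) g) {φ : Plane → ℝ} (hφ : IsTestFunction φ) :
    HasDerivAt (fun t : ℝ => ∫ x, ‖(t • grad (toComplex φ) + g) x‖ ^ 2)
      (-2 * ∫ x, Q x * Laplacian.laplacian φ x) 0 := by
  have hd := hφ.differentiable
  have hc : ContDiff ℝ ∞ (toComplex φ) := Complex.ofRealCLM.contDiff.comp hφ.contDiff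
  have hG := (isH1_grad hc (hφ.2.comp_left Complex.ofReal_zero)).3
  have iG := (memLp_iff_integrable_norm_pow hG.1 (n := 2) two_ne_zero).1 hG
  have ig := (memLp_iff_integrable_norm_pow h.3.1 (n := 2) two_ne_zero).1 h.3
  have ic : Integrable fun x => ∑ i : Fin 2,
      fderiv ℝ φ x (EuclideanSpace.single i 1) * (g x i).re := by
    refine integrable_finsetSum _ fun i _ => ?_
    have := ((hφ.fderiv_apply (EuclideanSpace.single i 1)).integrable_smul
      (h.1.2.1.euclidean_apply i)).re
    simpa using this
  have e : (fun t : ℝ => ∫ x, ‖(t • grad (toComplex φ) + g) x‖ ^ 2) = fun t =>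
      t ^ 2 * (∫ x, ‖grad (toComplex φ) x‖ ^ 2) + (2 * t) * (∫ x, ∑ i : Fin 2,
      fderiv ℝ φ x (EuclideanSpace.single i 1) * (g x i).re) + ∫ x, ‖g x‖ ^ 2 := by
    funext t
    have e1 : ∀ x, ‖(t • grad (toComplex φ) + g) x‖ ^ 2 = (t ^ 2 * ‖grad (toComplex φ) x‖ ^ 2 +
        (2 * t) * ∑ i : Fin 2, fderiv ℝ φ x (EuclideanSpace.single i 1) * (g x i).re)
        + ‖g x‖ ^ 2 := by
      intro x
      rw [EuclideanSpace.norm_sq_eq, EuclideanSpace.norm_sq_eq, EuclideanSpace.norm_sq_eq,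
        Finset.mul_sum, Finset.mul_sum, ← Finset.sum_add_distrib, ← Finset.sum_add_distrib]
      refine Finset.sum_congr rfl fun i _ => ?_
      simp only [Pi.add_apply, Pi.smul_apply, PiLp.add_apply, PiLp.smul_apply,
        toComplex_grad_apply hd, Complex.sq_norm, Complex.normSq_apply, Complex.add_re,
        Complex.add_im, Complex.real_smul, Complex.re_ofReal_mul, Complex.im_ofReal_mul,
        Complex.ofReal_re, Complex.ofReal_im]
      ring
    simp only [e1]
    have i1 := iG.const_mul (t ^ 2)
    have i2 := ic.const_mul (2 * t)
    have i12 := i1.add i2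
    simp only [Pi.add_def] at i12
    rw [integral_add i12 ig, integral_add i1 i2, integral_const_mul, integral_const_mul]
  rw [e]
  refine ((((hasDerivAt_pow 2 (0 : ℝ)).mul_const _).add
    (((hasDerivAt_id (0 : ℝ)).const_mul 2).mul_const _)).add_const _).congr_deriv ?_
  rw [integral_fderiv_mul_re h.1 hφ]
  simp

end CubicQuintic

end

/-! ### The first variation of the quotient -/

noncomputable section

namespace CubicQuintic

open Filter Topology Set
open scoped ENNReal NNReal RealInnerProductSpace

theorem hasDerivAt_quotient {α t a' b' d' e' : ℝ} {A B D E : ℝ → ℝ} (hA : HasDerivAt A a' t)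
    (hB : HasDerivAt B b' t) (hD : HasDerivAt D d' t) (hE : HasDerivAt E e' t) (hA0 : 0 < A t)
    (hB0 : 0 < B t) (hD0 : 0 < D t) (hE0 : 0 < E t) :
    HasDerivAt (fun s => quotient α (A s) (B s) (D s) (E s))
      (quotient α (A t) (B t) (D t) (E t) * (1 / (1 + α) * (a' / A t) +
        (2 + α) / (2 * (1 + α)) * (b' / B t) + α / (2 * (1 + α)) * (d' / D t) - e' / E t)) t := by
  unfold quotient
  refine ((((hA.rpow_const (Or.inl hA0.ne')).mul (hB.rpow_const (Or.inl hB0.ne'))).mul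
    (hD.rpow_const (Or.inl hD0.ne'))).div hE hE0.ne').congr_deriv ?_
  simp only [Pi.mul_apply]
  rw [Real.rpow_sub_one hA0.ne', Real.rpow_sub_one hB0.ne', Real.rpow_sub_one hD0.ne']
  generalize A t ^ (1 / (1 + α)) = x
  generalize B t ^ ((2 + α) / (2 * (1 + α))) = y
  generalize D t ^ (α / (2 * (1 + α))) = z
  generalize 1 / (1 + α) = p
  generalize (2 + α) / (2 * (1 + α)) = q
  generalize α / (2 * (1 + α)) = r
  field_simp

theorem quotient_pos {α A B D E : ℝ} (hA : 0 < A) (hB : 0 < B) (hD : 0 < D) (hE : 0 < E) :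
    0 < quotient α A B D E := by
  unfold quotient
  positivity

theorem norm_toComplex_pow (Q : Plane → ℝ) (x : Plane) {k : ℕ} (hk : Even k) :
    ‖toComplex Q x‖ ^ k = Q x ^ k := by
  rw [toComplex, Complex.norm_real, Real.norm_eq_abs, hk.pow_abs]

/-- The logarithmic derivative of the quotient along Q + tφ vanishes at t = 0. Once D and E are
expressed through A, multiplication by (1+α)A/2 gives coefficient 1 to the Laplacian, quintic and
cubic terms and leaves ω in front of Q. -/
theorem IsH1.euler_lagrange {α : ℝ} {Q : Plane → ℝ} {g : Plane → EuclideanSpace ℂ (Fin 2)}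
    (hα : 0 < α) (h : IsH1 (toComplex Q) g) (hF : F α (toComplex Q) = C α)
    (hA : 0 < ∫ x, ‖g x‖ ^ 2)
    (hD : ∫ x, ‖toComplex Q x‖ ^ 6 = 3 / 2 * α * ∫ x, ‖g x‖ ^ 2)
    (hE : ∫ x, ‖toComplex Q x‖ ^ 4 = 2 * (1 + α) * ∫ x, ‖g x‖ ^ 2)
    {φ : Plane → ℝ} (hφ : IsTestFunction φ) :
    ∫ x, (-(Q x * Laplacian.laplacian φ x) + (Q x ^ 5 - Q x ^ 3 +
      (2 + α) / 2 * ((∫ x, ‖g x‖ ^ 2) / ∫ x, ‖toComplex Q x‖ ^ 2) * Q x) * φ x) = 0 := by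
  have hE0 : 0 < ∫ x, ‖toComplex Q x‖ ^ 4 := by rw [hE]; positivity
  obtain ⟨-, hB0, hD0⟩ := h.energies_pos hE0
  have e2 := fun (x : Plane) (Q : Plane → ℝ) => norm_toComplex_pow Q x (k := 2) (by decide)
  have e4 := fun (x : Plane) (Q : Plane → ℝ) => norm_toComplex_pow Q x (k := 4) (by decide)
  have e6 := fun (x : Plane) (Q : Plane → ℝ) => norm_toComplex_pow Q x (k := 6) (by decide)
  have hm : AEStronglyMeasurable Q volume := by
    have := h.2.1.re
    exact this
  have h6 : Integrable fun x => ‖Q x‖ ^ 6 := by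
    simpa only [toComplex, Complex.norm_real] using h.integrable_pow_six
  have i2 := h.integrable_pow_two
  have i4 := h.integrable_pow_four
  have i6 := h.integrable_pow_six
  simp only [e2] at hB0 i2 ⊢
  simp only [e4] at hE0 hE i4
  simp only [e6] at hD0 hD i6
  have dA := hasDerivAt_integral_norm_grad_sq h hφ
  have dB := hasDerivAt_integral_pow hm h6 hφ.continuous hφ.2 (n := 2) (by norm_num)
    (by norm_num) i2
  have dD := hasDerivAt_integral_pow hm h6 hφ.continuous hφ.2 (n := 6) (by norm_num)
    (by norm_num) i6
  have dE := hasDerivAt_integral_pow hm h6 hφ.continuous hφ.2 (n := 4) (by norm_num)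
    (by norm_num) i4
  have hc : ContDiff ℝ ∞ (toComplex φ) := Complex.ofRealCLM.contDiff.comp hφ.contDiff
  have hu : ∀ t : ℝ, IsH1 (toComplex fun x => t * φ x + Q x) (t • grad (toComplex φ) + g) := by
    intro t
    have := ((isH1_grad hc (hφ.2.comp_left Complex.ofReal_zero)).const_smul t).add h
    convert! this using 1
    funext x
    simp [toComplex]
  have eF : ∀ t : ℝ, F α (toComplex fun x => t * φ x + Q x) =
      quotient α (∫ x, ‖(t • grad (toComplex φ) + g) x‖ ^ 2) (∫ x, (t * φ x + Q x) ^ 2)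
        (∫ x, (t * φ x + Q x) ^ 6) (∫ x, (t * φ x + Q x) ^ 4) := by
    intro t
    rw [(hu t).F_eq]
    simp only [e2, e4, e6]
  have hmin : IsLocalMin (fun t : ℝ =>
      quotient α (∫ x, ‖(t • grad (toComplex φ) + g) x‖ ^ 2) (∫ x, (t * φ x + Q x) ^ 2)
        (∫ x, (t * φ x + Q x) ^ 6) (∫ x, (t * φ x + Q x) ^ 4)) 0 := by
    -- For small t the fourth-power integral stays positive, so the perturbed function is an
    -- admissible nonzero competitor.
    filter_upwards [dE.continuousAt.eventually (lt_mem_nhds (a := 0) (by simpa using hE0))]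
      with t ht
    rw [← eF, ← eF]
    simp only [zero_mul, zero_add]
    rw [hF]
    refine C_le ((hu t).mem_H1Nonzero ?_)
    simp only [e4]
    exact ht.ne'
  have key := hmin.hasDerivAt_eq_zero (hasDerivAt_quotient dA dB dD dE (by simpa using hA)
    (by simpa using hB0) (by simpa using hD0) (by simpa using hE0))
  simp only [zero_smul, zero_mul, zero_add, Nat.reduceSub] at key
  rw [mul_eq_zero, or_iff_right (quotient_pos hA hB0 hD0 hE0).ne', hD, hE] at key
  have hQ1 : Integrable fun x => Q x * Laplacian.laplacian φ x := by
    have hQ : LocallyIntegrable Q := by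
      simpa only [pow_one] using locallyIntegrable_pow hm h6 (k := 1) (by norm_num)
    have : Integrable fun x => ∑ i : Fin 2, fderiv ℝ
      (fun y => fderiv ℝ φ y (EuclideanSpace.single i 1)) x (EuclideanSpace.single i 1) * Q x :=
      integrable_finsetSum _ fun i _ => ((hφ.fderiv_apply _).fderiv_apply _).integrable_smul hQ
    refine this.congr (.of_forall fun x => ?_)
    simp only []
    rw [laplacian_eq_sum hφ, mul_comm, Finset.sum_mul]
  have j1 := integrable_pow_mul hm h6 hφ.continuous hφ.2 (k := 1) (by norm_num)
  have j3 := integrable_pow_mul hm h6 hφ.continuous hφ.2 (k := 3) (by norm_num)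
  have j5 := integrable_pow_mul hm h6 hφ.continuous hφ.2 (k := 5) (by norm_num)
  set m := (2 + α) / 2 * ((∫ x, ‖g x‖ ^ 2) / ∫ x, Q x ^ 2) with hm
  have e : ∀ x, -(Q x * Laplacian.laplacian φ x) + (Q x ^ 5 - Q x ^ 3 + m * Q x) * φ x =
      (φ x * Q x ^ 5 + m * (φ x * Q x ^ 1)) - (Q x * Laplacian.laplacian φ x + φ x * Q x ^ 3) :=
    fun x => by ring
  have j51 : Integrable fun x => φ x * Q x ^ 5 + m * (φ x * Q x ^ 1) := j5.add (j1.const_mul m)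
  have jL3 : Integrable fun x => Q x * Laplacian.laplacian φ x + φ x * Q x ^ 3 := hQ1.add j3
  simp only [e]
  rw [integral_sub j51 jL3, integral_add j5 (j1.const_mul m), integral_add hQ1 j3,
    integral_const_mul, hm]
  generalize (∫ x, Q x * Laplacian.laplacian φ x) = X at *
  generalize (∫ x, φ x * Q x ^ 5) = Y at *
  generalize (∫ x, φ x * Q x ^ 3) = Z at *
  generalize (∫ x, φ x * Q x ^ 1) = W at *
  generalize (∫ x, ‖g x‖ ^ 2) = A at *
  generalize (∫ x, Q x ^ 2) = B at *
  have hne : (1 + α) ≠ 0 := by positivity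
  push_cast at key
  field_simp at key ⊢
  linarith

end CubicQuintic

end

noncomputable section

namespace CubicQuintic

open Filter Topology Set
open scoped ENNReal NNReal RealInnerProductSpace

/-! ### The radial equation -/

theorem hasFDerivAt_comp_norm_sq {G : ℝ → ℝ} {x : Plane} (hG : DifferentiableAt ℝ G (‖x‖ ^ 2)) :
    HasFDerivAt (fun y : Plane => G (‖y‖ ^ 2))
      (deriv G (‖x‖ ^ 2) • (2 • innerSL ℝ x : Plane →L[ℝ] ℝ)) x :=
  hG.hasDerivAt.comp_hasFDerivAt x (hasStrictFDerivAt_norm_sq x).hasFDerivAt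

theorem isTestFunction_comp_norm_sq {G : ℝ → ℝ} {R : ℝ} (hG : ContDiff ℝ ∞ G)
    (hR : ∀ s, R ≤ s → G s = 0) : IsTestFunction fun x : Plane => G (‖x‖ ^ 2) := by
  refine ⟨hG.comp (contDiff_norm_sq ℝ), HasCompactSupport.intro (isCompact_closedBall 0 (√R))
    fun x hx => hR _ ?_⟩
  rw [mem_closedBall_zero_iff, not_le] at hx
  exact (Real.sqrt_le_iff.1 hx.le).2

theorem laplacian_comp_norm_sq {G : ℝ → ℝ} {R : ℝ} (hG : ContDiff ℝ ∞ G)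
    (hR : ∀ s, R ≤ s → G s = 0) (x : Plane) :
    Laplacian.laplacian (fun y : Plane => G (‖y‖ ^ 2)) x =
      4 * (deriv G (‖x‖ ^ 2) + ‖x‖ ^ 2 * deriv (deriv G) (‖x‖ ^ 2)) := by
  have hG1 : Differentiable ℝ G := hG.differentiable (by simp)
  have hG2 : Differentiable ℝ (deriv G) :=
    ((contDiff_infty_iff_deriv.1 hG).2).differentiable (by simp)
  rw [laplacian_eq_sum (isTestFunction_comp_norm_sq hG hR)]
  have e1 : ∀ i : Fin 2, (fun y : Plane => fderiv ℝ (fun y : Plane => G (‖y‖ ^ 2)) y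
      (EuclideanSpace.single i 1)) = fun y => deriv G (‖y‖ ^ 2) * (2 * y i) := by
    intro i
    funext y
    rw [(hasFDerivAt_comp_norm_sq (hG1 _)).fderiv]
    simp [EuclideanSpace.inner_single_right]
  have e2 : ∀ i : Fin 2, fderiv ℝ (fun y : Plane => deriv G (‖y‖ ^ 2) * (2 * y i)) x
      (EuclideanSpace.single i 1) =
      2 * deriv G (‖x‖ ^ 2) + 4 * deriv (deriv G) (‖x‖ ^ 2) * x i ^ 2 := by
    intro i
    have h1 := hasFDerivAt_comp_norm_sq (x := x) (hG2 _)
    have h2 : HasFDerivAt (fun y : Plane => 2 * y i)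
        ((2 : ℝ) • (EuclideanSpace.proj i : Plane →L[ℝ] ℝ)) x :=
      (EuclideanSpace.proj i : Plane →L[ℝ] ℝ).hasFDerivAt.const_mul 2
    rw [(h1.fun_mul h2).fderiv]
    simp [EuclideanSpace.inner_single_right]
    ring
  simp only [e1, e2, EuclideanSpace.norm_sq_eq x, Real.norm_eq_abs, sq_abs, Fin.sum_univ_two]
  ring

/-- The nonlinearity of the equation along the profile `f`. -/
def nonlin (m : ℝ) (f : ℝ → ℝ) (s : ℝ) : ℝ := f s ^ 5 - f s ^ 3 + m * f s

variable {f : ℝ → ℝ} {m : ℝ}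

theorem integrableOn_pow_of_six (hm : Measurable f) (h6 : IntegrableOn (fun s => f s ^ 6) (Ioi 0))
    {k : ℕ} (hk : k ≤ 6) (R : ℝ) : IntegrableOn (fun s => f s ^ k) (Ioc 0 R) := by
  have h1 : IntegrableOn (fun s => 1 + f s ^ 6) (Ioc 0 R) :=
    (integrableOn_const (by simp)).add (h6.mono_set Ioc_subset_Ioi_self)
  refine h1.mono' (hm.pow_const k).aestronglyMeasurable (.of_forall fun s => ?_)
  have e : f s ^ 6 = |f s| ^ 6 := (Even.pow_abs (by decide) _).symm
  rw [norm_pow, Real.norm_eq_abs, e]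
  rcases le_total |f s| 1 with h | h
  · exact (pow_le_one₀ (abs_nonneg _) h).trans (le_add_of_nonneg_right (by positivity))
  · exact (pow_le_pow_right₀ h hk).trans (le_add_of_nonneg_left zero_le_one)

theorem intervalIntegrable_nonlin (hm : Measurable f)
    (h6 : IntegrableOn (fun s => f s ^ 6) (Ioi 0)) {a b : ℝ} (ha : 0 ≤ a) (hb : 0 ≤ b) :
    IntervalIntegrable (nonlin m f) volume a b := by
  have key : ∀ R, 0 ≤ R → IntervalIntegrable (nonlin m f) volume 0 R := by
    intro R hR
    rw [intervalIntegrable_iff_integrableOn_Ioc_of_le hR]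
    have h1 := integrableOn_pow_of_six hm h6 (k := 1) (by norm_num) R
    simp only [pow_one] at h1
    exact ((integrableOn_pow_of_six hm h6 (by norm_num) R).sub
      (integrableOn_pow_of_six hm h6 (by norm_num) R)).add (h1.const_mul m)
  exact (key a ha).symm.trans (key b hb)

theorem measurable_nonlin (hm : Measurable f) : Measurable (nonlin m f) := by
  unfold nonlin
  fun_prop

theorem continuousAt_nonlin {s : ℝ} (h : ContinuousAt f s) : ContinuousAt (nonlin m f) s :=
  ((h.pow 5).sub (h.pow 3)).add (h.const_mul m)

theorem countable_discontinuities (hf : AntitoneOn f (Ioi 0)) :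
    {s | 0 < s ∧ ¬ ContinuousAt f s}.Countable := by
  refine (hf.countable_not_continuousWithinAt).mono fun s hs => ?_
  refine mem_sep hs.1 fun h => hs.2 ?_
  exact h.continuousAt (Ioi_mem_nhds hs.1)

/-- The flux `∫₀ˢ N(f)`. -/
def flux (m : ℝ) (f : ℝ → ℝ) (s : ℝ) : ℝ := ∫ t in (0 : ℝ)..s, nonlin m f t

theorem continuousOn_flux (hm : Measurable f) (h6 : IntegrableOn (fun s => f s ^ 6) (Ioi 0)) (R : ℝ)
    (hR : 0 ≤ R) : ContinuousOn (flux m f) (Icc 0 R) := by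
  have := intervalIntegral.continuousOn_primitive_interval (μ := volume) (f := nonlin m f) (a := 0)
    (b := R) (by
      rw [← intervalIntegrable_iff']
      exact intervalIntegrable_nonlin hm h6 le_rfl hR)
  rwa [uIcc_of_le hR] at this

theorem continuousAt_flux (hm : Measurable f) (h6 : IntegrableOn (fun s => f s ^ 6) (Ioi 0)) {s : ℝ}
    (hs : 0 < s) : ContinuousAt (flux m f) s :=
  (continuousOn_flux hm h6 (s + 1) (by linarith)).continuousAt
    (Icc_mem_nhds hs (by linarith))

theorem hasDerivAt_flux (hm : Measurable f) (h6 : IntegrableOn (fun s => f s ^ 6) (Ioi 0)) {s : ℝ}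
    (hs : 0 < s) (hc : ContinuousAt f s) : HasDerivAt (flux m f) (nonlin m f s) s :=
  intervalIntegral.integral_hasDerivAt_right (intervalIntegrable_nonlin hm h6 le_rfl hs.le)
    (measurable_nonlin hm).stronglyMeasurable.stronglyMeasurableAtFilter (continuousAt_nonlin hc)

/-- Integration by parts with a flux that is continuous and differentiable off the countably many
jumps of the monotone profile. The boundary terms vanish because the flux is zero at 0 and G is zero
at R. -/
theorem integral_nonlin_mul (hf : AntitoneOn f (Ioi 0)) (hm : Measurable f)
    (h6 : IntegrableOn (fun s => f s ^ 6) (Ioi 0)) {G G' : ℝ → ℝ} (hG : ∀ s, HasDerivAt G (G' s) s)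
    (hG' : Continuous G') {R : ℝ} (hR : 0 ≤ R) (hGR : G R = 0) :
    ∫ s in (0 : ℝ)..R, nonlin m f s * G s = - ∫ s in (0 : ℝ)..R, flux m f s * G' s := by
  have hGc : Continuous G := continuous_iff_continuousAt.2 fun s => (hG s).continuousAt
  have hK := continuousOn_flux (m := m) hm h6 R hR
  have i1 : IntervalIntegrable (fun s => nonlin m f s * G s) volume 0 R :=
    (intervalIntegrable_nonlin hm h6 le_rfl hR).mul_continuousOn hGc.continuousOn
  have i2 : IntervalIntegrable (fun s => flux m f s * G' s) volume 0 R := by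
    refine ContinuousOn.intervalIntegrable ?_
    rw [uIcc_of_le hR]
    exact hK.mul hG'.continuousOn
  have h := integral_eq_of_hasDerivAt_off_countable (fun s => flux m f s * G s)
    (fun s => nonlin m f s * G s + flux m f s * G' s) (a := 0) (b := R)
    (countable_discontinuities hf) (by
      rw [uIcc_of_le hR]
      exact hK.mul hGc.continuousOn) (fun s hs => by
      rw [min_eq_left hR, max_eq_right hR] at hs
      have hc : ContinuousAt f s := by
        by_contra hc
        exact hs.2 ⟨hs.1.1, hc⟩
      exact (hasDerivAt_flux hm h6 hs.1.1 hc).mul (hG s)) (i1.add i2)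
  rw [intervalIntegral.integral_add i1 i2, hGR] at h
  simp only [flux, intervalIntegral.integral_same, zero_mul, mul_zero, sub_zero] at h ⊢
  linarith

/-- The test function is G(|x|²) with G′ = η/s: its Laplacian is 4(sG′)′ = 4η′, and integrating the
nonlinearity against G by parts produces the flux times η/s. -/
theorem radial_weak_equation (hf : AntitoneOn f (Ioi 0)) (hm : Measurable f)
    (h6 : IntegrableOn (fun s => f s ^ 6) (Ioi 0))
    (hw : ∀ φ : Plane → ℝ, IsTestFunction φ → ∫ x, (-(f (‖x‖ ^ 2) * Laplacian.laplacian φ x) +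
      (f (‖x‖ ^ 2) ^ 5 - f (‖x‖ ^ 2) ^ 3 + m * f (‖x‖ ^ 2)) * φ x) = 0)
    {η : ℝ → ℝ} (hη : ContDiff ℝ ∞ η) (hc : HasCompactSupport η) (hs : tsupport η ⊆ Ioi 0) :
    ∫ s in Ioi 0, f s * deriv η s = - ∫ s in Ioi 0, flux m f s / (4 * s) * η s := by
  obtain ⟨R₀, hR₀⟩ := hc.isCompact.bddAbove
  set R := max R₀ 0 + 1
  have hR : 0 < R := by
    have := le_max_right R₀ 0
    positivity
  have hηR : ∀ s, R ≤ s → s ∉ tsupport η := by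
    intro s hs' h
    have h1 := hR₀ h
    have := le_max_left R₀ 0
    simp only [R] at hs'
    linarith
  set θ : ℝ → ℝ := fun s => η s / s with hθ
  have hθt : tsupport θ ⊆ tsupport η := closure_mono fun s h => by
    intro h0
    simp [hθ, h0] at h
  have hθs : ContDiff ℝ ∞ θ := by
    refine contDiff_iff_contDiffAt.2 fun s => ?_
    by_cases h : s ∈ tsupport θ
    · exact hη.contDiffAt.div contDiffAt_id (ne_of_gt (hs (hθt h)))
    · exact contDiffAt_const.congr_of_eventuallyEq (notMem_tsupport_iff_eventuallyEq.1 h)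
  -- Starting the primitive at R makes G vanish beyond the support of η. Near 0 it is merely
  -- constant, which is harmless for a function of |x|².
  set G : ℝ → ℝ := fun s => ∫ t in R..s, θ t
  have hG : ∀ s, HasDerivAt G (θ s) s := fun s =>
    intervalIntegral.integral_hasDerivAt_right (hθs.continuous.intervalIntegrable _ _)
      hθs.continuous.stronglyMeasurable.stronglyMeasurableAtFilter hθs.continuous.continuousAt
  have hGd : deriv G = θ := funext fun s => (hG s).deriv
  have hGs : ContDiff ℝ ∞ G := contDiff_infty_iff_deriv.2
    ⟨fun s => (hG s).differentiableAt, hGd ▸ hθs⟩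
  have hGR : ∀ s, R ≤ s → G s = 0 := by
    intro s hs'
    refine intervalIntegral.integral_zero_ae (.of_forall fun t ht => ?_)
    rw [uIoc_of_le hs'] at ht
    exact image_eq_zero_of_notMem_tsupport fun h => hηR t ht.1.le (hθt h)
  have e0 : ∀ s, η s = s * θ s := by
    intro s
    rcases eq_or_ne s 0 with rfl | h0
    · rw [zero_mul]
      exact image_eq_zero_of_notMem_tsupport fun h => lt_irrefl (0 : ℝ) (hs h)
    · simp only [hθ]
      field_simp
  have hηd : ∀ s, deriv η s = θ s + s * deriv θ s := by
    intro s
    have h1 := (hasDerivAt_id s).mul (hθs.differentiable (by simp) s).hasDerivAt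
    have h2 : η = fun s => s * θ s := funext e0
    rw [h2]
    refine h1.deriv.trans ?_
    simp
  have key := hw _ (isTestFunction_comp_norm_sq hGs hGR)
  simp only [laplacian_comp_norm_sq hGs hGR, hGd] at key
  have e1 : ∀ x : Plane, -(f (‖x‖ ^ 2) * (4 * (θ (‖x‖ ^ 2) + ‖x‖ ^ 2 * deriv θ (‖x‖ ^ 2)))) +
      (f (‖x‖ ^ 2) ^ 5 - f (‖x‖ ^ 2) ^ 3 + m * f (‖x‖ ^ 2)) * G (‖x‖ ^ 2) =
      (fun s => -4 * (f s * deriv η s) + nonlin m f s * G s) (‖x‖ ^ 2) := by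
    intro x
    simp only [nonlin, hηd]
    ring
  simp only [e1] at key
  have hGm : Measurable G := hGs.continuous.measurable
  have hηdc : Continuous (deriv η) := hη.continuous_deriv (by simp)
  rw [integral_comp_norm_sq (fun s => -4 * (f s * deriv η s) + nonlin m f s * G s)
    (((hm.mul hηdc.measurable).const_mul (-4)).add
      ((measurable_nonlin hm).mul hGm)).aestronglyMeasurable,
    mul_eq_zero, or_iff_right Real.pi_pos.ne'] at key
  have hcut : ∀ F : ℝ → ℝ, (∀ s, R ≤ s → F s = 0) → ∫ s in Ioi 0, F s = ∫ s in (0 : ℝ)..R, F s := by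
    intro F hF
    rw [intervalIntegral.integral_of_le hR.le]
    refine setIntegral_eq_of_subset_of_forall_sdiff_eq_zero measurableSet_Ioi
      Ioc_subset_Ioi_self fun s hs' => hF s ?_
    by_contra h
    exact hs'.2 ⟨hs'.1, (not_le.1 h).le⟩
  have hη0 : ∀ s, R ≤ s → η s = 0 := fun s h => image_eq_zero_of_notMem_tsupport (hηR s h)
  have hηd0 : ∀ s, R ≤ s → deriv η s = 0 := fun s h =>
    image_eq_zero_of_notMem_tsupport fun h' => hηR s h (tsupport_deriv_subset h')
  rw [hcut _ fun s h => by rw [hηd0 s h, hGR s h]; simp] at key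
  rw [hcut _ fun s h => by rw [hηd0 s h, mul_zero], hcut _ fun s h => by rw [hη0 s h, mul_zero]]
  have i1 : IntervalIntegrable (fun s => -4 * (f s * deriv η s)) volume 0 R := by
    have h1 : IntervalIntegrable f volume 0 R := by
      rw [intervalIntegrable_iff_integrableOn_Ioc_of_le hR.le]
      simpa using integrableOn_pow_of_six hm h6 (k := 1) (by norm_num) R
    exact (h1.mul_continuousOn hηdc.continuousOn).const_mul (-4)
  have i2 : IntervalIntegrable (fun s => nonlin m f s * G s) volume 0 R :=
    (intervalIntegrable_nonlin hm h6 le_rfl hR.le).mul_continuousOn hGs.continuous.continuousOn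
  rw [intervalIntegral.integral_add i1 i2, intervalIntegral.integral_const_mul,
    integral_nonlin_mul hf hm h6 hG hθs.continuous hR.le (hGR R le_rfl)] at key
  have e2 : ∫ s in (0 : ℝ)..R, flux m f s / (4 * s) * η s =
      1 / 4 * ∫ s in (0 : ℝ)..R, flux m f s * θ s := by
    rw [← intervalIntegral.integral_const_mul]
    refine intervalIntegral.integral_congr fun s _ => ?_
    simp only [hθ]
    rcases eq_or_ne s 0 with rfl | h0
    · simp
    · field_simp
  rw [e2]
  linarith

end CubicQuintic

end

noncomputable section

namespace CubicQuintic

open Filter Topology Set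
open scoped ENNReal NNReal RealInnerProductSpace

/-! ### Regularity and positivity of the radial profile -/

theorem exists_Ioo_of_isCompact {K : Set ℝ} (hK : IsCompact K) (h : K ⊆ Ioi 0) :
    ∃ a b, 0 < a ∧ a < b ∧ K ⊆ Ioo a b := by
  rcases K.eq_empty_or_nonempty with rfl | hne
  · exact ⟨1, 2, one_pos, one_lt_two, empty_subset _⟩
  obtain ⟨p, hp, hp'⟩ := hK.exists_isLeast hne
  obtain ⟨q, hq, hq'⟩ := hK.exists_isGreatest hne
  have h0 : 0 < p := h hp
  have hpq : p ≤ q := hp' hq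
  exact ⟨p / 2, q + 1, by linarith, by linarith, fun x hx => by
    have h1 := hp' hx
    have h2 := hq' hx
    constructor <;> linarith⟩

theorem setIntegral_Ioi_eq_intervalIntegral {F : ℝ → ℝ} {a b : ℝ} (ha : 0 < a) (hab : a < b)
    (hF : ∀ s, s ∉ Ioo a b → F s = 0) : ∫ s in Ioi 0, F s = ∫ s in a..b, F s := by
  rw [intervalIntegral.integral_of_le hab.le]
  refine setIntegral_eq_of_subset_of_forall_sdiff_eq_zero measurableSet_Ioi
    (fun s hs => ha.trans hs.1) fun s hs => hF s fun h => hs.2 ⟨h.1, h.2.le⟩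

/-- The du Bois-Reymond lemma: subtracting from ζ its integral times a fixed bump ψ of mass one
leaves a function of mean zero, which is the derivative of an admissible η. -/
theorem ae_eq_const_of_integral_mul_deriv_eq_zero {v : ℝ → ℝ}
    (hv : LocallyIntegrableOn v (Ioi 0)) (h : ∀ η : ℝ → ℝ, ContDiff ℝ ∞ η → HasCompactSupport η →
      tsupport η ⊆ Ioi 0 → ∫ s in Ioi 0, v s * deriv η s = 0) :
    ∃ c, ∀ᵐ s : ℝ, s ∈ Ioi (0 : ℝ) → v s = c := by
  have hint : ∀ ζ : ℝ → ℝ, Continuous ζ → HasCompactSupport ζ → tsupport ζ ⊆ Ioi 0 →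
      IntegrableOn (fun s => v s * ζ s) (Ioi 0) := by
    intro ζ hζ hc hs
    have h1 : IntegrableOn (fun s => v s * ζ s) (tsupport ζ) :=
      (hv.integrableOn_compact_subset hs hc.isCompact).mul_continuousOn hζ.continuousOn hc.isCompact
    refine ((integrableOn_iff_integrable_of_support_subset fun s h0 => ?_).1 h1).integrableOn
    exact subset_tsupport _ fun h2 => h0 (by simp [h2])
  let χ : ContDiffBump (2 : ℝ) := ⟨1 / 2, 1, by norm_num, by norm_num⟩
  set ψ : ℝ → ℝ := χ.normed volume
  have hψ : ContDiff ℝ ∞ ψ := χ.contDiff_normed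
  have hψc : HasCompactSupport ψ := χ.hasCompactSupport_normed
  have hψs : tsupport ψ ⊆ Ioi 0 := by
    rw [χ.tsupport_normed_eq]
    intro x hx
    rw [Metric.mem_closedBall, Real.dist_eq] at hx
    have := (abs_le.1 hx).1
    simp only [χ] at this
    simp only [mem_Ioi]
    linarith
  set c := ∫ s in Ioi 0, v s * ψ s
  refine ⟨c, ?_⟩
  have key := isOpen_Ioi.ae_eq_zero_of_integral_contDiff_smul_eq_zero (μ := volume)
    (f := fun s => v s - c) (hv.sub ((locallyIntegrable_const c).locallyIntegrableOn _)) (by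
    intro ζ hζ hc hs
    set I := ∫ s, ζ s
    set ρ : ℝ → ℝ := fun s => ζ s - I * ψ s with hρ
    have hρs : ContDiff ℝ ∞ ρ := hζ.sub (contDiff_const.mul hψ)
    obtain ⟨a, b, ha, hab, hsub⟩ := exists_Ioo_of_isCompact (hc.isCompact.union hψc.isCompact)
      (union_subset hs hψs)
    have hρ0 : ∀ s, s ∉ Ioo a b → ρ s = 0 := by
      intro s h0
      have h1 : ζ s = 0 := image_eq_zero_of_notMem_tsupport fun h2 => h0 (hsub (Or.inl h2))
      have h2 : ψ s = 0 := image_eq_zero_of_notMem_tsupport fun h2 => h0 (hsub (Or.inr h2))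
      simp [hρ, h1, h2]
    set η : ℝ → ℝ := fun s => ∫ t in a..s, ρ t
    have hd : ∀ s, HasDerivAt η (ρ s) s := fun s =>
      intervalIntegral.integral_hasDerivAt_right (hρs.continuous.intervalIntegrable _ _)
        hρs.continuous.stronglyMeasurable.stronglyMeasurableAtFilter hρs.continuous.continuousAt
    have hηd : deriv η = ρ := funext fun s => (hd s).deriv
    have hη : ContDiff ℝ ∞ η := contDiff_infty_iff_deriv.2
      ⟨fun s => (hd s).differentiableAt, hηd ▸ hρs⟩
    have hρI : ∫ s, ρ s = 0 := by
      rw [integral_sub (hζ.continuous.integrable_of_hasCompactSupport hc)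
        ((hψ.continuous.integrable_of_hasCompactSupport hψc).const_mul I), integral_const_mul,
        χ.integral_normed, mul_one, sub_self]
    have hη0 : ∀ s, s ∉ Icc a b → η s = 0 := by
      intro s h0
      rcases lt_or_ge s a with h1 | h1
      · refine intervalIntegral.integral_zero_ae (.of_forall fun t ht => hρ0 t fun h2 => ?_)
        rw [uIoc_of_ge h1.le] at ht
        exact absurd h2.1 (not_lt.2 ht.2)
      · have h2 : b ≤ s := by
          by_contra h2
          exact h0 ⟨h1, (not_le.1 h2).le⟩
        refine (intervalIntegral.integral_eq_integral_of_support_subset fun t ht => ?_).trans hρI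
        have h3 : t ∈ Ioo a b := by
          by_contra h3
          exact ht (hρ0 t h3)
        exact ⟨h3.1, h3.2.le.trans h2⟩
    have hηs : tsupport η ⊆ Icc a b := closure_minimal (fun s h0 => by
      by_contra h1
      exact h0 (hη0 s h1)) isClosed_Icc
    have h1 := h η hη (isCompact_Icc.of_isClosed_subset (isClosed_tsupport η) hηs)
      fun s h0 => ha.trans_le (hηs h0).1
    rw [hηd] at h1
    have e1 : ∀ s, v s * ρ s = v s * ζ s - I * (v s * ψ s) := fun s => by
      simp only [hρ]
      ring
    simp only [e1] at h1
    rw [integral_sub (hint ζ hζ.continuous hc hs) ((hint ψ hψ.continuous hψc hψs).const_mul I),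
      integral_const_mul] at h1
    have e2 : ∫ s, ζ s • (v s - c) = ∫ s in Ioi 0, ζ s • (v s - c) := by
      refine (setIntegral_eq_integral_of_forall_compl_eq_zero fun s h0 => ?_).symm
      rw [image_eq_zero_of_notMem_tsupport fun h2 => h0 (hs h2), zero_smul]
    have e3 : ∫ s in Ioi 0, ζ s = I := 
      setIntegral_eq_integral_of_forall_compl_eq_zero fun s h0 =>
        image_eq_zero_of_notMem_tsupport fun h2 => h0 (hs h2)
    have e4 : ∀ s, ζ s • (v s - c) = v s * ζ s - c * ζ s := fun s => by
      rw [smul_eq_mul]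
      ring
    rw [e2]
    simp only [e4]
    rw [integral_sub (hint ζ hζ.continuous hc hs)
      ((hζ.continuous.integrable_of_hasCompactSupport hc).integrableOn.const_mul c),
      integral_const_mul, e3]
    linarith)
  filter_upwards [key] with s hs h0
  linarith [hs h0]

/-- A point with f s < F s would force f < F just to the right of s, by monotonicity of f and
continuity of F; the opposite inequality is excluded on the left. -/
theorem eqOn_of_antitoneOn_of_ae_eq {f F : ℝ → ℝ} (hf : AntitoneOn f (Ioi 0))
    (hF : ContinuousOn F (Ioi 0)) (h : ∀ᵐ s : ℝ, s ∈ Ioi (0 : ℝ) → f s = F s) :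
    EqOn f F (Ioi 0) := by
  have hd : ∀ a b : ℝ, 0 ≤ a → a < b → ∃ t ∈ Ioo a b, f t = F t := by
    intro a b ha hab
    have h1 : ∃ᵐ t : ℝ, t ∈ Ioo a b := by
      rw [frequently_ae_mem_iff]
      simp [hab]
    obtain ⟨t, ht, ht'⟩ := (h1.and_eventually h).exists
    exact ⟨t, ht, ht' (ha.trans_lt ht.1)⟩
  intro s hs
  have hs0 : 0 < s := hs
  have hc : ContinuousAt F s := hF.continuousAt (Ioi_mem_nhds hs)
  rcases lt_trichotomy (f s) (F s) with h1 | h1 | h1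
  · obtain ⟨δ, hδ, h2⟩ := Metric.eventually_nhds_iff.1 (hc.eventually (lt_mem_nhds h1))
    obtain ⟨t, ht, ht'⟩ := hd s (s + δ) hs0.le (by linarith)
    have h3 := h2 (y := t) (by rw [Real.dist_eq, abs_of_pos] <;> linarith [ht.1, ht.2])
    have h4 := hf hs (show t ∈ Ioi (0 : ℝ) from hs0.trans ht.1) ht.1.le
    linarith
  · exact h1
  · obtain ⟨δ, hδ, h2⟩ := Metric.eventually_nhds_iff.1 (hc.eventually (gt_mem_nhds h1))
    obtain ⟨t, ht, ht'⟩ := hd (max 0 (s - δ)) s (le_max_left _ _) (max_lt hs0 (by linarith))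
    have h5 := (le_max_right 0 (s - δ)).trans_lt ht.1
    have h6 : 0 < t := (le_max_left 0 (s - δ)).trans_lt ht.1
    have h3 := h2 (y := t) (by rw [Real.dist_eq, abs_of_neg] <;> linarith [ht.2])
    have h4 := hf (show t ∈ Ioi (0 : ℝ) from h6) hs ht.2.le
    linarith

variable {f : ℝ → ℝ} {m : ℝ}

/-- The right-hand side of the equation is continuous on the open half line. Its primitive h differs
from f by a constant almost everywhere, hence everywhere since f is monotone. -/
theorem hasDerivAt_profile (hf : AntitoneOn f (Ioi 0)) (hm : Measurable f)
    (h6 : IntegrableOn (fun s => f s ^ 6) (Ioi 0))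
    (hw : ∀ η : ℝ → ℝ, ContDiff ℝ ∞ η → HasCompactSupport η → tsupport η ⊆ Ioi 0 →
      ∫ s in Ioi 0, f s * deriv η s = - ∫ s in Ioi 0, flux m f s / (4 * s) * η s) {s : ℝ}
    (hs : 0 < s) : HasDerivAt f (flux m f s / (4 * s)) s := by
  set k : ℝ → ℝ := fun s => flux m f s / (4 * s)
  have hk : ContinuousOn k (Ioi 0) := fun s hs => by
    have hs0 : 0 < s := hs
    exact ((continuousAt_flux hm h6 hs).div (by fun_prop) (by positivity)).continuousWithinAt
  have hki : ∀ a b, 0 < a → 0 < b → IntervalIntegrable k volume a b := fun a b ha hb =>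
    (hk.mono fun x hx => (lt_min ha hb).trans_le hx.1).intervalIntegrable
  set h : ℝ → ℝ := fun s => ∫ t in (1 : ℝ)..s, k t
  have hd : ∀ s, 0 < s → HasDerivAt h (k s) s := fun s hs =>
    intervalIntegral.integral_hasDerivAt_right (hki 1 s one_pos hs)
      (hk.stronglyMeasurableAtFilter isOpen_Ioi s hs) (hk.continuousAt (Ioi_mem_nhds hs))
  have hh : ContinuousOn h (Ioi 0) := fun s hs => (hd s hs).continuousAt.continuousWithinAt
  have hfl : LocallyIntegrableOn f (Ioi 0) := by
    refine (locallyIntegrableOn_iff isOpen_Ioi.isLocallyClosed).2 fun K hK hKc => ?_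
    obtain ⟨a, b, ha, hab, hsub⟩ := exists_Ioo_of_isCompact hKc hK
    have h1 := integrableOn_pow_of_six hm h6 (k := 1) (by norm_num) b
    simp only [pow_one] at h1
    exact h1.mono_set fun x hx => ⟨ha.trans (hsub hx).1, (hsub hx).2.le⟩
  obtain ⟨c, hc⟩ := ae_eq_const_of_integral_mul_deriv_eq_zero
    (v := fun s => f s - h s) (hfl.sub (hh.locallyIntegrableOn measurableSet_Ioi)) (by
    intro η hη hηc hηs
    obtain ⟨a, b, ha, hab, hsub⟩ := exists_Ioo_of_isCompact hηc.isCompact hηs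
    have hη0 : ∀ s, s ∉ Ioo a b → η s = 0 := fun s h0 =>
      image_eq_zero_of_notMem_tsupport fun h1 => h0 (hsub h1)
    have hηd0 : ∀ s, s ∉ Ioo a b → deriv η s = 0 := fun s h0 =>
      image_eq_zero_of_notMem_tsupport fun h1 => h0 (hsub (tsupport_deriv_subset h1))
    have hηdc : Continuous (deriv η) := hη.continuous_deriv (by simp)
    have h1 := hw η hη hηc hηs
    rw [setIntegral_Ioi_eq_intervalIntegral ha hab fun s h0 => by rw [hηd0 s h0, mul_zero],
      setIntegral_Ioi_eq_intervalIntegral ha hab fun s h0 => by rw [hη0 s h0, mul_zero]] at h1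
    rw [setIntegral_Ioi_eq_intervalIntegral ha hab fun s h0 => by rw [hηd0 s h0, mul_zero]]
    have hsub' : uIcc a b ⊆ Ioi 0 := by
      rw [uIcc_of_le hab.le]
      exact fun x hx => ha.trans_le hx.1
    have h2 := intervalIntegral.integral_mul_deriv_eq_deriv_mul (u := h) (v := η) (a := a) (b := b)
      (u' := k) (v' := deriv η) (fun x hx => hd x (hsub' hx))
      (fun x _ => (hη.differentiable (by simp) x).hasDerivAt) (hki a b ha (ha.trans hab))
      (hηdc.intervalIntegrable _ _)
    rw [hη0 a fun h0 => lt_irrefl _ h0.1, hη0 b fun h0 => lt_irrefl _ h0.2] at h2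
    have hfi : IntervalIntegrable f volume a b := by
      rw [intervalIntegrable_iff_integrableOn_Ioc_of_le hab.le]
      have h1 := integrableOn_pow_of_six hm h6 (k := 1) (by norm_num) b
      simp only [pow_one] at h1
      exact h1.mono_set fun x hx => ⟨ha.trans hx.1, hx.2⟩
    simp only [sub_mul]
    rw [intervalIntegral.integral_sub (hfi.mul_continuousOn hηdc.continuousOn)
      (((hh.mono hsub').intervalIntegrable).mul_continuousOn hηdc.continuousOn), h1, h2]
    simp [k])
  have heq := eqOn_of_antitoneOn_of_ae_eq (F := fun s => h s + c) hf
    (hh.add continuousOn_const) (by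
      filter_upwards [hc] with s h1 h2
      linarith [h1 h2])
  refine ((hd s hs).add_const c).congr_of_eventuallyEq ?_
  filter_upwards [Ioi_mem_nhds hs] with t ht using heq ht

/-- With M = ∫f⁶, monotonicity gives s f⁶ ≤ M, so f³ ≤ √(M/s). Only the cubic term of the
nonlinearity is negative, whence the flux is at least −2√(Ms) and f′ ≥ −√M/(2√s). Thus f + √(Ms)
increases, and its value at 1 bounds f near the origin. -/
theorem exists_profile_bound (hf : AntitoneOn f (Ioi 0)) (hm : Measurable f) (hf0 : ∀ s, 0 ≤ f s)
    (h6 : IntegrableOn (fun s => f s ^ 6) (Ioi 0)) (hm0 : 0 ≤ m)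
    (hd : ∀ s, 0 < s → HasDerivAt f (flux m f s / (4 * s)) s) : BddAbove (f '' Ioi 0) := by
  set M := ∫ s in Ioi 0, f s ^ 6
  have hM : ∀ s, 0 < s → s * f s ^ 6 ≤ M := by
    intro s hs
    calc s * f s ^ 6 = ∫ t in Ioc 0 s, f s ^ 6 := by simp [hs.le]
      _ ≤ ∫ t in Ioc 0 s, f t ^ 6 := by
          refine setIntegral_mono_on (integrableOn_const (by simp))
            (h6.mono_set Ioc_subset_Ioi_self) measurableSet_Ioc fun t ht => ?_
          have := hf ht.1 (show s ∈ Ioi (0 : ℝ) from hs) ht.2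
          have := hf0 s
          gcongr
      _ ≤ M := setIntegral_mono_set h6 (.of_forall fun t => pow_nonneg (hf0 t) 6)
          Ioc_subset_Ioi_self.eventuallyLE
  have h3 : ∀ s, 0 < s → f s ^ 3 ≤ √M * s ^ (-(1 / 2) : ℝ) := by
    intro s hs
    rw [Real.rpow_neg hs.le, ← Real.sqrt_eq_rpow, ← div_eq_mul_inv, ← Real.sqrt_div' _ hs.le]
    refine Real.le_sqrt_of_sq_le ?_
    rw [le_div_iff₀ hs]
    have := hM s hs
    nlinarith
  have hK : ∀ s, 0 < s → -(2 * √M * √s) ≤ flux m f s := by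
    intro s hs
    have e : -(2 * √M * √s) = ∫ t in (0 : ℝ)..s, -(√M * t ^ (-(1 / 2) : ℝ)) := by
      rw [intervalIntegral.integral_neg, intervalIntegral.integral_const_mul,
        integral_rpow (Or.inl (by norm_num)), Real.sqrt_eq_rpow s]
      norm_num
      ring
    rw [e]
    refine intervalIntegral.integral_mono_on_of_le_Ioo hs.le
      ((intervalIntegral.intervalIntegrable_rpow' (by norm_num)).const_mul _).neg
      (intervalIntegrable_nonlin hm h6 le_rfl hs.le) fun t ht => ?_
    have h1 := h3 t ht.1
    have h2 := hf0 t
    have h4 : 0 ≤ f t ^ 5 := by positivity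
    have h5 : 0 ≤ m * f t := by positivity
    simp only [nonlin]
    linarith
  have hg : ∀ s, 0 < s → HasDerivAt (fun s => f s + √M * √s)
      (flux m f s / (4 * s) + √M * (1 / (2 * √s))) s := fun s hs =>
    (hd s hs).add ((Real.hasDerivAt_sqrt hs.ne').const_mul _)
  have hmono : MonotoneOn (fun s => f s + √M * √s) (Ioi 0) := by
    refine monotoneOn_of_deriv_nonneg (convex_Ioi 0)
      (fun s hs => (hg s hs).continuousAt.continuousWithinAt)
      (fun s hs => (hg s (by simpa using hs)).differentiableAt.differentiableWithinAt) fun s hs => ?_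
    have hs0 : 0 < s := by simpa using hs
    rw [(hg s hs0).deriv]
    have h1 := hK s hs0
    have h2 : 0 < √s := Real.sqrt_pos.2 hs0
    have h4 : √s * √s = s := Real.mul_self_sqrt hs0.le
    have e : √M * (1 / (2 * √s)) = (2 * √M * √s) / (4 * s) := by
      rw [← h4]
      field_simp
      norm_num
      ring
    rw [e, ← add_div]
    refine div_nonneg (by linarith) (by positivity)
  refine ⟨f 1 + √M * √1, ?_⟩
  rintro _ ⟨s, hs, rfl⟩
  have hM0 : 0 ≤ √M * √1 := by positivity
  rcases le_total s 1 with h1 | h1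
  · have h2 := hmono hs (mem_Ioi.2 one_pos) h1
    have h4 : 0 ≤ √M * √s := by positivity
    simp only at h2
    linarith
  · have := hf (mem_Ioi.2 one_pos) hs h1
    linarith

/-- At a zero of f ≥ 0 the derivative vanishes, hence so does the flux. The pair (f, flux) then has
zero data at s and satisfies a linear differential inequality towards the origin, so it vanishes at
r as well, where f r ≠ 0. -/
theorem profile_pos (hf : AntitoneOn f (Ioi 0)) (hm : Measurable f) (hf0 : ∀ s, 0 ≤ f s)
    (h6 : IntegrableOn (fun s => f s ^ 6) (Ioi 0)) (hm0 : 0 ≤ m)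
    (hd : ∀ s, 0 < s → HasDerivAt f (flux m f s / (4 * s)) s) (hne : ∃ s, 0 < s ∧ f s ≠ 0) {s : ℝ}
    (hs : 0 < s) : 0 < f s := by
  refine lt_of_le_of_ne (hf0 s) fun h0 => ?_
  obtain ⟨r, hr, hr0⟩ := hne
  have hrs : r < s := by
    by_contra h1
    have := hf hs hr (not_lt.1 h1)
    exact hr0 (le_antisymm (by linarith) (hf0 r))
  have hK0 : flux m f s = 0 := by
    have h1 : IsLocalMin f s := .of_forall fun t => by
      rw [← h0]
      exact hf0 t
    have := h1.hasDerivAt_eq_zero (hd s hs)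
    rw [div_eq_zero_iff] at this
    exact this.resolve_right (by positivity)
  set Y : ℝ → ℝ × ℝ := fun t => (f (s - t), flux m f (s - t))
  set Y' : ℝ → ℝ × ℝ := fun t => (-(flux m f (s - t) / (4 * (s - t))), -nonlin m f (s - t))
  have hpos : ∀ t ∈ Icc 0 (s - r), 0 < s - t := fun t ht => by linarith [ht.2]
  have hY : ∀ t ∈ Icc 0 (s - r), HasDerivAt Y (Y' t) t := by
    intro t ht
    have h1 := (hd _ (hpos t ht)).comp_const_sub s t
    have h2 := (hasDerivAt_flux (m := m) hm h6 (hpos t ht)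
      (hd _ (hpos t ht)).continuousAt).comp_const_sub s t
    exact h1.prodMk h2
  -- Grönwall in reversed time. On [r, s] one has 1/(4τ) ≤ 1/(4r), and |N(f)| ≤ (f(r)⁴ + f(r)² + m)
  -- f since f ≤ f(r).
  have hz := eq_zero_of_abs_deriv_le_mul_abs_self_of_eq_zero_right (f := Y) (f' := Y') (a := 0)
    (b := s - r) (K := max (1 / (4 * r)) (f r ^ 4 + f r ^ 2 + m))
    (fun t ht => (hY t ht).continuousAt.continuousWithinAt)
    (fun t ht => (hY t ⟨ht.1, ht.2.le⟩).hasDerivWithinAt) (by simp [Y, hK0, ← h0])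
    (fun t ht => by
      have hp := hpos t ⟨ht.1, ht.2.le⟩
      have hrt : r ≤ s - t := by linarith [ht.2]
      refine max_le ?_ ?_
      · calc ‖-(flux m f (s - t) / (4 * (s - t)))‖ = 1 / (4 * (s - t)) * ‖flux m f (s - t)‖ := by
              rw [norm_neg, norm_div, Real.norm_of_nonneg (by positivity : 0 ≤ 4 * (s - t))]
              ring
          _ ≤ 1 / (4 * r) * ‖flux m f (s - t)‖ := by gcongr
          _ ≤ _ := mul_le_mul (le_max_left _ _) (le_max_right _ _) (norm_nonneg _)
            (le_max_of_le_left (by positivity))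
      · have h1 := hf hr (show s - t ∈ Ioi (0 : ℝ) from hp) hrt
        have h2 := hf0 (s - t)
        have h3 : ‖nonlin m f (s - t)‖ ≤ (f r ^ 4 + f r ^ 2 + m) * f (s - t) := by
          set q := f (s - t)
          have e : nonlin m f (s - t) = (q ^ 4 - q ^ 2 + m) * q := by
            simp only [nonlin, q]
            ring
          rw [e, norm_mul, Real.norm_of_nonneg h2]
          gcongr
          rw [Real.norm_eq_abs, abs_le]
          have h4 : q ^ 4 ≤ f r ^ 4 := by gcongr
          have h5 : q ^ 2 ≤ f r ^ 2 := by gcongr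
          have h6 : 0 ≤ q ^ 4 := by positivity
          have h7 : 0 ≤ q ^ 2 := by positivity
          constructor <;> linarith
        calc ‖-nonlin m f (s - t)‖ ≤ (f r ^ 4 + f r ^ 2 + m) * ‖f (s - t)‖ := by
              rw [norm_neg, Real.norm_of_nonneg h2]
              exact h3
          _ ≤ _ := mul_le_mul (le_max_right _ _) (le_max_left _ _) (norm_nonneg _)
            (le_max_of_le_left (by positivity))) (s - r) ⟨by linarith, le_rfl⟩
  have := congrArg Prod.fst hz
  simp only [Y, sub_sub_cancel, Prod.fst_zero] at this
  exact hr0 this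

/-- For a bounded decreasing profile the right limit at 0 is the supremum; this is the value given
at the origin, and to negative arguments so that the extension is continuous on ℝ. -/
theorem exists_continuous_extension (hf : AntitoneOn f (Ioi 0)) (hb : BddAbove (f '' Ioi 0))
    (hc : ∀ s, 0 < s → ContinuousAt f s) (hpos : ∀ s, 0 < s → 0 < f s) :
    ∃ F : ℝ → ℝ, Continuous F ∧ (∀ s, 0 < F s) ∧ ∀ s, 0 < s → F s = f s := by
  set L := sSup (f '' Ioi 0)
  have hL : 0 < L := (hpos 1 one_pos).trans_le (le_csSup hb ⟨1, mem_Ioi.2 one_pos, rfl⟩)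
  have ht : Tendsto f (𝓝[>] 0) (𝓝 L) := hf.tendsto_nhdsGT hb
  refine ⟨fun s => if 0 < s then f s else L, continuous_iff_continuousAt.2 fun s => ?_,
    fun s => ?_, fun s hs => if_pos hs⟩
  · rcases lt_trichotomy s 0 with h | rfl | h
    · refine continuousAt_const.congr (f := fun _ => L) ?_
      filter_upwards [Iio_mem_nhds h] with t ht
      rw [if_neg (not_lt.2 (le_of_lt ht))]
    · rw [continuousAt_iff_continuous_left'_right']
      constructor
      · refine (continuousWithinAt_const (b := L)).congr (fun t ht => ?_) (by simp)
        rw [if_neg (not_lt.2 (le_of_lt ht))]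
      · have e : (fun s => if 0 < s then f s else L) 0 = L := if_neg (lt_irrefl _)
        unfold ContinuousWithinAt
        rw [e]
        refine ht.congr' ?_
        filter_upwards [self_mem_nhdsWithin] with t ht
        rw [if_pos (mem_Ioi.1 ht)]
    · refine (hc s h).congr ?_
      filter_upwards [Ioi_mem_nhds h] with t ht
      rw [if_pos (mem_Ioi.1 ht)]
  · simp only []
    split_ifs with h
    · exact hpos s h
    · exact hL

end CubicQuintic

end

noncomputable section

namespace CubicQuintic

open Filter Topology Set
open scoped ENNReal NNReal RealInnerProductSpace

/-! ### The minimizer -/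

theorem exists_positive_minimizer {α : ℝ} (hα : 0 < α) : ∃ Q : Plane → ℝ, Continuous Q ∧
    (∀ x, 0 < Q x) ∧ IsRadial Q ∧ ∃ g, IsH1 (toComplex Q) g ∧ F α (toComplex Q) = C α ∧
      0 < ∫ x, ‖g x‖ ^ 2 ∧ ∫ x, ‖toComplex Q x‖ ^ 6 = 3 / 2 * α * ∫ x, ‖g x‖ ^ 2 ∧
      ∫ x, ‖toComplex Q x‖ ^ 4 = 2 * (1 + α) * ∫ x, ‖g x‖ ^ 2 := by
  obtain ⟨f, hfa, hfm, hf0, g, hg, hF, hA, hD, hE⟩ := exists_normalized_minimizer hα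
  set q : Plane → ℝ := fun x => f (‖x‖ ^ 2)
  have h6 : IntegrableOn (fun s => f s ^ 6) (Ioi 0) := by
    rw [← integrable_comp_norm_sq_iff (hfm.pow_const 6).aestronglyMeasurable]
    have := hg.integrable_pow_six
    simp only [norm_toComplex_pow _ _ (show Even 6 by decide)] at this
    exact this
  have hd := fun s hs => hasDerivAt_profile hfa hfm h6 (fun η h1 h2 h3 =>
    radial_weak_equation hfa hfm h6 (fun φ hφ => hg.euler_lagrange hα hF hA hD hE hφ) h1 h2 h3)
    (s := s) hs
  have hm0 : 0 ≤ (2 + α) / 2 * ((∫ x, ‖g x‖ ^ 2) / ∫ x, ‖toComplex q x‖ ^ 2) :=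
    mul_nonneg (by positivity) (div_nonneg hA.le (integral_nonneg fun x => by positivity))
  have hx0 : ∀ᵐ x : Plane, 0 < ‖x‖ ^ 2 := by
    have : ∀ᵐ x : Plane, x ≠ 0 := measure_eq_zero_iff_ae_notMem.1 (measure_singleton 0)
    filter_upwards [this] with x hx
    positivity
  have hne : ∃ s, 0 < s ∧ f s ≠ 0 := by
    by_contra! h
    have h1 : ∫ x, ‖toComplex q x‖ ^ 4 = 0 := by
      refine integral_eq_zero_of_ae ?_
      filter_upwards [hx0] with x hx
      simp [toComplex, q, h _ hx]
    rw [hE] at h1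
    have : 0 < 2 * (1 + α) * ∫ x, ‖g x‖ ^ 2 := by positivity
    exact this.ne' h1
  obtain ⟨G, hGc, hG0, hGf⟩ := exists_continuous_extension hfa
    (exists_profile_bound hfa hfm hf0 h6 hm0 hd) (fun s hs => (hd s hs).continuousAt)
    fun s hs => profile_pos hfa hfm hf0 h6 hm0 hd hne hs
  have hae : toComplex q =ᵐ[volume] toComplex fun x => G (‖x‖ ^ 2) := by
    filter_upwards [hx0] with x hx
    simp only [toComplex, q, hGf _ hx]
  have hg' := hg.congr hae (EventuallyEq.refl _ g)
  have hI : ∀ k : ℕ, ∫ x, ‖toComplex (fun x => G (‖x‖ ^ 2)) x‖ ^ k = ∫ x, ‖toComplex q x‖ ^ k :=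
    fun k => integral_congr_ae (hae.symm.mono fun x hx => by simp only [hx])
  refine ⟨fun x => G (‖x‖ ^ 2), by fun_prop, fun x => hG0 _, fun x y hxy => by simp only [hxy],
    g, hg', ?_, hA, ?_, ?_⟩
  · rw [hg'.F_eq, hI, hI, hI, ← hg.F_eq, hF]
  · rw [hI, hD]
  · rw [hI, hE]

/-! ### Norms and the value of the infimum -/

theorem IsH1.lpNorm_weakGrad_rpow {u : Plane → ℂ} {g : Plane → EuclideanSpace ℂ (Fin 2)}
    (h : IsH1 u g) (p : ℝ) :
    lpNorm (weakGrad u) 2 volume ^ p = (∫ x, ‖g x‖ ^ 2) ^ (p / 2) := by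
  rw [lpNorm_congr_ae' h.1.weakGrad_ae_eq]
  exact_mod_cast lpNorm_rpow_eq_integral h.3.1 2 two_ne_zero p

theorem IsH1.lpNorm_rpow {u : Plane → ℂ} {g : Plane → EuclideanSpace ℂ (Fin 2)}
    (h : IsH1 u g) (p : ℝ) : lpNorm u 2 volume ^ p = (∫ x, ‖u x‖ ^ 2) ^ (p / 2) := by
  exact_mod_cast lpNorm_rpow_eq_integral h.2.1 2 two_ne_zero p

theorem quotient_normalized {α A B : ℝ} (hα : 0 < α) (hA : 0 < A) :
    quotient α A B (3 / 2 * α * A) (2 * (1 + α) * A) =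
      (3 / 2 * α) ^ (α / (2 * (1 + α))) / (2 * (1 + α)) * B ^ ((2 + α) / (1 + α) / 2) *
        A ^ (-(α / (1 + α)) / 2) := by
  unfold quotient
  have h1 : (1 + α) ≠ 0 := by positivity
  rw [Real.mul_rpow (by positivity) hA.le, show (2 + α) / (2 * (1 + α)) = (2 + α) / (1 + α) / 2 by
    field_simp]
  -- The exponents satisfy 1/(1+α) + α/(2(1+α)) = 1 − α/(2(1+α)); the remaining factor A cancels
  -- against the denominator.
  have e : A ^ (1 / (1 + α)) * A ^ (α / (2 * (1 + α))) = A ^ (-(α / (1 + α)) / 2) * A := by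
    rw [← Real.rpow_add hA, ← Real.rpow_add_one hA.ne']
    congr 1
    field_simp
    ring
  rw [div_eq_iff (by positivity)]
  calc _ = (A ^ (1 / (1 + α)) * A ^ (α / (2 * (1 + α)))) * B ^ ((2 + α) / (1 + α) / 2) *
        (3 / 2 * α) ^ (α / (2 * (1 + α))) := by ring
    _ = _ := by
      rw [e]
      field_simp

end CubicQuintic

end

theorem theorem3p2 (α : ℝ) (hα : 0 < α) :
    ∃ Q : CubicQuintic.Plane → ℝ,
      Continuous Q ∧ (∀ x, 0 < Q x) ∧ CubicQuintic.IsRadial Q ∧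
      CubicQuintic.IsMinimizer α (CubicQuintic.toComplex Q) ∧
      CubicQuintic.F α (CubicQuintic.toComplex Q) = CubicQuintic.C α ∧
      CubicQuintic.IsSolution
        ((2 + α) / 2 * (lpNorm (CubicQuintic.weakGrad (CubicQuintic.toComplex Q)) 2 volume ^ 2 /
          lpNorm (CubicQuintic.toComplex Q) 2 volume ^ 2)) Q ∧
      CubicQuintic.beta (CubicQuintic.toComplex Q) = 3 / 2 * α ∧
      CubicQuintic.C α =
        (3 / 2 * α) ^ (α / (2 * (1 + α))) / (2 * (1 + α)) *
          lpNorm (CubicQuintic.toComplex Q) 2 volume ^ ((2 + α) / (1 + α)) *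
          lpNorm (CubicQuintic.weakGrad (CubicQuintic.toComplex Q)) 2 volume ^
            (-(α / (1 + α))) := by
  obtain ⟨Q, hc, hpos, hr, g, hg, hF, hA, hD, hE⟩ := CubicQuintic.exists_positive_minimizer hα
  have hmem := hg.mem_H1Nonzero (by rw [hE]; positivity)
  have nA : lpNorm (CubicQuintic.weakGrad (CubicQuintic.toComplex Q)) 2 volume ^ 2 =
      ∫ x, ‖g x‖ ^ 2 := by
    have := hg.lpNorm_weakGrad_rpow 2
    simpa using this
  have nB : lpNorm (CubicQuintic.toComplex Q) 2 volume ^ 2 =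
      ∫ x, ‖CubicQuintic.toComplex Q x‖ ^ 2 := by
    have := hg.lpNorm_rpow 2
    simpa using this
  refine ⟨Q, hc, hpos, hr, ⟨hmem, fun v hv => ?_⟩, hF, ⟨hc.locallyIntegrable,
    (hc.pow 3).locallyIntegrable, (hc.pow 5).locallyIntegrable, fun φ hφ => ?_⟩, ?_, ?_⟩
  · simp only [Set.mem_ofPred_eq]
    rw [hF]
    exact CubicQuintic.C_le hv
  · rw [nA, nB]
    exact hg.euler_lagrange hα hF hA hD hE hφ
  · have e : ∫ x, ‖CubicQuintic.weakGrad (CubicQuintic.toComplex Q) x‖ ^ 2 = ∫ x, ‖g x‖ ^ 2 :=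
      integral_congr_ae (hg.1.weakGrad_ae_eq.mono fun x hx => by simp only [hx])
    rw [CubicQuintic.beta, e, hD, mul_div_cancel_right₀ _ hA.ne']
  · rw [hg.lpNorm_weakGrad_rpow, hg.lpNorm_rpow, ← CubicQuintic.quotient_normalized hα hA, ← hF,
      hg.F_eq, hD, hE]
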